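/- Let $T>0$. Consider on $[0,1]\times[0,T]$ the system $$\eta_t+u_x+\alpha(\eta u)_x=0,\qquad u_t+\eta_x+\beta\,uu_x+\gamma\,\eta\eta_x-\tfrac13u_{xxt}=0,\qquad u(0,t)=u(1,t)=0,$$ with initial data $\eta_0=\eta(\cdot,0)$, $u_0=u(\cdot,0)$, where $(\alpha,\beta,\gamma)=(1,1,0)$ (the classical Boussinesq system (CB)) or $(\alpha,\beta,\gamma)=(\tfrac12,\tfrac32,\tfrac12)$ (the symmetric system (SCB)). Write $(f,g)=\int_0^1fg\,dx$, $\|f\|=(f,f)^{1/2}$, $a(f,g)=(f,g)+\tfrac13(f',g')$, $\|f\|_1=a(f,f)^{1/2}$. For integers $N,M\ge1$ let $h=1/N$, $k=T/M$, $t^n=nk$. Let $S_h$ be the space of continuous functions on $[0,1]$ that are affine on each interval $[jh,(j+1)h]$, $0\le j<N$, and $S_{h,0}=\{\phi\in S_h:\phi(0)=\phi(1)=0\}$; let $I_h$, $I_{h,0}$ be the interpolation operators at the (respectively interior) mesh points into $S_h$, $S_{h,0}$, let $P$ be the $L^2(0,1)$-projection onto $S_h$, and let $A:L^2(0,1)\to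 S_{h,0}$ be defined by $a(Af,\chi)=(f,\chi)$ for all $\chi\in S_{h,0}$. The improved Euler, piecewise linear Galerkin scheme seeks $H_h^n\in S_h$, $U_h^n\in S_{h,0}$ for $0\le n\le M$ and $H_h^{n,1}\in S_h$, $U_h^{n,1}\in S_{h,0}$ for $0\le n\le M-1$ such that $H_h^0=I_h\eta_0$, $U_h^0=I_{h,0}u_0$ and, for $0\le n\le M-1$, $$\begin{aligned} H_h^{n,1}-H_h^n+\tfrac k2PU_{hx}^n+\tfrac{k}{2}\alpha P(H_h^nU_h^n)_x&=0,\\ U_h^{n,1}-U_h^n+\tfrac k2AH_{hx}^n+\tfrac k2\beta A(U_h^nU_{hx}^n)+\tfrac k2\gamma A(H_h^nH_{hx}^n)&=0,\\ H_h^{n+1}-H_h^n+kPU_{hx}^{n,1}+k\alpha P(H_h^{n,1}U_h^{n,1})_x&=0,\\ U_h^{n+1}-U_h^n+kAH_{hx}^{n,1}+k\beta A(U_h^{n,1}U_{hx}^{n,1})+k\gamma A(H_h^{n,1}H_{hx}^{n,1})&=0. \end{aligned}$$ Suppose that $(\eta,u)$ is a sufficiently smooth solution of (CB) or of (SCB),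 that is, of class $C^r$ on $[0,1]\times[0,T]$, where $r$ is a suitable absolute integer. Then there are $h_0>0$ and an increasing continuous function $C:[0,\infty)\to\mathbb R$ such that, for all $N,M\ge1$ with $h\le h_0$, the scheme has a solution, and every solution of it satisfies, with $\mu=k/h^{4/3}$, $$\max_{0\le n\le M}\|H_h^n-\eta(t^n)\|\le C(\mu)\,(k^2+h^{3/2}),\qquad \max_{0\le n\le M}\|U_h^n-u(t^n)\|_1\le C(\mu)\,(k^2+h).$$ In particular, if $k=O(h^{4/3})$, both bounds hold with a constant independent of $h$ and $k$. -/

import Mathlib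

namespace Boussinesq

open Set

noncomputable section

/-- The two initial-boundary-value problems under study. -/
inductive System where
  /-- The classical Boussinesq system (CB). -/
  | cb
  /-- The symmetric classical Boussinesq system (SCB). -/
  | scb

/-- Coefficient of `(η u)_x` in the first equation: `1` for (CB), `1/2` for (SCB). -/
def System.coeffEU : System → ℝ
  | .cb => 1
  | .scb => 1 / 2

/-- Coefficient of `u u_x` in the second equation: `1` for (CB), `3/2` for (SCB). -/
def System.coeffUU : System → ℝ
  | .cb => 1
  | .scb => 3 / 2

/-- Coefficient of `η η_x` in the second equation: `0` for (CB), `1/2` for (SCB). -/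
def System.coeffEE : System → ℝ
  | .cb => 0
  | .scb => 1 / 2

/-- Partial derivative in `x` on `[0,1]` (one-sided at the endpoints) of `w = w(x,t)`. -/
def dx (w : ℝ → ℝ → ℝ) : ℝ → ℝ → ℝ :=
  fun x t => derivWithin (fun y => w y t) (Icc 0 1) x

/-- Partial derivative in `t` on `[0,T]` (one-sided at the endpoints) of `w = w(x,t)`. -/
def dt (T : ℝ) (w : ℝ → ℝ → ℝ) : ℝ → ℝ → ℝ :=
  fun x t => derivWithin (fun s => w x s) (Icc 0 T) t

/-- `(η, u)` is a solution of the system on `[0,1] × [0,T]` which is of class `C^r` on that closed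
rectangle. The initial data are `η₀ = η(·,0)` and `u₀ = u(·,0)`. The equations are
* `η_t + u_x + coeffEU (η u)_x = 0`,
* `u_t + η_x + coeffUU u u_x + coeffEE η η_x - (1/3) u_xxt = 0`,
with `u = 0` at `x = 0` and at `x = 1`. -/
structure IsSolution (sys : System) (r : ℕ) (T : ℝ) (η u : ℝ → ℝ → ℝ) : Prop where
  smooth_eta : ContDiffOn ℝ r (fun p : ℝ × ℝ => η p.1 p.2) (Icc 0 1 ×ˢ Icc 0 T)
  smooth_u : ContDiffOn ℝ r (fun p : ℝ × ℝ => u p.1 p.2) (Icc 0 1 ×ˢ Icc 0 T)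
  eq_eta : ∀ x ∈ Icc (0 : ℝ) 1, ∀ t ∈ Icc (0 : ℝ) T,
    dt T η x t + dx u x t + sys.coeffEU * dx (fun y s => η y s * u y s) x t = 0
  eq_u : ∀ x ∈ Icc (0 : ℝ) 1, ∀ t ∈ Icc (0 : ℝ) T,
    dt T u x t + dx η x t + sys.coeffUU * (u x t * dx u x t)
      + sys.coeffEE * (η x t * dx η x t) - 1 / 3 * dt T (dx (dx u)) x t = 0
  bc_left : ∀ t ∈ Icc (0 : ℝ) T, u 0 t = 0
  bc_right : ∀ t ∈ Icc (0 : ℝ) T, u 1 t = 0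

/-- The `L²(0,1)` inner product. -/
def ip (f g : ℝ → ℝ) : ℝ := ∫ x in (0 : ℝ)..1, f x * g x

/-- The bilinear form `a(ψ,χ) = (ψ,χ) + (1/3) (ψ',χ')`. Functions to which it is applied are
piecewise smooth, so that the almost everywhere defined classical derivative is the weak one. -/
def aForm (f g : ℝ → ℝ) : ℝ := ip f g + 1 / 3 * ip (deriv f) (deriv g)

/-- The `L²(0,1)` norm. -/
def l2Norm (f : ℝ → ℝ) : ℝ := Real.sqrt (ip f f)

/-- The `H¹(0,1)` norm `‖v‖₁ = (‖v‖² + (1/3) ‖v'‖²)^{1/2}`. -/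
def h1Norm (f : ℝ → ℝ) : ℝ := Real.sqrt (aForm f f)

/-- The space `S_h` of functions that are continuous on `[0,1]` and affine on every cell
`[j/N, (j+1)/N]` of the uniform mesh with `h = 1/N`. Only the values on `[0,1]` matter. -/
def Sh (N : ℕ) : Set (ℝ → ℝ) :=
  {φ | ContinuousOn φ (Icc 0 1) ∧
    ∀ j < N, ∃ a b : ℝ, ∀ x ∈ Icc ((j : ℝ) / N) (((j : ℝ) + 1) / N), φ x = a + b * x}

/-- The subspace `S_{h,0}` of functions of `S_h` that vanish at `0` and at `1`. -/
def Sh0 (N : ℕ) : Set (ℝ → ℝ) := {φ | φ ∈ Sh N ∧ φ 0 = 0 ∧ φ 1 = 0}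

/-- The nodal (hat) basis function at the node `j/N`. -/
def hat (N j : ℕ) (x : ℝ) : ℝ := max 0 (1 - |(N : ℝ) * x - j|)

/-- The interpolant `I_h v` in `S_h`. -/
def interp (N : ℕ) (v : ℝ → ℝ) (x : ℝ) : ℝ :=
  ∑ j ∈ Finset.range (N + 1), v ((j : ℝ) / N) * hat N j x

/-- The interpolant `I_{h,0} v` in `S_{h,0}`, at the interior nodes. -/
def interp0 (N : ℕ) (v : ℝ → ℝ) (x : ℝ) : ℝ :=
  ∑ j ∈ Finset.Ioo 0 N, v ((j : ℝ) / N) * hat N j x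

/-- One explicit substep with step length `τ`: `(H', U') ∈ S_h × S_{h,0}` is obtained from the
base point `(H, U)` with the right-hand side evaluated at `(G, V)`, that is,
* `(H' - H, φ) + τ (V_x, φ) + τ coeffEU ((G V)_x, φ) = 0` for all `φ ∈ S_h`,
* `a(U' - U, χ) + τ (G_x, χ) + τ coeffUU (V V_x, χ) + τ coeffEE (G G_x, χ) = 0`
  for all `χ ∈ S_{h,0}`.
With the `L²` projection `P` onto `S_h`, and `A f ∈ S_{h,0}` given by `a(A f, χ) = (f, χ)`, these say
`H' - H + τ P V_x + τ coeffEU P (G V)_x = 0` and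
`U' - U + τ A G_x + τ coeffUU A (V V_x) + τ coeffEE A (G G_x) = 0`. -/
structure IsSubstep (sys : System) (N : ℕ) (τ : ℝ) (H U G V H' U' : ℝ → ℝ) : Prop where
  mem_H : H' ∈ Sh N
  mem_U : U' ∈ Sh0 N
  eq_H : ∀ φ ∈ Sh N,
    ip (fun x => H' x - H x) φ + τ * ip (deriv V) φ
      + τ * sys.coeffEU * ip (deriv fun x => G x * V x) φ = 0
  eq_U : ∀ χ ∈ Sh0 N,
    aForm (fun x => U' x - U x) χ + τ * ip (deriv G) χ
      + τ * sys.coeffUU * ip (fun x => V x * deriv V x) χ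
      + τ * sys.coeffEE * ip (fun x => G x * deriv G x) χ = 0

/-- The improved Euler, piecewise linear Galerkin scheme with `M` steps of length `k`, mesh length
`h = 1/N` and initial data `η₀`, `u₀`. Here `H n`, `U n` (`n ≤ M`) are the approximations at time
`n k`, and `Hs n`, `Us n` (`n < M`) are the intermediate stages. -/
structure IsImprovedEuler (sys : System) (N M : ℕ) (k : ℝ) (η₀ u₀ : ℝ → ℝ)
    (H U Hs Us : ℕ → ℝ → ℝ) : Prop where
  mem_H : ∀ n ≤ M, H n ∈ Sh N
  mem_U : ∀ n ≤ M, U n ∈ Sh0 N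
  init_H : EqOn (H 0) (interp N η₀) (Icc 0 1)
  init_U : EqOn (U 0) (interp0 N u₀) (Icc 0 1)
  stage : ∀ n < M, IsSubstep sys N (k / 2) (H n) (U n) (H n) (U n) (Hs n) (Us n)
  step : ∀ n < M, IsSubstep sys N k (H n) (U n) (Hs n) (Us n) (H (n + 1)) (U (n + 1))

end

end Boussinesq

/-!
In nodal coordinates the scheme is the explicit midpoint rule, with step `k`, for an ordinary
differential equation `x' = F x = L x + Q x x` in the finite-dimensional space `S_h × S_{h,0}`, here
`State N`, with the inner product `(H, φ) + a(U, χ)` (`isSubstep_iff`). So it has exactly one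
solution, and the theorem is a statement about consistency and stability.

*Consistency.* Let `w t` be the nodal values of `(η, u)` at time `t`. Testing with piecewise affine
functions, the defect `w' - F w` consists of interpolation errors, of order `h²`, and of errors of
the trapezoidal rule for the fluxes, paired with the slope of the test function. In the second
equation the slope is controlled by the norm of the test function, which gives `h²`. In the first
one it is not; there the uniformity of the mesh helps: quadrature errors of neighbouring cells agree
up to `h³`, so summation by parts costs nothing, except for two boundary terms. Since nodal values
are bounded only by `h^{-1/2}` times the norm, these reduce the order to `h^{3/2}`
(`State.abs_sum_fwd_H_mul_le`, `norm_residual_le`).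

*Stability.* The linearization `B` of `F` at a smooth state is `O(1 / h)`, but its symmetric part is
bounded uniformly in the mesh: the linear terms involve only slopes of the second component, and the
unbounded transport term `(H_x, w φ)` is skew-symmetric up to a bounded term, because its velocity
`w` vanishes at both ends (`State.abs_linearizedField_symm_le`). Therefore
`‖(1 + k B + k² B² / 2) e‖ ≤ (1 + C k) ‖e‖` as soon as `k³ ≤ m³ h⁴`, since the only term that is not
controlled by the symmetric part is `k⁴ ‖B² e‖² / 4` (`norm_rk2_linear_le`). The quadratic remainder
in the error is `O(‖e‖² / h)`, harmless while `‖e‖ ≤ h`; a bound of order `h^{3/2}` maintains this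
on fine meshes (`exists_midpoint_error_step`, `le_exp_mul_of_conditional_recursion`,
`exists_norm_eulerSeq_sub_le`).

*The dependence on `μ`.* How fine the mesh has to be depends on `m`, while `h₀` must not depend on
`μ`. Take for `h₀` the threshold for `m = 1`. For `m > 1`, a mesh with `h ≤ h₀` that is not fine
enough for `m` and violates `k³ ≤ h⁴` has both `h` and `k` bounded below, which leaves finitely many
pairs `(N, M)`; each has a finite error, by uniqueness of the discrete solution
(`exists_errorBound_threshold`). A continuous increasing majorant of the resulting constants is the
function `C`.
-/

namespace Boussinesq

noncomputable section

/-! ### The explicit midpoint rule for a quadratic vector field -/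

section AbstractRK

variable {V : Type} [NormedAddCommGroup V] [InnerProductSpace ℝ V]

/-- Stability of the explicit midpoint rule for `x' = B x` when `B` is skew-symmetric up to a
bounded part but is itself only `O(1 / h)`. In the expansion of the square all inner products are
controlled by the bounded part, and what remains is `k ^ 4 / 4 * ‖B (B e)‖ ^ 2 ≲ k ^ 4 / h ^ 4`. It
is `O(k)` precisely when `k ^ 3 ≲ h ^ 4`, which is where the exponent `4 / 3` comes from. -/
theorem norm_rk2_linear_le (B : V →ₗ[ℝ] V) {c h k m : ℝ} (hc : 0 ≤ c) (hm : 0 ≤ m)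
    (hh : 0 < h) (hk : 0 ≤ k) (hkh : k ≤ m * h) (hk3 : k ^ 3 ≤ m ^ 3 * h ^ 4)
    (hB : ∀ x, ‖B x‖ ≤ c / h * ‖x‖)
    (hS : ∀ x y, |inner ℝ (B x) y + inner ℝ x (B y)| ≤ c * ‖x‖ * ‖y‖) (e : V) :
    ‖e + k • B e + (k ^ 2 / 2) • B (B e)‖
      ≤ (1 + (c + c ^ 2 * m + c ^ 3 * m ^ 2 + c ^ 4 * m ^ 3) * k) * ‖e‖ := by
  set f := B e with hf
  set g := B f with hg
  have hkh' : k / h ≤ m := by rwa [div_le_iff₀ hh]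
  have h1 : 2 * inner ℝ e f ≤ c * ‖e‖ ^ 2 := by
    have := (le_abs_self _).trans (hS e e)
    rw [← hf, real_inner_comm e f] at this
    linarith
  have h2 : inner ℝ f f + inner ℝ e g ≤ c * ‖e‖ * ‖f‖ := by
    simpa [← hf, ← hg] using (le_abs_self _).trans (hS e f)
  have h3 : 2 * inner ℝ f g ≤ c * ‖f‖ ^ 2 := by
    have := (le_abs_self _).trans (hS f f)
    rw [← hg, real_inner_comm f g] at this
    linarith
  have hfe : ‖f‖ ≤ c / h * ‖e‖ := hB e
  have hgf : ‖g‖ ≤ c / h * ‖f‖ := hB f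
  have hge : ‖g‖ ≤ (c / h) ^ 2 * ‖e‖ := by
    calc ‖g‖ ≤ c / h * ‖f‖ := hgf
      _ ≤ c / h * (c / h * ‖e‖) := by gcongr
      _ = _ := by ring
  have hexp : ‖e + k • f + (k ^ 2 / 2) • g‖ ^ 2
      = ‖e‖ ^ 2 + k * (2 * inner ℝ e f) + k ^ 2 * (inner ℝ f f + inner ℝ e g)
        + k ^ 3 / 2 * (2 * inner ℝ f g) + k ^ 4 / 4 * ‖g‖ ^ 2 := by
    rw [← real_inner_self_eq_norm_sq, ← real_inner_self_eq_norm_sq, ← real_inner_self_eq_norm_sq]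
    simp only [inner_add_left, inner_add_right, real_inner_smul_left, real_inner_smul_right]
    rw [real_inner_comm e f, real_inner_comm e g, real_inner_comm f g]
    ring
  have t1 : k * (2 * inner ℝ e f) ≤ k * (c * ‖e‖ ^ 2) := by gcongr
  have t2 : k ^ 2 * (inner ℝ f f + inner ℝ e g) ≤ k * (c ^ 2 * m * ‖e‖ ^ 2) := by
    calc k ^ 2 * (inner ℝ f f + inner ℝ e g) ≤ k ^ 2 * (c * ‖e‖ * ‖f‖) := by gcongr
      _ ≤ k ^ 2 * (c * ‖e‖ * (c / h * ‖e‖)) := by gcongr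
      _ = k * (c ^ 2 * (k / h) * ‖e‖ ^ 2) := by field_simp
      _ ≤ _ := by gcongr
  have t3 : k ^ 3 / 2 * (2 * inner ℝ f g) ≤ k * (c ^ 3 * m ^ 2 * ‖e‖ ^ 2) := by
    calc k ^ 3 / 2 * (2 * inner ℝ f g) ≤ k ^ 3 / 2 * (c * ‖f‖ ^ 2) := by gcongr
      _ ≤ k ^ 3 * (c * ‖f‖ ^ 2) := by
        have : 0 ≤ k ^ 3 * (c * ‖f‖ ^ 2) := by positivity
        linarith
      _ ≤ k ^ 3 * (c * (c / h * ‖e‖) ^ 2) := by gcongr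
      _ = k * (c ^ 3 * (k / h) ^ 2 * ‖e‖ ^ 2) := by field_simp
      _ ≤ _ := by gcongr
  have t4 : k ^ 4 / 4 * ‖g‖ ^ 2 ≤ k * (c ^ 4 * m ^ 3 * ‖e‖ ^ 2) := by
    calc k ^ 4 / 4 * ‖g‖ ^ 2 ≤ k ^ 4 * ‖g‖ ^ 2 := by
          have : 0 ≤ k ^ 4 * ‖g‖ ^ 2 := by positivity
          linarith
      _ ≤ k ^ 4 * ((c / h) ^ 2 * ‖e‖) ^ 2 := by gcongr
      _ = k * (c ^ 4 * (k ^ 3 / h ^ 4) * ‖e‖ ^ 2) := by field_simp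
      _ ≤ _ := by
        gcongr
        rw [div_le_iff₀ (by positivity)]
        exact hk3
  set D := c + c ^ 2 * m + c ^ 3 * m ^ 2 + c ^ 4 * m ^ 3
  have hD : 0 ≤ D := by positivity
  refine le_of_sq_le_sq ?_ (by positivity)
  have : 0 ≤ D * k * ‖e‖ ^ 2 := by positivity
  have : ‖e + k • f + (k ^ 2 / 2) • g‖ ^ 2 ≤ (1 + D * k) * ‖e‖ ^ 2 := by
    rw [hexp]; simp only [D]; linarith
  calc _ ≤ (1 + D * k) * ‖e‖ ^ 2 := this
    _ ≤ (1 + D * k) ^ 2 * ‖e‖ ^ 2 := by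
      gcongr
      nlinarith [mul_nonneg hD hk]
    _ = _ := by ring

/-- The vector field `x ↦ L x + Q x x`. -/
def quadField (L : V →ₗ[ℝ] V) (Q : V →ₗ[ℝ] V →ₗ[ℝ] V) (x : V) : V := L x + Q x x

/-- The linearization of `quadField L Q` at `w`. -/
def linearizedField (L : V →ₗ[ℝ] V) (Q : V →ₗ[ℝ] V →ₗ[ℝ] V) (w : V) : V →ₗ[ℝ] V :=
  L + Q w + Q.flip w

theorem quadField_add_sub (L : V →ₗ[ℝ] V) (Q : V →ₗ[ℝ] V →ₗ[ℝ] V) (w e : V) :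
    quadField L Q (w + e) - quadField L Q w = linearizedField L Q w e + Q e e := by
  simp [quadField, linearizedField]
  abel

set_option maxHeartbeats 1000000 in
/-- Error propagation over one step `X ↦ Y ↦ X'` of the midpoint rule, compared with values `w`,
`v`, `w'` of a smooth curve at the beginning, the middle and the end of the step. The consistency
errors are `r`, `ρ` and `δ`. The field is linearized at `v`; since `Q` is only `O(1 / h)`, the
quadratic remainder is harmless only as long as the error does not exceed `h`. The constant does
not depend on the space. -/
theorem exists_midpoint_error_step (c m : ℝ) (hc : 0 ≤ c) (hm : 0 ≤ m) :
    ∃ K : ℝ, 0 ≤ K ∧ ∀ (V : Type) [NormedAddCommGroup V] [InnerProductSpace ℝ V]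
      (L : V →ₗ[ℝ] V) (Q : V →ₗ[ℝ] V →ₗ[ℝ] V) (h k ε : ℝ)
      (X Y X' w v w' wt r δ ρ : V),
      0 < h → h ≤ 1 → 0 ≤ k → k ≤ m * h → k ^ 3 ≤ m ^ 3 * h ^ 4 → 0 ≤ ε → ε ≤ 1 →
      (∀ x y, ‖Q x y‖ ≤ c / h * ‖x‖ * ‖y‖) →
      (∀ x, ‖linearizedField L Q v x‖ ≤ c / h * ‖x‖) →
      (∀ x y, |inner ℝ (linearizedField L Q v x) y + inner ℝ x (linearizedField L Q v y)|
        ≤ c * ‖x‖ * ‖y‖) →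
      Y = X + (k / 2) • quadField L Q X →
      X' = X + k • quadField L Q Y →
      wt = quadField L Q w + r → ‖r‖ ≤ ε →
      v = w + (k / 2) • wt + ρ → ‖ρ‖ ≤ h * ε → ‖w - v‖ ≤ c * k →
      w' = w + k • quadField L Q v - k • δ → ‖δ‖ ≤ ε →
      ‖X - w‖ ≤ h →
      ‖X' - w'‖ ≤ (1 + K * k) * ‖X - w‖ + K * k * ε := by
  obtain ⟨K₁, hK₁⟩ : ∃ K₁, K₁ = c + c ^ 2 * m + c ^ 3 * m ^ 2 + c ^ 4 * m ^ 3 := ⟨_, rfl⟩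
  obtain ⟨q, hqdef⟩ : ∃ q, q = 2 * c ^ 2 * m + c + 1 := ⟨_, rfl⟩
  obtain ⟨a, hadef⟩ : ∃ a, a = 1 + c * m + m * q + 1 := ⟨_, rfl⟩
  obtain ⟨G, hG⟩ : ∃ G, G = c * (m * q + 1) + c * (2 * a) * a + 1 := ⟨_, rfl⟩
  have hK₁0 : 0 ≤ K₁ := by rw [hK₁]; positivity
  have hq : 0 ≤ q := by rw [hqdef]; positivity
  have ha : 0 ≤ a := by rw [hadef]; positivity
  have hG0 : 0 ≤ G := by rw [hG]; positivity
  refine ⟨K₁ + G, by positivity, ?_⟩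
  intro V _ _ L Q h k ε X Y X' w v w' wt r δ ρ hh hh1 hk hkh hk3 hε hε1 hQ hB hS
    hY hX' hwt hr hv hρ hww hw' hδ he
  set B := linearizedField L Q v with hBdef
  set e := X - w with hedef
  have hkh' : k / h ≤ m := by rwa [div_le_iff₀ hh]
  have hXe : X = w + e := by simp [e]
  set ζ := (k / 2) • (Q (w - v) e + Q e (w - v) + Q e e - r) - ρ with hζ
  -- error of the intermediate stage
  set e₁ := e + (k / 2) • B e + ζ with he₁
  have hYe : Y = v + e₁ := by
    have h1 : quadField L Q X = quadField L Q w + (linearizedField L Q w e + Q e e) := by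
      rw [← quadField_add_sub, ← hXe]; abel
    have h2 : linearizedField L Q w e = B e + (Q (w - v) e + Q e (w - v)) := by
      simp [B, linearizedField]; abel
    have h3 : wt = quadField L Q w + r := hwt
    rw [hY, h1, h2, he₁, hζ]
    linear_combination (norm := module) hXe - hv - (k / 2) • h3
  have hζn : ‖ζ‖ ≤ k * (q * (‖e‖ + ε)) + h * ε := by
    have b1 : ‖Q (w - v) e‖ ≤ c ^ 2 * m * ‖e‖ := by
      calc _ ≤ c / h * ‖w - v‖ * ‖e‖ := hQ _ _
        _ ≤ c / h * (c * k) * ‖e‖ := by gcongr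
        _ = c ^ 2 * (k / h) * ‖e‖ := by ring
        _ ≤ _ := by gcongr
    have b2 : ‖Q e (w - v)‖ ≤ c ^ 2 * m * ‖e‖ := by
      calc _ ≤ c / h * ‖e‖ * ‖w - v‖ := hQ _ _
        _ ≤ c / h * ‖e‖ * (c * k) := by gcongr
        _ = c ^ 2 * (k / h) * ‖e‖ := by ring
        _ ≤ _ := by gcongr
    have b3 : ‖Q e e‖ ≤ c * ‖e‖ := by
      calc _ ≤ c / h * ‖e‖ * ‖e‖ := hQ _ _
        _ ≤ c / h * h * ‖e‖ := by gcongr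
        _ = _ := by field_simp
    have b4 : ‖Q (w - v) e + Q e (w - v) + Q e e - r‖ ≤ q * (‖e‖ + ε) := by
      calc _ ≤ ‖Q (w - v) e‖ + ‖Q e (w - v)‖ + ‖Q e e‖ + ‖r‖ :=
            (norm_sub_le _ _).trans (by gcongr; exact norm_add₃_le)
        _ ≤ c ^ 2 * m * ‖e‖ + c ^ 2 * m * ‖e‖ + c * ‖e‖ + ε := by gcongr
        _ ≤ _ := by
          rw [hqdef]
          have : 0 ≤ (2 * c ^ 2 * m + c) * ε := by positivity
          linarith [norm_nonneg e]
    calc ‖ζ‖ ≤ ‖(k / 2) • (Q (w - v) e + Q e (w - v) + Q e e - r)‖ + ‖ρ‖ := norm_sub_le _ _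
      _ ≤ k / 2 * (q * (‖e‖ + ε)) + h * ε := by
        rw [norm_smul, Real.norm_of_nonneg (by positivity)]; gcongr
      _ ≤ _ := by
        have : 0 ≤ k * (q * (‖e‖ + ε)) := by positivity
        linarith
  have hBζ : ‖B ζ‖ ≤ c * (m * q + 1) * (‖e‖ + ε) := by
    calc ‖B ζ‖ ≤ c / h * ‖ζ‖ := hB _
      _ ≤ c / h * (k * (q * (‖e‖ + ε)) + h * ε) := by gcongr
      _ = c * ((k / h) * (q * (‖e‖ + ε)) + ε) := by field_simp
      _ ≤ c * (m * (q * (‖e‖ + ε)) + (‖e‖ + ε)) := by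
        gcongr
        linarith [norm_nonneg e]
      _ = _ := by ring
  have he₁n : ‖e₁‖ ≤ a * (‖e‖ + ε) := by
    calc ‖e₁‖ ≤ ‖e‖ + ‖(k / 2) • B e‖ + ‖ζ‖ := norm_add₃_le
      _ ≤ ‖e‖ + k / 2 * (c / h * ‖e‖) + (k * (q * (‖e‖ + ε)) + h * ε) := by
        rw [norm_smul, Real.norm_of_nonneg (by positivity)]; gcongr; exact hB e
      _ = ‖e‖ + c / 2 * (k / h) * ‖e‖ + ((k / h * h) * (q * (‖e‖ + ε)) + h * ε) := by
        field_simp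
      _ ≤ ‖e‖ + c * m * ‖e‖ + ((m * 1) * (q * (‖e‖ + ε)) + 1 * ε) := by
        gcongr
        linarith
      _ ≤ _ := by
        rw [hadef]
        have : 0 ≤ (1 + c * m) * ε := by positivity
        linarith [norm_nonneg e]
  have he₁h : ‖e₁‖ ≤ 2 * a * h := by
    calc ‖e₁‖ ≤ ‖e‖ + ‖(k / 2) • B e‖ + ‖ζ‖ := norm_add₃_le
      _ ≤ ‖e‖ + k / 2 * (c / h * ‖e‖) + (k * (q * (‖e‖ + ε)) + h * ε) := by
        rw [norm_smul, Real.norm_of_nonneg (by positivity)]; gcongr; exact hB e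
      _ = ‖e‖ + c / 2 * (k / h) * ‖e‖ + ((k / h * h) * (q * (‖e‖ + ε)) + h * ε) := by
        field_simp
      _ ≤ h + c * m * h + ((m * h) * (q * (1 + 1)) + h * 1) := by
        gcongr
        · linarith
        · exact he.trans hh1
      _ ≤ _ := by
        rw [hadef]
        have : 0 ≤ (1 + c * m + 1) * h := by positivity
        linarith
  have hQe₁ : ‖Q e₁ e₁‖ ≤ c * (2 * a) * a * (‖e‖ + ε) := by
    calc ‖Q e₁ e₁‖ ≤ c / h * ‖e₁‖ * ‖e₁‖ := hQ _ _
      _ ≤ c / h * (2 * a * h) * (a * (‖e‖ + ε)) := by gcongr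
      _ = _ := by field_simp
  -- the linear part of the error recursion is the midpoint rule for `B`
  have hfin : X' - w' = (e + k • B e + (k ^ 2 / 2) • B (B e)) + k • (B ζ + Q e₁ e₁ + δ) := by
    have h1 : quadField L Q Y = quadField L Q v + (B e₁ + Q e₁ e₁) := by
      rw [hBdef, ← quadField_add_sub, ← hYe]; abel
    have h2 : B e₁ = B e + (k / 2) • B (B e) + B ζ := by simp [he₁]
    rw [hX', hw', h1, h2, hedef]
    module
  have hlin : _ ≤ (1 + K₁ * k) * _ := hK₁ ▸ norm_rk2_linear_le B hc hm hh hk hkh hk3 hB hS e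
  calc ‖X' - w'‖ ≤ ‖e + k • B e + (k ^ 2 / 2) • B (B e)‖ + ‖k • (B ζ + Q e₁ e₁ + δ)‖ := by
        rw [hfin]; exact norm_add_le _ _
    _ ≤ (1 + K₁ * k) * ‖e‖ + k * (G * (‖e‖ + ε)) := by
      refine add_le_add hlin ?_
      rw [norm_smul, Real.norm_of_nonneg hk]
      gcongr
      calc _ ≤ ‖B ζ‖ + ‖Q e₁ e₁‖ + ‖δ‖ := norm_add₃_le
        _ ≤ c * (m * q + 1) * (‖e‖ + ε) + c * (2 * a) * a * (‖e‖ + ε) + 1 * (‖e‖ + ε) := by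
          gcongr
          linarith [norm_nonneg e]
        _ = _ := by rw [hG]; ring
    _ ≤ _ := by
      have : 0 ≤ K₁ * k * ε := by positivity
      linarith

/-- A discrete Grönwall inequality in which the recursion is available only as long as the
quantity stays below a threshold. -/
theorem le_exp_mul_of_conditional_recursion {a : ℕ → ℝ} {K k ε b : ℝ} {M : ℕ} (hK : 0 ≤ K)
    (hk : 0 ≤ k) (hε : 0 ≤ ε) (h0 : a 0 ≤ 0)
    (hrec : ∀ n < M, a n ≤ b → a (n + 1) ≤ (1 + K * k) * a n + K * k * ε)
    (hb : Real.exp (K * (M * k)) * ε ≤ b) :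
    ∀ n ≤ M, a n ≤ Real.exp (K * (M * k)) * ε := by
  -- this form of the bound is reproduced exactly by the recursion
  have key : ∀ n ≤ M, a n ≤ (Real.exp (K * (n * k)) - 1) * ε := by
    intro n
    induction n with
    | zero => intro _; simpa using h0
    | succ n ih =>
      intro hn
      have h1 := ih (by omega)
      have h2 : a n ≤ b := by
        refine h1.trans (le_trans ?_ hb)
        have : Real.exp (K * (n * k)) ≤ Real.exp (K * (M * k)) := by
          have : (n : ℝ) ≤ M := by exact_mod_cast (by omega : n ≤ M)
          gcongr
        nlinarith
      refine (hrec n (by omega) h2).trans ?_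
      have h3 : (1 + K * k) * Real.exp (K * (n * k)) ≤ Real.exp (K * ((n + 1 : ℕ) * k)) := by
        have : K * ((n + 1 : ℕ) * k) = K * k + K * (n * k) := by push_cast; ring
        rw [this, Real.exp_add]
        gcongr
        linarith [Real.add_one_le_exp (K * k)]
      calc (1 + K * k) * a n + K * k * ε
          ≤ (1 + K * k) * ((Real.exp (K * (n * k)) - 1) * ε) + K * k * ε := by gcongr
        _ = ((1 + K * k) * Real.exp (K * (n * k)) - 1) * ε := by ring
        _ ≤ _ := by gcongr
  intro n hn
  refine (key n hn).trans ?_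
  have : Real.exp (K * (n * k)) ≤ Real.exp (K * (M * k)) := by
    have : (n : ℝ) ≤ M := by exact_mod_cast hn
    gcongr
  nlinarith

end AbstractRK

section

open Finset

/-! ### Cell sums -/

/-- Forward difference of a sequence of nodal values. -/
def fwd (a : ℕ → ℝ) (j : ℕ) : ℝ := a (j + 1) - a j

/-- Mean of the two nodal values of a cell. -/
def avg (a : ℕ → ℝ) (j : ℕ) : ℝ := (a j + a (j + 1)) / 2

/-- Cell mass form: the integral over the unit cell of the product of the affine functions
with nodal values `a j, a (j + 1)` and `b j, b (j + 1)`. -/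
def mass (a b : ℕ → ℝ) (j : ℕ) : ℝ :=
  (2 * a j * b j + a j * b (j + 1) + a (j + 1) * b j + 2 * a (j + 1) * b (j + 1)) / 6

theorem mass_comm (a b : ℕ → ℝ) (j : ℕ) : mass a b j = mass b a j := by
  unfold mass; ring

theorem mass_self_nonneg (a : ℕ → ℝ) (j : ℕ) : 0 ≤ mass a a j := by
  unfold mass; nlinarith [sq_nonneg (a j + a (j + 1)), sq_nonneg (a j), sq_nonneg (a (j + 1))]

theorem sq_add_sq_le_mass (a : ℕ → ℝ) (j : ℕ) : a j ^ 2 + a (j + 1) ^ 2 ≤ 6 * mass a a j := by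
  unfold mass; nlinarith [sq_nonneg (a j + a (j + 1))]

theorem abs_mass_le (a b : ℕ → ℝ) (j : ℕ) :
    |mass a b j| ≤ (|a j| + |a (j + 1)|) * (|b j| + |b (j + 1)|) := by
  have h : ∀ x y : ℝ, |x * y| = |x| * |y| := abs_mul
  unfold mass
  rw [abs_div, abs_of_pos (by norm_num : (0 : ℝ) < 6), div_le_iff₀ (by norm_num)]
  calc _ ≤ |2 * a j * b j| + |a j * b (j + 1)| + |a (j + 1) * b j| + |2 * a (j + 1) * b (j + 1)| :=
        (abs_add_le _ _).trans (by gcongr; exact abs_add_three _ _ _)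
    _ ≤ _ := by
      simp only [h, abs_two]
      have := mul_nonneg (abs_nonneg (a j)) (abs_nonneg (b j))
      have := mul_nonneg (abs_nonneg (a j)) (abs_nonneg (b (j + 1)))
      have := mul_nonneg (abs_nonneg (a (j + 1))) (abs_nonneg (b j))
      have := mul_nonneg (abs_nonneg (a (j + 1))) (abs_nonneg (b (j + 1)))
      linarith

theorem abs_avg_le (a : ℕ → ℝ) (j : ℕ) : |avg a j| ≤ |a j| + |a (j + 1)| := by
  unfold avg
  rw [abs_div, abs_two]
  have := abs_add_le (a j) (a (j + 1))
  linarith [abs_nonneg (a j), abs_nonneg (a (j + 1))]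

theorem abs_fwd_le (a : ℕ → ℝ) (j : ℕ) : |fwd a j| ≤ |a j| + |a (j + 1)| := by
  unfold fwd
  linarith [abs_sub (a (j + 1)) (a j)]

/-- The Leibniz rule for the product of three piecewise affine functions, integrated over a
cell. -/
theorem fwd_mul_mass_add (a b c : ℕ → ℝ) (j : ℕ) :
    fwd a j * mass b c j + fwd b j * mass a c j + fwd c j * mass a b j
      = fwd (fun i => a i * b i * c i) j := by
  unfold fwd mass; ring

theorem sum_fwd (a : ℕ → ℝ) (N : ℕ) : ∑ j ∈ range N, fwd a j = a N - a 0 :=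
  Finset.sum_range_sub a N

/-! ### The discrete state space -/

/-- Pairs of sequences of nodal values, the first supported in `0, …, N`, the second in
`1, …, N - 1`. -/
def stateSubmodule (N : ℕ) : Submodule ℝ ((ℕ → ℝ) × (ℕ → ℝ)) where
  carrier := {x | (∀ j, N < j → x.1 j = 0) ∧ x.2 0 = 0 ∧ ∀ j, N ≤ j → x.2 j = 0}
  add_mem' := by
    rintro x y ⟨h1, h2, h3⟩ ⟨g1, g2, g3⟩
    refine ⟨fun j hj => ?_, ?_, fun j hj => ?_⟩
    · simp [h1 j hj, g1 j hj]
    · simp [h2, g2]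
    · simp [h3 j hj, g3 j hj]
  zero_mem' := by simp
  smul_mem' := by
    rintro c x ⟨h1, h2, h3⟩
    refine ⟨fun j hj => ?_, ?_, fun j hj => ?_⟩
    · simp [h1 j hj]
    · simp [h2]
    · simp [h3 j hj]

/-- The discrete state space `S_h × S_{h,0}` in nodal coordinates. It is a type synonym, so that
it can carry the inner product `(H, φ) + a(U, χ)`. -/
def State (N : ℕ) : Type := stateSubmodule N

namespace State

variable {N : ℕ}

instance : AddCommGroup (State N) := inferInstanceAs (AddCommGroup (stateSubmodule N))

instance : Module ℝ (State N) := inferInstanceAs (Module ℝ (stateSubmodule N))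

/-- Nodal values of the first component. -/
def H (x : State N) : ℕ → ℝ := x.1.1

/-- Nodal values of the second component. -/
def U (x : State N) : ℕ → ℝ := x.1.2

/-- The state with given nodal values; values that a state must not have are discarded. -/
def mk (N : ℕ) (a b : ℕ → ℝ) : State N :=
  ⟨(fun j => if j ≤ N then a j else 0, fun j => if 0 < j ∧ j < N then b j else 0), by
    refine ⟨fun j hj => ?_, ?_, fun j hj => ?_⟩
    · simp [hj]
    · simp
    · simp [hj]⟩

@[simp] theorem H_mk (a b : ℕ → ℝ) (j : ℕ) : (mk N a b).H j = if j ≤ N then a j else 0 := rfl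

@[simp] theorem U_mk (a b : ℕ → ℝ) (j : ℕ) :
    (mk N a b).U j = if 0 < j ∧ j < N then b j else 0 := rfl

@[simp] theorem H_add (x y : State N) (j : ℕ) : (x + y).H j = x.H j + y.H j := rfl

@[simp] theorem U_add (x y : State N) (j : ℕ) : (x + y).U j = x.U j + y.U j := rfl

@[simp] theorem H_smul (c : ℝ) (x : State N) (j : ℕ) : (c • x).H j = c * x.H j := rfl

@[simp] theorem U_smul (c : ℝ) (x : State N) (j : ℕ) : (c • x).U j = c * x.U j := rfl

@[simp] theorem H_sub (x y : State N) (j : ℕ) : (x - y).H j = x.H j - y.H j := rfl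

@[simp] theorem U_sub (x y : State N) (j : ℕ) : (x - y).U j = x.U j - y.U j := rfl

theorem U_zero_eq (x : State N) : x.U 0 = 0 := x.2.2.1

theorem U_eq_zero (x : State N) {j : ℕ} (hj : N ≤ j) : x.U j = 0 := x.2.2.2 j hj

theorem H_eq_zero (x : State N) {j : ℕ} (hj : N < j) : x.H j = 0 := x.2.1 j hj

theorem ext_nodal {x y : State N} (hH : ∀ j ≤ N, x.H j = y.H j)
    (hU : ∀ j, 0 < j → j < N → x.U j = y.U j) : x = y := by
  refine Subtype.ext (Prod.ext (funext fun j => ?_) (funext fun j => ?_))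
  · by_cases hj : j ≤ N
    · exact hH j hj
    · exact (x.H_eq_zero (not_le.1 hj)).trans (y.H_eq_zero (not_le.1 hj)).symm
  · by_cases hj : 0 < j ∧ j < N
    · exact hU j hj.1 hj.2
    · rcases Nat.eq_zero_or_pos j with rfl | h0
      · exact x.U_zero_eq.trans y.U_zero_eq.symm
      · have hN : N ≤ j := by by_contra h; exact hj ⟨h0, not_le.1 h⟩
        exact (x.U_eq_zero hN).trans (y.U_eq_zero hN).symm

instance : FiniteDimensional ℝ (State N) := by
  let f : State N →ₗ[ℝ] (Fin (N + 1) → ℝ) × (Fin (N + 1) → ℝ) :=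
    { toFun := fun x => (fun j => x.H j, fun j => x.U j)
      map_add' := fun _ _ => rfl
      map_smul' := fun _ _ => rfl }
  refine FiniteDimensional.of_injective f fun x y hxy => ?_
  have h1 := congrArg Prod.fst hxy
  have h2 := congrArg Prod.snd hxy
  refine ext_nodal (fun j hj => ?_) fun j _ hj => ?_
  · exact congrFun h1 ⟨j, by omega⟩
  · exact congrFun h2 ⟨j, by omega⟩

/-- The form `(H, φ) + a(U, χ)` on states. -/
def form (x y : State N) : ℝ :=
  ∑ j ∈ range N, (1 / N * mass x.H y.H j + 1 / N * mass x.U y.U j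
    + 1 / 3 * (N * (fwd x.U j * fwd y.U j)))

theorem form_term_nonneg (x : State N) (j : ℕ) :
    0 ≤ 1 / (N : ℝ) * mass x.H x.H j + 1 / N * mass x.U x.U j
      + 1 / 3 * (N * (fwd x.U j * fwd x.U j)) := by
  have h1 := mass_self_nonneg x.H j
  have h2 := mass_self_nonneg x.U j
  have h3 := mul_self_nonneg (fwd x.U j)
  positivity

theorem form_definite [NeZero N] (x : State N) (hx : form x x = 0) : x = 0 := by
  have hN : (0 : ℝ) < N := by exact_mod_cast Nat.pos_of_neZero N
  have h := (sum_eq_zero_iff_of_nonneg fun j _ => form_term_nonneg x j).1 hx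
  have key : ∀ j < N, (x.H j = 0 ∧ x.H (j + 1) = 0) ∧ x.U j = 0 := by
    intro j hj
    have h0 := h j (mem_range.2 hj)
    have h1 := mass_self_nonneg x.H j
    have h2 := mass_self_nonneg x.U j
    have h3 := mul_self_nonneg (fwd x.U j)
    have e1 : 0 ≤ 1 / (N : ℝ) * mass x.H x.H j := by positivity
    have e2 : 0 ≤ 1 / (N : ℝ) * mass x.U x.U j := by positivity
    have e3 : 0 ≤ 1 / 3 * (N * (fwd x.U j * fwd x.U j)) := by positivity
    have f1 : mass x.H x.H j = 0 := by
      have : 1 / (N : ℝ) * mass x.H x.H j = 0 := by linarith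
      simpa [hN.ne'] using this
    have f2 : mass x.U x.U j = 0 := by
      have : 1 / (N : ℝ) * mass x.U x.U j = 0 := by linarith
      simpa [hN.ne'] using this
    have g1 := sq_add_sq_le_mass x.H j
    have g2 := sq_add_sq_le_mass x.U j
    refine ⟨⟨?_, ?_⟩, ?_⟩ <;> refine pow_eq_zero_iff (two_ne_zero) |>.1 ?_ <;>
      nlinarith [sq_nonneg (x.H j), sq_nonneg (x.H (j + 1)), sq_nonneg (x.U j),
        sq_nonneg (x.U (j + 1))]
  refine ext_nodal (fun j hj => ?_) fun j _ hj => (key j hj).2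
  rcases Nat.lt_or_ge j N with hj' | hj'
  · exact (key j hj').1.1
  · have hpos := Nat.pos_of_neZero N
    have := (key (N - 1) (by omega)).1.2
    rw [show N - 1 + 1 = j by omega] at this
    exact this

/-- The inner product `(H, φ) + a(U, χ)` on the discrete state space. -/
@[reducible]
def innerCore (N : ℕ) [NeZero N] : InnerProductSpace.Core ℝ (State N) where
  inner := form
  conj_inner_symm x y := by
    simp only [form, conj_trivial]
    exact sum_congr rfl fun j _ => by rw [mass_comm y.H, mass_comm y.U]; ring
  re_inner_nonneg x := by
    change 0 ≤ form x x
    exact sum_nonneg fun j _ => form_term_nonneg x j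
  add_left x y z := by
    simp only [form, ← sum_add_distrib]
    refine sum_congr rfl fun j _ => ?_
    simp only [mass, fwd, H_add, U_add]; ring
  smul_left x y r := by
    simp only [form, mul_sum, conj_trivial]
    refine sum_congr rfl fun j _ => ?_
    simp only [mass, fwd, H_smul, U_smul]; ring
  definite := form_definite

instance [NeZero N] : NormedAddCommGroup (State N) := (innerCore N).toNormedAddCommGroup

instance [NeZero N] : InnerProductSpace ℝ (State N) :=
  InnerProductSpace.ofCore (innerCore N).toCore

theorem inner_eq [NeZero N] (x y : State N) : inner ℝ x y = form x y := rfl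

theorem norm_sq_eq [NeZero N] (x : State N) : ‖x‖ ^ 2 = form x x := by
  rw [← real_inner_self_eq_norm_sq, inner_eq]

/-- The state that represents a linear functional. -/
def riesz [NeZero N] (f : State N →ₗ[ℝ] ℝ) : State N :=
  (InnerProductSpace.toDual ℝ (State N)).symm (LinearMap.toContinuousLinearMap f)

theorem inner_riesz [NeZero N] (f : State N →ₗ[ℝ] ℝ) (y : State N) : inner ℝ (riesz f) y = f y := by
  simp [riesz]

/-! ### Bounds of nodal values and of cell sums by the norm -/

/-- A local size of a state in the `j`-th cell that dominates the nodal values of both components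
and the slope of the second one. -/
def cellSize (x : State N) (j : ℕ) : ℝ :=
  |x.H j| + |x.H (j + 1)| + |x.U j| + |x.U (j + 1)| + N * |fwd x.U j|

theorem cellSize_nonneg (x : State N) (j : ℕ) : 0 ≤ cellSize x j := by
  unfold cellSize; positivity

theorem sum_cellSize_sq_le [NeZero N] (x : State N) :
    ∑ j ∈ range N, 1 / (N : ℝ) * cellSize x j ^ 2 ≤ 30 * ‖x‖ ^ 2 := by
  have hN : (0 : ℝ) < N := by exact_mod_cast Nat.pos_of_neZero N
  rw [norm_sq_eq, form, mul_sum]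
  refine sum_le_sum fun j _ => ?_
  have h1 := sq_add_sq_le_mass x.H j
  have h2 := sq_add_sq_le_mass x.U j
  have h3 : cellSize x j ^ 2 ≤ 5 * (x.H j ^ 2 + x.H (j + 1) ^ 2 + x.U j ^ 2 + x.U (j + 1) ^ 2
      + N ^ 2 * fwd x.U j ^ 2) := by
    unfold cellSize
    rw [← sq_abs (x.H j), ← sq_abs (x.H (j + 1)), ← sq_abs (x.U j), ← sq_abs (x.U (j + 1)),
      ← sq_abs (fwd x.U j), ← mul_pow]
    generalize |x.H j| = a, |x.H (j + 1)| = b, |x.U j| = c, |x.U (j + 1)| = d,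
      (N : ℝ) * |fwd x.U j| = e
    nlinarith [sq_nonneg (a - b), sq_nonneg (a - c), sq_nonneg (a - d), sq_nonneg (a - e),
      sq_nonneg (b - c), sq_nonneg (b - d), sq_nonneg (b - e), sq_nonneg (c - d),
      sq_nonneg (c - e), sq_nonneg (d - e)]
  calc 1 / (N : ℝ) * cellSize x j ^ 2
      ≤ 1 / N * (5 * (6 * mass x.H x.H j + 6 * mass x.U x.U j + N ^ 2 * fwd x.U j ^ 2)) := by
        gcongr; linarith
    _ = 30 * (1 / N * mass x.H x.H j + 1 / N * mass x.U x.U j)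
        + 5 * (N * (fwd x.U j * fwd x.U j)) := by field_simp; ring
    _ ≤ _ := by
      have : 0 ≤ N * (fwd x.U j * fwd x.U j) := by
        have := mul_self_nonneg (fwd x.U j)
        positivity
      linarith

/-- Cauchy–Schwarz for cell sums. -/
theorem abs_sum_le_of_cellSize [NeZero N] {t : ℕ → ℝ} {K : ℝ} (hK : 0 ≤ K) (x y : State N)
    (ht : ∀ j < N, |t j| ≤ K * (1 / N * (cellSize x j * cellSize y j))) :
    |∑ j ∈ range N, t j| ≤ 30 * K * ‖x‖ * ‖y‖ := by
  have hN : (0 : ℝ) < N := by exact_mod_cast Nat.pos_of_neZero N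
  have hcs : (∑ j ∈ range N, 1 / (N : ℝ) * (cellSize x j * cellSize y j)) ≤ 30 * ‖x‖ * ‖y‖ := by
    refine le_of_sq_le_sq ?_ (by positivity)
    have h := sum_mul_sq_le_sq_mul_sq (range N) (cellSize x) (cellSize y)
    have hx := sum_cellSize_sq_le x
    have hy := sum_cellSize_sq_le y
    rw [← mul_sum] at hx hy ⊢
    calc (1 / (N : ℝ) * ∑ j ∈ range N, cellSize x j * cellSize y j) ^ 2
        = (1 / (N : ℝ)) ^ 2 * (∑ j ∈ range N, cellSize x j * cellSize y j) ^ 2 := by ring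
      _ ≤ (1 / (N : ℝ)) ^ 2
          * ((∑ j ∈ range N, cellSize x j ^ 2) * ∑ j ∈ range N, cellSize y j ^ 2) := by gcongr
      _ = (1 / (N : ℝ) * ∑ j ∈ range N, cellSize x j ^ 2)
          * (1 / (N : ℝ) * ∑ j ∈ range N, cellSize y j ^ 2) := by ring
      _ ≤ (30 * ‖x‖ ^ 2) * (30 * ‖y‖ ^ 2) := by
        refine mul_le_mul hx hy ?_ (by positivity)
        exact mul_nonneg (by positivity) (sum_nonneg fun _ _ => sq_nonneg _)
      _ = _ := by ring
  calc |∑ j ∈ range N, t j| ≤ ∑ j ∈ range N, |t j| := abs_sum_le_sum_abs _ _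
    _ ≤ ∑ j ∈ range N, K * (1 / N * (cellSize x j * cellSize y j)) :=
      sum_le_sum fun j hj => ht j (mem_range.1 hj)
    _ = K * ∑ j ∈ range N, 1 / (N : ℝ) * (cellSize x j * cellSize y j) := by rw [mul_sum]
    _ ≤ K * (30 * ‖x‖ * ‖y‖) := by gcongr
    _ = _ := by ring

/-- The discrete Sobolev inequality: nodal values of the second component are bounded by the
norm. -/
theorem abs_U_le [NeZero N] (x : State N) (j : ℕ) : |x.U j| ≤ 2 * ‖x‖ := by
  have hN : (0 : ℝ) < N := by exact_mod_cast Nat.pos_of_neZero N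
  rcases Nat.lt_or_ge j N with hj | hj
  swap
  · rw [x.U_eq_zero hj, abs_zero]; positivity
  have h1 : x.U j = ∑ i ∈ range j, fwd x.U i := by rw [sum_fwd, x.U_zero_eq, sub_zero]
  refine abs_le_of_sq_le_sq ?_ (by positivity)
  have h2 : (∑ i ∈ range j, fwd x.U i) ^ 2 ≤ N * ∑ i ∈ range N, fwd x.U i ^ 2 := by
    calc (∑ i ∈ range j, fwd x.U i) ^ 2 ≤ (range j).card * ∑ i ∈ range j, fwd x.U i ^ 2 :=
          sq_sum_le_card_mul_sum_sq
      _ ≤ N * ∑ i ∈ range N, fwd x.U i ^ 2 := by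
        refine mul_le_mul (by simpa using hj.le) ?_ (sum_nonneg fun _ _ => sq_nonneg _) hN.le
        exact sum_le_sum_of_subset_of_nonneg (range_mono hj.le) fun _ _ _ => sq_nonneg _
  have h3 : N * ∑ i ∈ range N, fwd x.U i ^ 2 ≤ 3 * ‖x‖ ^ 2 := by
    rw [norm_sq_eq, form, mul_sum, mul_sum]
    refine sum_le_sum fun i _ => ?_
    have e1 := mass_self_nonneg x.H i
    have e2 := mass_self_nonneg x.U i
    have e3 : 0 ≤ 1 / (N : ℝ) * mass x.H x.H i := by positivity
    have e4 : 0 ≤ 1 / (N : ℝ) * mass x.U x.U i := by positivity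
    nlinarith
  rw [h1]
  nlinarith [norm_nonneg x]

theorem abs_H_add_le_cellSize (x : State N) (j : ℕ) :
    |x.H j| + |x.H (j + 1)| ≤ cellSize x j := by
  unfold cellSize
  have : 0 ≤ |x.U j| + |x.U (j + 1)| + N * |fwd x.U j| := by positivity
  linarith

theorem abs_U_add_le_cellSize (x : State N) (j : ℕ) :
    |x.U j| + |x.U (j + 1)| ≤ cellSize x j := by
  unfold cellSize
  have : 0 ≤ |x.H j| + |x.H (j + 1)| + N * |fwd x.U j| := by positivity
  linarith

theorem abs_fwd_U_le_cellSize [NeZero N] (x : State N) (j : ℕ) :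
    |fwd x.U j| ≤ 1 / N * cellSize x j := by
  have hN : (0 : ℝ) < N := by exact_mod_cast Nat.pos_of_neZero N
  rw [one_div, ← div_eq_inv_mul, le_div_iff₀ hN]
  unfold cellSize
  have : 0 ≤ |x.H j| + |x.H (j + 1)| + |x.U j| + |x.U (j + 1)| := by positivity
  linarith

end State

/-! ### The forms of the semidiscrete problem -/

namespace State

variable {N : ℕ}

/-- The linear part `-(U_x, φ) - (H_x, χ)` of the right-hand side, the second term integrated by
parts. -/
def linForm (x z : State N) : ℝ :=
  ∑ j ∈ range N, (fwd z.U j * avg x.H j - fwd x.U j * avg z.H j)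

/-- The quadratic part `-α ((H U)_x, φ) - β (U U_x, χ) - γ (H H_x, χ)` of the right-hand side,
polarized, with the last two terms integrated by parts. -/
def quadForm (α β γ : ℝ) (x y z : State N) : ℝ :=
  ∑ j ∈ range N, (β / 2 * (fwd z.U j * mass x.U y.U j) + γ / 2 * (fwd z.U j * mass x.H y.H j)
    - α * (fwd x.H j * mass y.U z.H j + fwd y.U j * mass x.H z.H j))

/-- The linear operator given by `linForm`. -/
def linOp (N : ℕ) [NeZero N] : State N →ₗ[ℝ] State N where
  toFun x := riesz
    { toFun := fun z => linForm x z
      map_add' := fun z z' => by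
        simp only [linForm, ← sum_add_distrib]
        refine sum_congr rfl fun j _ => ?_
        simp only [avg, fwd, H_add, U_add]; ring
      map_smul' := fun c z => by
        simp only [linForm, mul_sum, smul_eq_mul, RingHom.id_apply]
        refine sum_congr rfl fun j _ => ?_
        simp only [avg, fwd, H_smul, U_smul]; ring }
  map_add' x x' := by
    refine ext_inner_right ℝ fun z => ?_
    simp only [inner_add_left, inner_riesz, LinearMap.coe_mk, AddHom.coe_mk, linForm,
      ← sum_add_distrib]
    refine sum_congr rfl fun j _ => ?_
    simp only [avg, fwd, H_add, U_add]; ring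
  map_smul' c x := by
    refine ext_inner_right ℝ fun z => ?_
    simp only [inner_smul_left, inner_riesz, LinearMap.coe_mk, AddHom.coe_mk, linForm, mul_sum,
      RingHom.id_apply, conj_trivial]
    refine sum_congr rfl fun j _ => ?_
    simp only [avg, fwd, H_smul, U_smul]; ring

theorem inner_linOp [NeZero N] (x z : State N) : inner ℝ (linOp N x) z = linForm x z :=
  inner_riesz _ _

/-- The bilinear operator given by `quadForm`. -/
def quadOp (N : ℕ) [NeZero N] (α β γ : ℝ) : State N →ₗ[ℝ] State N →ₗ[ℝ] State N :=
  LinearMap.mk₂ ℝ (fun x y => riesz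
    { toFun := fun z => quadForm α β γ x y z
      map_add' := fun z z' => by
        simp only [quadForm, ← sum_add_distrib]
        refine sum_congr rfl fun j _ => ?_
        simp only [mass, fwd, H_add, U_add]; ring
      map_smul' := fun c z => by
        simp only [quadForm, mul_sum, smul_eq_mul, RingHom.id_apply]
        refine sum_congr rfl fun j _ => ?_
        simp only [mass, fwd, H_smul, U_smul]; ring })
    (fun x x' y => by
      refine ext_inner_right ℝ fun z => ?_
      simp only [inner_add_left, inner_riesz, LinearMap.coe_mk, AddHom.coe_mk, quadForm,
        ← sum_add_distrib]
      refine sum_congr rfl fun j _ => ?_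
      simp only [mass, fwd, H_add, U_add]; ring)
    (fun c x y => by
      refine ext_inner_right ℝ fun z => ?_
      simp only [inner_smul_left, inner_riesz, LinearMap.coe_mk, AddHom.coe_mk, quadForm, mul_sum,
        conj_trivial]
      refine sum_congr rfl fun j _ => ?_
      simp only [mass, fwd, H_smul, U_smul]; ring)
    (fun x y y' => by
      refine ext_inner_right ℝ fun z => ?_
      simp only [inner_add_left, inner_riesz, LinearMap.coe_mk, AddHom.coe_mk, quadForm,
        ← sum_add_distrib]
      refine sum_congr rfl fun j _ => ?_
      simp only [mass, fwd, H_add, U_add]; ring)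
    (fun c x y => by
      refine ext_inner_right ℝ fun z => ?_
      simp only [inner_smul_left, inner_riesz, LinearMap.coe_mk, AddHom.coe_mk, quadForm, mul_sum,
        conj_trivial]
      refine sum_congr rfl fun j _ => ?_
      simp only [mass, fwd, H_smul, U_smul]; ring)

theorem inner_quadOp [NeZero N] (α β γ : ℝ) (x y z : State N) :
    inner ℝ (quadOp N α β γ x y) z = quadForm α β γ x y z :=
  inner_riesz _ _

/-! ### Boundedness of the forms -/

theorem norm_le_of_inner_le [NeZero N] {x : State N} {C : ℝ} (hC : 0 ≤ C)
    (h : ∀ z, |inner ℝ x z| ≤ C * ‖z‖) : ‖x‖ ≤ C := by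
  rcases eq_or_ne x 0 with rfl | hx
  · simpa using hC
  have h1 := (le_abs_self _).trans (h x)
  rw [real_inner_self_eq_norm_sq, sq] at h1
  exact le_of_mul_le_mul_right h1 (norm_pos_iff.2 hx)

theorem abs_fwd_U_le [NeZero N] (x : State N) (j : ℕ) : |fwd x.U j| ≤ 4 * ‖x‖ := by
  linarith [abs_fwd_le x.U j, abs_U_le x j, abs_U_le x (j + 1)]

theorem abs_quadForm_le [NeZero N] {α β γ : ℝ} (hα : |α| ≤ 2) (hβ : |β| ≤ 2) (hγ : |γ| ≤ 2)
    (x y z : State N) :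
    |quadForm α β γ x y z| ≤ 1000 * N * ‖x‖ * ‖y‖ * ‖z‖ := by
  have hN : (0 : ℝ) < N := by exact_mod_cast Nat.pos_of_neZero N
  have key : ∀ {t : ℕ → ℝ} (a b c : State N),
      (∀ j, |t j| ≤ 4 * ‖c‖ * (cellSize a j * cellSize b j)) →
      |∑ j ∈ range N, t j| ≤ 120 * N * ‖a‖ * ‖b‖ * ‖c‖ := by
    intro t a b c ht
    refine (abs_sum_le_of_cellSize (K := 4 * ‖c‖ * N) (by positivity) a b
      fun j _ => (ht j).trans (le_of_eq ?_)).trans (le_of_eq ?_)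
    · field_simp
    · ring
  have s : ∀ (a : State N) j, 0 ≤ cellSize a j := cellSize_nonneg
  have h1 : |∑ j ∈ range N, fwd z.U j * mass x.U y.U j| ≤ 120 * N * ‖x‖ * ‖y‖ * ‖z‖ := by
    refine key x y z fun j => ?_
    rw [abs_mul]
    gcongr
    · exact abs_fwd_U_le z j
    · exact (abs_mass_le _ _ _).trans (mul_le_mul (abs_U_add_le_cellSize x j)
        (abs_U_add_le_cellSize y j) (by positivity) (s _ _))
  have h2 : |∑ j ∈ range N, fwd z.U j * mass x.H y.H j| ≤ 120 * N * ‖x‖ * ‖y‖ * ‖z‖ := by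
    refine key x y z fun j => ?_
    rw [abs_mul]
    gcongr
    · exact abs_fwd_U_le z j
    · exact (abs_mass_le _ _ _).trans (mul_le_mul (abs_H_add_le_cellSize x j)
        (abs_H_add_le_cellSize y j) (by positivity) (s _ _))
  have h3 : |∑ j ∈ range N, fwd x.H j * mass y.U z.H j| ≤ 120 * N * ‖x‖ * ‖z‖ * ‖y‖ := by
    refine key x z y fun j => ?_
    rw [abs_mul]
    calc |fwd x.H j| * |mass y.U z.H j|
        ≤ cellSize x j * ((2 * ‖y‖ + 2 * ‖y‖) * cellSize z j) := by
          refine mul_le_mul ((abs_fwd_le _ _).trans (abs_H_add_le_cellSize x j))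
            ((abs_mass_le _ _ _).trans ?_) (abs_nonneg _) (s _ _)
          have := abs_H_add_le_cellSize z j
          have := abs_U_le y j
          have := abs_U_le y (j + 1)
          gcongr
      _ = _ := by ring
  have h4 : |∑ j ∈ range N, fwd y.U j * mass x.H z.H j| ≤ 120 * N * ‖x‖ * ‖z‖ * ‖y‖ := by
    refine key x z y fun j => ?_
    rw [abs_mul]
    gcongr
    · exact abs_fwd_U_le y j
    · exact (abs_mass_le _ _ _).trans (mul_le_mul (abs_H_add_le_cellSize x j)
        (abs_H_add_le_cellSize z j) (by positivity) (s _ _))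
  have hsplit : quadForm α β γ x y z
      = β / 2 * (∑ j ∈ range N, fwd z.U j * mass x.U y.U j)
        + γ / 2 * (∑ j ∈ range N, fwd z.U j * mass x.H y.H j)
        + -α * (∑ j ∈ range N, fwd x.H j * mass y.U z.H j)
        + -α * (∑ j ∈ range N, fwd y.U j * mass x.H z.H j) := by
    simp only [quadForm, mul_sum, ← sum_add_distrib]
    exact sum_congr rfl fun j _ => by ring
  have hβ' : |β / 2| ≤ 1 := by rw [abs_div, abs_two]; linarith
  have hγ' : |γ / 2| ≤ 1 := by rw [abs_div, abs_two]; linarith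
  have hα' : |-α| ≤ 2 := by rwa [abs_neg]
  have mulb : ∀ {a b A B : ℝ}, |a| ≤ A → |b| ≤ B → |a * b| ≤ A * B := fun {a b A B} ha hb => by
    rw [abs_mul]; exact mul_le_mul ha hb (abs_nonneg _) ((abs_nonneg _).trans ha)
  rw [hsplit]
  have f1 := mulb hβ' h1
  have f2 := mulb hγ' h2
  have f3 := mulb hα' h3
  have f4 := mulb hα' h4
  have : 0 ≤ N * ‖x‖ * ‖y‖ * ‖z‖ := by positivity
  refine ((abs_add_le _ _).trans (add_le_add ((abs_add_three _ _ _).trans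
    (add_le_add (add_le_add f1 f2) f3)) f4)).trans ?_
  linarith

theorem norm_quadOp_le [NeZero N] {α β γ : ℝ} (hα : |α| ≤ 2) (hβ : |β| ≤ 2) (hγ : |γ| ≤ 2)
    (x y : State N) : ‖quadOp N α β γ x y‖ ≤ 1000 * N * ‖x‖ * ‖y‖ :=
  norm_le_of_inner_le (by positivity) fun z => by
    rw [inner_quadOp]; exact abs_quadForm_le hα hβ hγ x y z

/-- The nodal values and the slopes of both components are bounded by `c`. -/
structure LipBound (w : State N) (c : ℝ) : Prop where
  H_le : ∀ j, |w.H j| ≤ c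
  U_le : ∀ j, |w.U j| ≤ c
  fwd_H_le : ∀ j < N, |fwd w.H j| ≤ c * (1 / N)
  fwd_U_le : ∀ j < N, |fwd w.U j| ≤ c * (1 / N)

/-- The transport term `-α ((w U)_x, φ)` without its bounded part. It is the only part of the
linearized form that is unbounded as the mesh is refined. -/
def transportForm (α : ℝ) (w x z : State N) : ℝ :=
  -α * ∑ j ∈ range N, fwd x.H j * mass w.U z.H j

/-- The linearized form without the transport term. -/
def boundedForm (α β γ : ℝ) (w x z : State N) : ℝ :=
  ∑ j ∈ range N, (fwd z.U j * avg x.H j - fwd x.U j * avg z.H j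
    + β * (fwd z.U j * mass w.U x.U j) + γ * (fwd z.U j * mass w.H x.H j)
    - α * (fwd w.H j * mass x.U z.H j + fwd x.U j * mass w.H z.H j
      + fwd w.U j * mass x.H z.H j))

theorem inner_linearizedField [NeZero N] (α β γ : ℝ) (w x z : State N) :
    inner ℝ (linearizedField (linOp N) (quadOp N α β γ) w x) z
      = transportForm α w x z + boundedForm α β γ w x z := by
  simp only [linearizedField, LinearMap.add_apply, LinearMap.flip_apply, inner_add_left,
    inner_linOp, inner_quadOp, linForm, quadForm, transportForm, boundedForm, mul_sum,
    ← sum_add_distrib]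
  refine sum_congr rfl fun j _ => ?_
  rw [mass_comm x.U w.U, mass_comm x.H w.H]
  ring

theorem abs_boundedForm_le [NeZero N] {α β γ c : ℝ} (hα : |α| ≤ 2) (hβ : |β| ≤ 2) (hγ : |γ| ≤ 2)
    {w : State N} (hw : LipBound w c) (x z : State N) :
    |boundedForm α β γ w x z| ≤ 30 * (2 + 16 * c) * ‖x‖ * ‖z‖ := by
  have hN : (0 : ℝ) < N := by exact_mod_cast Nat.pos_of_neZero N
  have hc : 0 ≤ c := (abs_nonneg _).trans (hw.H_le 0)
  refine abs_sum_le_of_cellSize (by positivity) x z fun j hj => ?_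
  have s : ∀ (a : State N) j, 0 ≤ cellSize a j := cellSize_nonneg
  have mulb : ∀ {a b A B : ℝ}, |a| ≤ A → |b| ≤ B → |a * b| ≤ A * B := fun {a b A B} ha hb => by
    rw [abs_mul]; exact mul_le_mul ha hb (abs_nonneg _) ((abs_nonneg _).trans ha)
  have avgH : ∀ a : State N, |avg a.H j| ≤ cellSize a j := fun a =>
    (abs_avg_le _ _).trans (abs_H_add_le_cellSize a j)
  have massw : ∀ a : State N, |mass w.H a.H j| ≤ 2 * c * cellSize a j := fun a => by
    refine (abs_mass_le _ _ _).trans (mul_le_mul ?_ (abs_H_add_le_cellSize a j) (by positivity)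
      (by positivity))
    linarith [hw.H_le j, hw.H_le (j + 1)]
  have massu : |mass w.U x.U j| ≤ 2 * c * cellSize x j := by
    refine (abs_mass_le _ _ _).trans (mul_le_mul ?_ (abs_U_add_le_cellSize x j) (by positivity)
      (by positivity))
    linarith [hw.U_le j, hw.U_le (j + 1)]
  have massUH : |mass x.U z.H j| ≤ cellSize x j * cellSize z j :=
    (abs_mass_le _ _ _).trans (mul_le_mul (abs_U_add_le_cellSize x j) (abs_H_add_le_cellSize z j)
      (by positivity) (s _ _))
  have massHH : |mass x.H z.H j| ≤ cellSize x j * cellSize z j :=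
    (abs_mass_le _ _ _).trans (mul_le_mul (abs_H_add_le_cellSize x j) (abs_H_add_le_cellSize z j)
      (by positivity) (s _ _))
  have f1 := mulb (abs_fwd_U_le_cellSize z j) (avgH x)
  have f2 := mulb (abs_fwd_U_le_cellSize x j) (avgH z)
  have f3 := mulb hβ (mulb (abs_fwd_U_le_cellSize z j) massu)
  have f4 := mulb hγ (mulb (abs_fwd_U_le_cellSize z j) (massw x))
  have f5 := mulb (hw.fwd_H_le j hj) massUH
  have f6 := mulb (abs_fwd_U_le_cellSize x j) (massw z)
  have f7 := mulb (hw.fwd_U_le j hj) massHH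
  have f8 := mulb hα ((abs_add_three _ _ _).trans (add_le_add (add_le_add f5 f6) f7))
  refine (abs_sub _ _).trans ((add_le_add ((abs_add_three _ _ _).trans (add_le_add (add_le_add
    ((abs_sub _ _).trans (add_le_add f1 f2)) f3) f4)) f8).trans (le_of_eq ?_))
  ring

theorem abs_transportForm_le [NeZero N] {α c : ℝ} (hα : |α| ≤ 2) {w : State N}
    (hw : LipBound w c) (x z : State N) :
    |transportForm α w x z| ≤ 120 * c * N * ‖x‖ * ‖z‖ := by
  have hN : (0 : ℝ) < N := by exact_mod_cast Nat.pos_of_neZero N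
  have hc : 0 ≤ c := (abs_nonneg _).trans (hw.H_le 0)
  have h : |∑ j ∈ range N, fwd x.H j * mass w.U z.H j| ≤ 30 * (2 * c * N) * ‖x‖ * ‖z‖ := by
    refine abs_sum_le_of_cellSize (by positivity) x z fun j _ => ?_
    rw [abs_mul]
    calc |fwd x.H j| * |mass w.U z.H j|
        ≤ cellSize x j * ((c + c) * cellSize z j) := by
          refine mul_le_mul ((abs_fwd_le _ _).trans (abs_H_add_le_cellSize x j))
            ((abs_mass_le _ _ _).trans ?_) (abs_nonneg _) (cellSize_nonneg _ _)
          have := abs_H_add_le_cellSize z j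
          have := hw.U_le j
          have := hw.U_le (j + 1)
          gcongr
      _ = _ := by field_simp; ring
  rw [transportForm, abs_mul, abs_neg]
  calc |α| * |∑ j ∈ range N, fwd x.H j * mass w.U z.H j|
      ≤ 2 * (30 * (2 * c * N) * ‖x‖ * ‖z‖) := by gcongr
    _ = _ := by ring

/-- The transport form is skew-symmetric up to a bounded term, by the Leibniz rule and because
`w.U` vanishes at both ends. -/
theorem abs_transportForm_add_le [NeZero N] {α c : ℝ} (hα : |α| ≤ 2) {w : State N}
    (hw : LipBound w c) (x z : State N) :
    |transportForm α w x z + transportForm α w z x| ≤ 60 * c * ‖x‖ * ‖z‖ := by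
  have hc : 0 ≤ c := (abs_nonneg _).trans (hw.H_le 0)
  have hid : transportForm α w x z + transportForm α w z x
      = α * ∑ j ∈ range N, fwd w.U j * mass x.H z.H j := by
    have h0 : ∑ j ∈ range N, fwd (fun i => x.H i * z.H i * w.U i) j = 0 := by
      rw [sum_fwd, w.U_zero_eq, w.U_eq_zero le_rfl]; simp
    have h1 : ∑ j ∈ range N, fwd (fun i => x.H i * z.H i * w.U i) j
        = ∑ j ∈ range N, fwd x.H j * mass w.U z.H j + ∑ j ∈ range N, fwd z.H j * mass w.U x.H j
          + ∑ j ∈ range N, fwd w.U j * mass x.H z.H j := by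
      rw [← sum_add_distrib, ← sum_add_distrib]
      refine sum_congr rfl fun j _ => ?_
      rw [← fwd_mul_mass_add, mass_comm z.H w.U, mass_comm x.H w.U]
    unfold transportForm
    linear_combination α * (h0.symm.trans h1)
  have h : |∑ j ∈ range N, fwd w.U j * mass x.H z.H j| ≤ 30 * c * ‖x‖ * ‖z‖ := by
    refine abs_sum_le_of_cellSize hc x z fun j hj => ?_
    rw [abs_mul]
    calc |fwd w.U j| * |mass x.H z.H j|
        ≤ (c * (1 / N)) * (cellSize x j * cellSize z j) := by
          refine mul_le_mul (hw.fwd_U_le j hj) ((abs_mass_le _ _ _).trans (mul_le_mul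
            (abs_H_add_le_cellSize x j) (abs_H_add_le_cellSize z j) (by positivity)
            (cellSize_nonneg _ _))) (abs_nonneg _) (by positivity)
      _ = _ := by ring
  rw [hid, abs_mul]
  calc |α| * |∑ j ∈ range N, fwd w.U j * mass x.H z.H j| ≤ 2 * (30 * c * ‖x‖ * ‖z‖) := by gcongr
    _ = _ := by ring

theorem norm_linearizedField_le [NeZero N] {α β γ c : ℝ} (hα : |α| ≤ 2) (hβ : |β| ≤ 2)
    (hγ : |γ| ≤ 2) {w : State N} (hw : LipBound w c) (x : State N) :
    ‖linearizedField (linOp N) (quadOp N α β γ) w x‖ ≤ (60 + 600 * c) * N * ‖x‖ := by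
  have hc : 0 ≤ c := (abs_nonneg _).trans (hw.H_le 0)
  have hN : (1 : ℝ) ≤ N := by exact_mod_cast Nat.pos_of_neZero N
  refine norm_le_of_inner_le (by positivity) fun z => ?_
  rw [inner_linearizedField]
  refine ((abs_add_le _ _).trans (add_le_add (abs_transportForm_le hα hw x z)
    (abs_boundedForm_le hα hβ hγ hw x z))).trans ?_
  calc 120 * c * N * ‖x‖ * ‖z‖ + 30 * (2 + 16 * c) * ‖x‖ * ‖z‖
      = 120 * c * N * ‖x‖ * ‖z‖ + 30 * (2 + 16 * c) * 1 * ‖x‖ * ‖z‖ := by ring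
    _ ≤ 120 * c * N * ‖x‖ * ‖z‖ + 30 * (2 + 16 * c) * N * ‖x‖ * ‖z‖ := by gcongr
    _ = _ := by ring

theorem abs_linearizedField_symm_le [NeZero N] {α β γ c : ℝ} (hα : |α| ≤ 2) (hβ : |β| ≤ 2)
    (hγ : |γ| ≤ 2) {w : State N} (hw : LipBound w c) (x y : State N) :
    |inner ℝ (linearizedField (linOp N) (quadOp N α β γ) w x) y
      + inner ℝ x (linearizedField (linOp N) (quadOp N α β γ) w y)|
      ≤ (120 + 1020 * c) * ‖x‖ * ‖y‖ := by
  rw [real_inner_comm _ x, inner_linearizedField, inner_linearizedField,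
    show ∀ a b a' b' : ℝ, a + b + (a' + b') = (a + a') + b + b' by intros; ring]
  refine (abs_add_three _ _ _).trans ?_
  have h1 := abs_transportForm_add_le hα hw x y
  have h2 := abs_boundedForm_le hα hβ hγ hw x y
  have h3 := abs_boundedForm_le hα hβ hγ hw y x
  linarith

end State

end

section

open Finset

/-! ### Piecewise affine functions and their nodal values -/

/-- Nodal values of a function on the mesh of length `1 / N`. -/
def nodal (N : ℕ) (f : ℝ → ℝ) (j : ℕ) : ℝ := f ((j : ℝ) / N)

/-- The `j`-th mesh cell. -/
def cell (N j : ℕ) : Set ℝ := Set.Icc ((j : ℝ) / N) (((j : ℝ) + 1) / N)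

/-- The piecewise affine function with given nodal values. -/
def plFun (N : ℕ) (a : ℕ → ℝ) (x : ℝ) : ℝ := ∑ j ∈ range (N + 1), a j * hat N j x

theorem mem_cell_iff {N : ℕ} (hN : 0 < N) {j : ℕ} {x : ℝ} :
    x ∈ cell N j ↔ (j : ℝ) ≤ N * x ∧ N * x ≤ j + 1 := by
  have hN' : (0 : ℝ) < N := by exact_mod_cast hN
  rw [cell, Set.mem_Icc, div_le_iff₀ hN', le_div_iff₀ hN', mul_comm x]

theorem cell_le {N : ℕ} (j : ℕ) : (j : ℝ) / N ≤ ((j : ℝ) + 1) / N := by gcongr; linarith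

theorem cell_subset {N j : ℕ} (hj : j < N) : cell N j ⊆ Set.Icc 0 1 := by
  have hN : 0 < N := by omega
  intro x hx
  have hN' : (0 : ℝ) < N := by exact_mod_cast hN
  have hj' : (j : ℝ) + 1 ≤ N := by exact_mod_cast hj
  have h := (mem_cell_iff hN).1 hx
  constructor
  · by_contra hx0
    have : (0 : ℝ) ≤ j := j.cast_nonneg
    nlinarith
  · by_contra hx1
    nlinarith

theorem node_mem_cell {N : ℕ} (j : ℕ) : (j : ℝ) / N ∈ cell N j := ⟨le_rfl, cell_le j⟩

theorem node_succ_mem_cell {N : ℕ} (j : ℕ) : ((j + 1 : ℕ) : ℝ) / N ∈ cell N j := by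
  push_cast
  exact ⟨cell_le j, le_rfl⟩

theorem node_mem_Icc {N j : ℕ} (hj : j ≤ N) : (j : ℝ) / N ∈ Set.Icc (0 : ℝ) 1 := by
  have : (j : ℝ) ≤ N := by exact_mod_cast hj
  exact ⟨by positivity, div_le_one_of_le₀ this N.cast_nonneg⟩

theorem Sh.eq_affine {N : ℕ} {f : ℝ → ℝ} (hf : f ∈ Sh N) {j : ℕ} (hj : j < N) {x : ℝ}
    (hx : x ∈ cell N j) : f x = nodal N f j + fwd (nodal N f) j * (N * x - j) := by
  have hN : (N : ℝ) ≠ 0 := by exact_mod_cast (by omega : N ≠ 0)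
  obtain ⟨a, b, hab⟩ := hf.2 j hj
  rw [fwd, nodal, nodal, hab x hx, hab _ (node_mem_cell j), hab _ (node_succ_mem_cell j)]
  push_cast
  field_simp
  ring

theorem Sh.sub {N : ℕ} {f g : ℝ → ℝ} (hf : f ∈ Sh N) (hg : g ∈ Sh N) :
    (fun x => f x - g x) ∈ Sh N := by
  refine ⟨hf.1.sub hg.1, fun j hj => ?_⟩
  obtain ⟨a, b, hab⟩ := hf.2 j hj
  obtain ⟨c, d, hcd⟩ := hg.2 j hj
  exact ⟨a - c, b - d, fun x hx => by
    simp only [hab x hx, hcd x hx]; ring⟩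

theorem hat_eq_zero_of_lt {N i j : ℕ} (hN : 0 < N) (hij : i < j) {x : ℝ} (hx : x ∈ cell N j) :
    hat N i x = 0 := by
  have h := (mem_cell_iff hN).1 hx
  have hij' : (i : ℝ) + 1 ≤ j := by exact_mod_cast hij
  refine max_eq_left ?_
  have := le_abs_self ((N : ℝ) * x - i)
  linarith

theorem hat_eq_zero_of_gt {N i j : ℕ} (hN : 0 < N) (hij : j + 1 < i) {x : ℝ} (hx : x ∈ cell N j) :
    hat N i x = 0 := by
  have h := (mem_cell_iff hN).1 hx
  have hij' : (j : ℝ) + 1 + 1 ≤ i := by exact_mod_cast hij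
  refine max_eq_left ?_
  have := neg_le_abs ((N : ℝ) * x - i)
  linarith

theorem plFun_eq_affine {N : ℕ} (a : ℕ → ℝ) {j : ℕ} (hj : j < N) {x : ℝ} (hx : x ∈ cell N j) :
    plFun N a x = a j + fwd a j * (N * x - j) := by
  have hN : 0 < N := by omega
  have h := (mem_cell_iff hN).1 hx
  have hsub : ({j, j + 1} : Finset ℕ) ⊆ range (N + 1) := by
    intro i hi
    simp only [mem_insert, mem_singleton] at hi
    rw [mem_range]; omega
  rw [plFun, ← sum_subset hsub, sum_pair (by omega)]
  · have h1 : hat N j x = 1 - (N * x - j) := by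
      rw [hat, abs_of_nonneg (by linarith), max_eq_right (by linarith)]
    have h2 : hat N (j + 1) x = N * x - j := by
      rw [hat]
      push_cast
      rw [abs_of_nonpos (by linarith), max_eq_right (by linarith)]
      ring
    rw [h1, h2, fwd]; ring
  · intro i _ hi
    simp only [mem_insert, mem_singleton, not_or] at hi
    rcases Nat.lt_or_gt_of_ne hi.1 with h' | h'
    · rw [hat_eq_zero_of_lt hN h' hx, mul_zero]
    · rw [hat_eq_zero_of_gt hN (by omega) hx, mul_zero]

theorem nodal_plFun {N : ℕ} (hN : 0 < N) (a : ℕ → ℝ) {j : ℕ} (hj : j ≤ N) :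
    nodal N (plFun N a) j = a j := by
  have hN' : (N : ℝ) ≠ 0 := by exact_mod_cast hN.ne'
  rw [nodal]
  rcases Nat.lt_or_ge j N with h | h
  · rw [plFun_eq_affine a h (node_mem_cell j), mul_div_cancel₀ _ hN']; ring
  · obtain ⟨i, rfl⟩ : ∃ i, j = i + 1 := ⟨j - 1, by omega⟩
    rw [plFun_eq_affine a (by omega) (node_succ_mem_cell i), mul_div_cancel₀ _ hN', fwd]
    push_cast
    ring

theorem plFun_mem_Sh {N : ℕ} (a : ℕ → ℝ) : plFun N a ∈ Sh N := by
  refine ⟨Continuous.continuousOn ?_, fun j hj => ⟨a j - fwd a j * j, fwd a j * N, fun x hx => ?_⟩⟩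
  · unfold plFun hat
    fun_prop
  · rw [plFun_eq_affine a hj hx]; ring

theorem plFun_mem_Sh0 {N : ℕ} (hN : 0 < N) {a : ℕ → ℝ} (h0 : a 0 = 0) (h1 : a N = 0) :
    plFun N a ∈ Sh0 N := by
  have hN' : (N : ℝ) ≠ 0 := by exact_mod_cast hN.ne'
  refine ⟨plFun_mem_Sh a, ?_, ?_⟩
  · have := nodal_plFun hN a (Nat.zero_le N)
    simpa [nodal, h0] using this
  · have := nodal_plFun hN a le_rfl
    simpa [nodal, h1, hN'] using this

theorem interp_eq_plFun (N : ℕ) (v : ℝ → ℝ) : interp N v = plFun N (nodal N v) := rfl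

theorem interp0_eq_plFun (N : ℕ) (v : ℝ → ℝ) :
    interp0 N v = plFun N fun j => if 0 < j ∧ j < N then nodal N v j else 0 := by
  funext x
  rw [interp0, plFun]
  simp only [ite_mul, zero_mul]
  rw [← sum_filter]
  refine sum_congr ?_ fun _ _ => rfl
  ext j
  simp only [mem_Ioo, mem_filter, mem_range]
  omega

/-! ### Integrals as cell sums -/

theorem intervalIntegrable_of_cells {N : ℕ} {F : ℝ → ℝ} (P : ℕ → ℝ → ℝ)
    (hP : ∀ j < N, ContinuousOn (P j) (cell N j))
    (h : ∀ j < N, ∀ x ∈ Set.Ioo ((j : ℝ) / N) (((j : ℝ) + 1) / N), F x = P j x) {j : ℕ}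
    (hj : j < N) :
    IntervalIntegrable F MeasureTheory.volume ((j : ℝ) / N) (((j : ℝ) + 1) / N) := by
  have h1 : IntervalIntegrable (P j) MeasureTheory.volume ((j : ℝ) / N) (((j : ℝ) + 1) / N) :=
    ContinuousOn.intervalIntegrable_of_Icc (cell_le j) (hP j hj)
  refine h1.congr_uIoo ?_
  rw [Set.uIoo_of_le (cell_le j)]
  exact fun x hx => (h j hj x hx).symm

theorem integral_eq_sum_cells {N : ℕ} (hN : 0 < N) {F : ℝ → ℝ} (P : ℕ → ℝ → ℝ)
    (hP : ∀ j < N, ContinuousOn (P j) (cell N j))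
    (h : ∀ j < N, ∀ x ∈ Set.Ioo ((j : ℝ) / N) (((j : ℝ) + 1) / N), F x = P j x) :
    ∫ x in (0 : ℝ)..1, F x
      = ∑ j ∈ range N, ∫ x in ((j : ℝ) / N)..(((j : ℝ) + 1) / N), P j x := by
  have hN' : (N : ℝ) ≠ 0 := by exact_mod_cast hN.ne'
  have h1 := intervalIntegral.sum_integral_adjacent_intervals (f := F)
    (μ := MeasureTheory.volume) (a := fun j : ℕ => (j : ℝ) / N) (n := N) (fun j hj => by
      have := intervalIntegrable_of_cells P hP h hj
      push_cast
      exact this)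
  simp only [Nat.cast_zero, zero_div, div_self hN'] at h1
  rw [← h1]
  refine sum_congr rfl fun j hj => ?_
  push_cast
  refine intervalIntegral.integral_congr_uIoo ?_
  rw [Set.uIoo_of_le (cell_le j)]
  exact h j (mem_range.1 hj)

theorem integral_cell_quadratic {N : ℕ} (hN : 0 < N) (j : ℕ) (a b c : ℝ) :
    ∫ x in ((j : ℝ) / N)..(((j : ℝ) + 1) / N),
        (a + b * (N * x - j) + c * (N * x - j) ^ 2) = 1 / N * (a + b / 2 + c / 3) := by
  have hN' : (N : ℝ) ≠ 0 := by exact_mod_cast hN.ne'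
  rw [intervalIntegral.integral_comp_mul_sub (fun s => a + b * s + c * s ^ 2) hN',
    mul_div_cancel₀ _ hN', mul_div_cancel₀ _ hN', sub_self, add_sub_cancel_left]
  have : ∫ s in (0 : ℝ)..1, (a + b * s + c * s ^ 2) = a + b / 2 + c / 3 := by
    rw [intervalIntegral.integral_add, intervalIntegral.integral_add,
      intervalIntegral.integral_const_mul, intervalIntegral.integral_const_mul, integral_id,
      integral_pow, intervalIntegral.integral_const]
    · norm_num
      ring
    all_goals exact Continuous.intervalIntegrable (by fun_prop) _ _
  rw [this, smul_eq_mul, one_div]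

theorem integral_eq_sum_of_quadratic {N : ℕ} (hN : 0 < N) {F : ℝ → ℝ} (a b c : ℕ → ℝ)
    (h : ∀ j < N, ∀ x ∈ Set.Ioo ((j : ℝ) / N) (((j : ℝ) + 1) / N),
      F x = a j + b j * (N * x - j) + c j * (N * x - j) ^ 2) :
    ∫ x in (0 : ℝ)..1, F x = ∑ j ∈ range N, 1 / N * (a j + b j / 2 + c j / 3) := by
  rw [integral_eq_sum_cells hN (fun j x => a j + b j * (N * x - j) + c j * (N * x - j) ^ 2)
    (fun j _ => by fun_prop) h]
  exact sum_congr rfl fun j _ => integral_cell_quadratic hN j _ _ _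

section Sh

variable {N : ℕ} {f g v φ : ℝ → ℝ}

theorem Sh.hasDerivAt (hf : f ∈ Sh N) {j : ℕ} (hj : j < N) {x : ℝ}
    (hx : x ∈ Set.Ioo ((j : ℝ) / N) (((j : ℝ) + 1) / N)) :
    HasDerivAt f (N * fwd (nodal N f) j) x := by
  have h1 : HasDerivAt (fun y : ℝ => nodal N f j + fwd (nodal N f) j * (N * y - j))
      (N * fwd (nodal N f) j) x := by
    have := ((((hasDerivAt_id x).const_mul (N : ℝ)).sub_const (j : ℝ)).const_mul
      (fwd (nodal N f) j)).const_add (nodal N f j)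
    simpa [mul_comm] using this
  refine h1.congr_of_eventuallyEq ?_
  filter_upwards [Icc_mem_nhds hx.1 hx.2] with y hy
  exact Sh.eq_affine hf hj hy

theorem Sh.ip_eq (hN : 0 < N) (hf : f ∈ Sh N) (hg : g ∈ Sh N) :
    ip f g = ∑ j ∈ range N, 1 / N * mass (nodal N f) (nodal N g) j := by
  set F := nodal N f
  set G := nodal N g
  rw [ip, integral_eq_sum_of_quadratic hN (fun j => F j * G j)
    (fun j => F j * fwd G j + fwd F j * G j) (fun j => fwd F j * fwd G j)]
  · refine sum_congr rfl fun j _ => ?_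
    simp only [mass, fwd]; ring
  · intro j hj x hx
    rw [Sh.eq_affine hf hj (Set.Ioo_subset_Icc_self hx),
      Sh.eq_affine hg hj (Set.Ioo_subset_Icc_self hx)]
    ring

theorem Sh.ip_deriv_eq (hN : 0 < N) (hf : f ∈ Sh N) (hg : g ∈ Sh N) :
    ip (deriv f) g = ∑ j ∈ range N, fwd (nodal N f) j * avg (nodal N g) j := by
  have hN' : (N : ℝ) ≠ 0 := by exact_mod_cast hN.ne'
  set F := nodal N f
  set G := nodal N g
  rw [ip, integral_eq_sum_of_quadratic hN (fun j => N * fwd F j * G j)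
    (fun j => N * fwd F j * fwd G j) (fun j => 0)]
  · refine sum_congr rfl fun j _ => ?_
    simp only [avg, fwd]; field_simp; ring
  · intro j hj x hx
    rw [(Sh.hasDerivAt hf hj hx).deriv, Sh.eq_affine hg hj (Set.Ioo_subset_Icc_self hx)]
    ring

theorem Sh.ip_deriv_deriv_eq (hN : 0 < N) (hf : f ∈ Sh N) (hg : g ∈ Sh N) :
    ip (deriv f) (deriv g) = ∑ j ∈ range N, N * (fwd (nodal N f) j * fwd (nodal N g) j) := by
  have hN' : (N : ℝ) ≠ 0 := by exact_mod_cast hN.ne'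
  set F := nodal N f
  set G := nodal N g
  rw [ip, integral_eq_sum_of_quadratic hN (fun j => N * fwd F j * (N * fwd G j))
    (fun j => 0) (fun j => 0)]
  · refine sum_congr rfl fun j _ => ?_
    field_simp; ring
  · intro j hj x hx
    rw [(Sh.hasDerivAt hf hj hx).deriv, (Sh.hasDerivAt hg hj hx).deriv]
    ring

theorem Sh.ip_deriv_mul_eq (hN : 0 < N) (hf : f ∈ Sh N) (hv : v ∈ Sh N) (hg : g ∈ Sh N) :
    ip (deriv fun x => f x * v x) g
      = ∑ j ∈ range N, (fwd (nodal N f) j * mass (nodal N v) (nodal N g) j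
          + fwd (nodal N v) j * mass (nodal N f) (nodal N g) j) := by
  have hN' : (N : ℝ) ≠ 0 := by exact_mod_cast hN.ne'
  set F := nodal N f
  set G := nodal N g
  set W := nodal N v
  rw [ip, integral_eq_sum_of_quadratic hN
    (fun j => (N * fwd F j * W j + N * fwd W j * F j) * G j)
    (fun j => (N * fwd F j * W j + N * fwd W j * F j) * fwd G j
      + (N * fwd F j * fwd W j * 2) * G j) (fun j => N * fwd F j * fwd W j * 2 * fwd G j)]
  · refine sum_congr rfl fun j _ => ?_
    simp only [mass, fwd]; field_simp; ring
  · intro j hj x hx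
    rw [((Sh.hasDerivAt hf hj hx).fun_mul (Sh.hasDerivAt hv hj hx)).deriv,
      Sh.eq_affine hf hj (Set.Ioo_subset_Icc_self hx),
      Sh.eq_affine hg hj (Set.Ioo_subset_Icc_self hx),
      Sh.eq_affine hv hj (Set.Ioo_subset_Icc_self hx)]
    ring

theorem Sh.ip_mul_deriv_eq (hN : 0 < N) (hf : f ∈ Sh N) (hg : g ∈ Sh N) :
    ip (fun x => f x * deriv f x) g
      = ∑ j ∈ range N, fwd (nodal N f) j * mass (nodal N f) (nodal N g) j := by
  have hN' : (N : ℝ) ≠ 0 := by exact_mod_cast hN.ne'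
  set F := nodal N f
  set G := nodal N g
  rw [ip, integral_eq_sum_of_quadratic hN
    (fun j => N * fwd F j * F j * G j)
    (fun j => N * fwd F j * (F j * fwd G j + fwd F j * G j))
    (fun j => N * fwd F j * (fwd F j * fwd G j))]
  · refine sum_congr rfl fun j _ => ?_
    simp only [mass, fwd]; field_simp; ring
  · intro j hj x hx
    rw [(Sh.hasDerivAt hf hj hx).deriv, Sh.eq_affine hf hj (Set.Ioo_subset_Icc_self hx),
      Sh.eq_affine hg hj (Set.Ioo_subset_Icc_self hx)]
    ring

end Sh

/-! ### The scheme in nodal coordinates -/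

/-- `(f, g) ∈ S_h × S_{h,0}` has the nodal values `x`. -/
structure Represents (N : ℕ) (f g : ℝ → ℝ) (x : State N) : Prop where
  mem_H : f ∈ Sh N
  mem_U : g ∈ Sh0 N
  nodal_H : ∀ j ≤ N, nodal N f j = x.H j
  nodal_U : ∀ j ≤ N, nodal N g j = x.U j

variable {N : ℕ}

theorem represents_plFun (hN : 0 < N) (x : State N) :
    Represents N (plFun N x.H) (plFun N x.U) x where
  mem_H := plFun_mem_Sh _
  mem_U := plFun_mem_Sh0 hN x.U_zero_eq (x.U_eq_zero le_rfl)
  nodal_H _ hj := nodal_plFun hN _ hj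
  nodal_U _ hj := nodal_plFun hN _ hj

theorem represents_mk (hN : 0 < N) {f g : ℝ → ℝ} (hf : f ∈ Sh N) (hg : g ∈ Sh0 N) :
    Represents N f g (State.mk N (nodal N f) (nodal N g)) where
  mem_H := hf
  mem_U := hg
  nodal_H j hj := by simp [hj]
  nodal_U j hj := by
    have hN' : (N : ℝ) ≠ 0 := by exact_mod_cast hN.ne'
    rcases Nat.eq_zero_or_pos j with rfl | h0
    · simp [nodal, hg.2.1]
    · rcases Nat.lt_or_ge j N with h1 | h1
      · simp [h0, h1]
      · obtain rfl : j = N := le_antisymm hj h1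
        simp [nodal, hg.2.2, hN']

/-- The two weak equations of a substep, added up, are one equation in the discrete state space. -/
theorem weak_substep_eq_inner [NeZero N] (sys : System) (τ : ℝ)
    {H U G V H' U' φ χ : ℝ → ℝ} {x y x' z : State N} (hx : Represents N H U x)
    (hy : Represents N G V y) (hx' : Represents N H' U' x') (hz : Represents N φ χ z) :
    (ip (fun s => H' s - H s) φ + τ * ip (deriv V) φ
        + τ * sys.coeffEU * ip (deriv fun s => G s * V s) φ)
      + (aForm (fun s => U' s - U s) χ + τ * ip (deriv G) χ
        + τ * sys.coeffUU * ip (fun s => V s * deriv V s) χ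
        + τ * sys.coeffEE * ip (fun s => G s * deriv G s) χ)
      = inner ℝ (x' - x - τ • quadField (State.linOp N)
          (State.quadOp N sys.coeffEU sys.coeffUU sys.coeffEE) y) z := by
  have hN : 0 < N := Nat.pos_of_neZero N
  have e1 : ∑ j ∈ range N, fwd (fun i => y.H i * z.U i) j = 0 := by
    rw [sum_fwd, z.U_zero_eq, z.U_eq_zero le_rfl]; simp
  have e2 : ∑ j ∈ range N, fwd (fun i => y.H i * y.H i * z.U i) j = 0 := by
    rw [sum_fwd, z.U_zero_eq, z.U_eq_zero le_rfl]; simp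
  have e3 : ∑ j ∈ range N, fwd (fun i => y.U i * y.U i * z.U i) j = 0 := by
    rw [sum_fwd, z.U_zero_eq, z.U_eq_zero le_rfl]; simp
  rw [aForm, Sh.ip_eq hN (Sh.sub hx'.mem_H hx.mem_H) hz.mem_H,
    Sh.ip_deriv_eq hN hy.mem_U.1 hz.mem_H, Sh.ip_deriv_mul_eq hN hy.mem_H hy.mem_U.1 hz.mem_H,
    Sh.ip_eq hN (Sh.sub hx'.mem_U.1 hx.mem_U.1) hz.mem_U.1,
    Sh.ip_deriv_deriv_eq hN (Sh.sub hx'.mem_U.1 hx.mem_U.1) hz.mem_U.1,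
    Sh.ip_deriv_eq hN hy.mem_H hz.mem_U.1, Sh.ip_mul_deriv_eq hN hy.mem_U.1 hz.mem_U.1,
    Sh.ip_mul_deriv_eq hN hy.mem_H hz.mem_U.1, inner_sub_left, real_inner_smul_left, quadField,
    inner_add_left, State.inner_linOp, State.inner_quadOp, State.inner_eq, State.form,
    State.linForm, State.quadForm]
  have key := congrArg₂ (· + ·) (congrArg₂ (· + ·) (congrArg (τ * ·) e1)
    (congrArg (τ * sys.coeffEE / 2 * ·) e2)) (congrArg (τ * sys.coeffUU / 2 * ·) e3)
  simp only [mul_zero, add_zero] at key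
  refine Eq.trans ?_ ((congrArg (_ + ·) key).trans (add_zero _))
  simp only [mul_sum, ← sum_add_distrib, ← sum_sub_distrib]
  refine sum_congr rfl fun j hj => ?_
  have hj0 : j ≤ N := (mem_range.1 hj).le
  have hj1 : j + 1 ≤ N := mem_range.1 hj
  have sub_nodal : ∀ (a b : ℝ → ℝ) i, nodal N (fun s => a s - b s) i = nodal N a i - nodal N b i :=
    fun _ _ _ => rfl
  simp only [fwd, avg, mass, sub_nodal, State.H_sub, State.U_sub, hx.nodal_H j hj0,
    hx.nodal_H _ hj1, hx.nodal_U j hj0, hx.nodal_U _ hj1, hy.nodal_H j hj0,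
    hy.nodal_H _ hj1, hy.nodal_U j hj0, hy.nodal_U _ hj1, hx'.nodal_H j hj0,
    hx'.nodal_H _ hj1, hx'.nodal_U j hj0, hx'.nodal_U _ hj1, hz.nodal_H j hj0,
    hz.nodal_H _ hj1, hz.nodal_U j hj0, hz.nodal_U _ hj1]
  ring

/-- A substep of the scheme is an explicit update in the discrete state space. Both existence and
uniqueness of the discrete solution rest on this. -/
theorem isSubstep_iff [NeZero N] (sys : System) (τ : ℝ) {H U G V H' U' : ℝ → ℝ}
    {x y x' : State N} (hx : Represents N H U x) (hy : Represents N G V y)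
    (hx' : Represents N H' U' x') :
    IsSubstep sys N τ H U G V H' U' ↔
      x' = x + τ • quadField (State.linOp N)
        (State.quadOp N sys.coeffEU sys.coeffUU sys.coeffEE) y := by
  have hN : 0 < N := Nat.pos_of_neZero N
  constructor
  · intro h
    rw [← sub_eq_zero, ← sub_sub]
    refine ext_inner_right ℝ fun z => ?_
    have hz := represents_plFun hN z
    rw [← weak_substep_eq_inner sys τ hx hy hx' hz, h.eq_H _ hz.mem_H, h.eq_U _ hz.mem_U]
    simp
  · intro h
    have h0 : ∀ {φ χ : ℝ → ℝ} {z : State N}, Represents N φ χ z → _ := fun {φ χ z} hz =>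
      weak_substep_eq_inner sys τ hx hy hx' hz
    rw [← sub_eq_zero, ← sub_sub] at h
    simp only [h, inner_zero_left] at h0
    have zero_mem : (fun _ => 0 : ℝ → ℝ) ∈ Sh0 N :=
      ⟨⟨continuousOn_const, fun _ _ => ⟨0, 0, fun _ _ => by simp⟩⟩, rfl, rfl⟩
    refine ⟨hx'.mem_H, hx'.mem_U, fun φ hφ => ?_, fun χ hχ => ?_⟩
    · have := h0 (represents_mk hN hφ zero_mem)
      simpa [aForm, ip] using this
    · have := h0 (represents_mk hN zero_mem.1 hχ)
      simpa [ip] using this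

end

section

open Finset

/-! ### Interpolation and the trapezoidal rule on a cell -/

theorem abs_sub_le_of_deriv_bound {s : Set ℝ} (hs : Convex ℝ s) {f f' : ℝ → ℝ} {K : ℝ}
    (hf : ∀ x ∈ s, HasDerivWithinAt f (f' x) s x) (hK : ∀ x ∈ s, |f' x| ≤ K) {x y : ℝ}
    (hx : x ∈ s) (hy : y ∈ s) : |f y - f x| ≤ K * |y - x| :=
  hs.norm_image_sub_le_of_norm_hasDerivWithin_le hf hK hx hy

theorem abs_taylor_one_le {s : Set ℝ} (hs : Convex ℝ s) {f f' f'' : ℝ → ℝ} {K : ℝ}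
    (hf : ∀ x ∈ s, HasDerivWithinAt f (f' x) s x)
    (hf' : ∀ x ∈ s, HasDerivWithinAt f' (f'' x) s x) (hK : ∀ x ∈ s, |f'' x| ≤ K) {x y : ℝ}
    (hx : x ∈ s) (hy : y ∈ s) : |f y - f x - f' x * (y - x)| ≤ K * (y - x) ^ 2 := by
  have hK0 : 0 ≤ K := (abs_nonneg _).trans (hK x hx)
  have hsub : Set.uIcc x y ⊆ s := hs.ordConnected.uIcc_subset hx hy
  have h := abs_sub_le_of_deriv_bound (s := Set.uIcc x y) (convex_uIcc x y)
    (f := fun z => f z - f' x * z) (f' := fun z => f' z - f' x) (K := K * |y - x|)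
    (fun z hz => ((hf z (hsub hz)).mono hsub).sub
      (by simpa using ((hasDerivWithinAt_id z (Set.uIcc x y)).const_mul (f' x))))
    (fun z hz => (abs_sub_le_of_deriv_bound hs hf' hK hx (hsub hz)).trans
      (mul_le_mul_of_nonneg_left (Set.abs_sub_left_of_mem_uIcc hz) hK0))
    Set.left_mem_uIcc Set.right_mem_uIcc
  calc |f y - f x - f' x * (y - x)| = |f y - f' x * y - (f x - f' x * x)| := by ring_nf
    _ ≤ K * |y - x| * |y - x| := h
    _ = K * (y - x) ^ 2 := by rw [mul_assoc, ← sq, sq_abs]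

section Cells

variable {N : ℕ}

theorem convex_cell (j : ℕ) : Convex ℝ (cell N j) := convex_Icc _ _

theorem abs_fwd_nodal_le {f f' : ℝ → ℝ} {K : ℝ} {j : ℕ}
    (hf : ∀ x ∈ cell N j, HasDerivWithinAt f (f' x) (cell N j) x)
    (hK : ∀ x ∈ cell N j, |f' x| ≤ K) : |fwd (nodal N f) j| ≤ K * (1 / N) := by
  have h := abs_sub_le_of_deriv_bound (convex_cell j) hf hK (node_mem_cell j)
    (node_succ_mem_cell j)
  have h1 : ((j + 1 : ℕ) : ℝ) / N - j / N = 1 / N := by push_cast; ring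
  rwa [h1, abs_of_nonneg (by positivity : (0 : ℝ) ≤ 1 / N)] at h

theorem abs_interp_sub_le (hN : 0 < N) {f f' f'' : ℝ → ℝ} {K : ℝ} {j : ℕ}
    (hf : ∀ x ∈ cell N j, HasDerivWithinAt f (f' x) (cell N j) x)
    (hf' : ∀ x ∈ cell N j, HasDerivWithinAt f' (f'' x) (cell N j) x)
    (hK : ∀ x ∈ cell N j, |f'' x| ≤ K) {x : ℝ} (hx : x ∈ cell N j) :
    |nodal N f j + fwd (nodal N f) j * (N * x - j) - f x| ≤ 2 * K * (1 / N) ^ 2 := by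
  have hN' : (0 : ℝ) < N := by exact_mod_cast hN
  have hK0 : 0 ≤ K := (abs_nonneg _).trans (hK x hx)
  obtain ⟨h0, h1⟩ := (mem_cell_iff hN).1 hx
  obtain ⟨s, hs⟩ : ∃ s, s = N * x - j := ⟨_, rfl⟩
  have hs0 : 0 ≤ s := by linarith
  have hs1 : s ≤ 1 := by linarith
  have t1 := abs_taylor_one_le (convex_cell j) hf hf' hK (node_mem_cell j) hx
  have t2 := abs_taylor_one_le (convex_cell j) hf hf' hK (node_mem_cell j) (node_succ_mem_cell j)
  have e1 : x - j / N = s * (1 / N) := by rw [hs]; field_simp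
  have e2 : ((j + 1 : ℕ) : ℝ) / N - j / N = 1 / N := by push_cast; ring
  rw [e1] at t1
  rw [e2] at t2
  set d := f' (j / N)
  have e3 : nodal N f j + fwd (nodal N f) j * (N * x - j) - f x
      = s * (f ((j + 1 : ℕ) / N) - f (j / N) - d * (1 / N))
        - (f x - f (j / N) - d * (s * (1 / N))) := by
    rw [← hs, fwd, nodal, nodal]; ring
  rw [e3]
  refine (abs_sub _ _).trans ?_
  rw [abs_mul, abs_of_nonneg hs0]
  have : s * |f ((j + 1 : ℕ) / N) - f (j / N) - d * (1 / N)| ≤ 1 * (K * (1 / N) ^ 2) := by gcongr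
  have : K * (s * (1 / N)) ^ 2 ≤ K * (1 * (1 / N)) ^ 2 := by gcongr
  linarith

theorem continuousOn_of_hasDerivWithinAt {s : Set ℝ} {f f' : ℝ → ℝ}
    (hf : ∀ x ∈ s, HasDerivWithinAt f (f' x) s x) : ContinuousOn f s :=
  fun x hx => (hf x hx).continuousWithinAt

theorem abs_integral_cell_le {j : ℕ} {F : ℝ → ℝ} {C : ℝ}
    (h : ∀ x ∈ cell N j, |F x| ≤ C) :
    |∫ x in ((j : ℝ) / N)..(((j : ℝ) + 1) / N), F x| ≤ C * (1 / N) := by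
  have h1 := intervalIntegral.norm_integral_le_of_norm_le_const (f := F) (C := C)
    (a := (j : ℝ) / N) (b := ((j : ℝ) + 1) / N) (fun x hx => by
      rw [Set.uIoc_of_le (cell_le j)] at hx
      exact h x (Set.Ioc_subset_Icc_self hx))
  have h2 : ((j : ℝ) + 1) / N - j / N = 1 / N := by ring
  rwa [h2, abs_of_nonneg (by positivity : (0 : ℝ) ≤ 1 / N)] at h1

/-- The error of the trapezoidal rule on a cell, divided by the mesh length. -/
def trapErr (N : ℕ) (f : ℝ → ℝ) (j : ℕ) : ℝ :=
  avg (nodal N f) j - N * ∫ x in ((j : ℝ) / N)..(((j : ℝ) + 1) / N), f x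

theorem integral_cell_affine (hN : 0 < N) (j : ℕ) (a : ℕ → ℝ) :
    ∫ x in ((j : ℝ) / N)..(((j : ℝ) + 1) / N), (a j + fwd a j * (N * x - j))
      = 1 / N * avg a j := by
  have := integral_cell_quadratic hN j (a j) (fwd a j) 0
  simp only [zero_mul, add_zero, zero_div] at this
  rw [this, avg, fwd]; ring

theorem abs_trapErr_le (hN : 0 < N) {f f' f'' : ℝ → ℝ} {K : ℝ} {j : ℕ}
    (hf : ∀ x ∈ cell N j, HasDerivWithinAt f (f' x) (cell N j) x)
    (hf' : ∀ x ∈ cell N j, HasDerivWithinAt f' (f'' x) (cell N j) x)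
    (hK : ∀ x ∈ cell N j, |f'' x| ≤ K) : |trapErr N f j| ≤ 2 * K * (1 / N) ^ 2 := by
  have hN' : (0 : ℝ) < N := by exact_mod_cast hN
  have h1 := abs_integral_cell_le (fun x hx => abs_interp_sub_le hN hf hf' hK hx)
  rw [intervalIntegral.integral_sub (Continuous.intervalIntegrable (by fun_prop) _ _)
    (ContinuousOn.intervalIntegrable_of_Icc (cell_le j) (continuousOn_of_hasDerivWithinAt hf)),
    integral_cell_affine hN] at h1
  have h2 : trapErr N f j
      = N * (1 / N * avg (nodal N f) j - ∫ x in ((j : ℝ) / N)..(((j : ℝ) + 1) / N), f x) := by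
    rw [trapErr]; field_simp
  rw [h2, abs_mul, abs_of_pos hN']
  calc _ ≤ N * (2 * K * (1 / N) ^ 2 * (1 / N)) := by gcongr
    _ = _ := by field_simp

theorem add_mem_cell_succ {j : ℕ} {x : ℝ} (hx : x ∈ cell N j) :
    x + 1 / N ∈ cell N (j + 1) := by
  obtain ⟨h0, h1⟩ := hx
  constructor
  · push_cast; rw [add_div]; linarith
  · push_cast; rw [add_div]; linarith

theorem hasDerivWithinAt_shift {f f' : ℝ → ℝ} {s t : Set ℝ} {d : ℝ}
    (hf : ∀ x ∈ t, HasDerivWithinAt f (f' x) t x) (hst : Set.MapsTo (fun x => x + d) s t) :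
    ∀ x ∈ s, HasDerivWithinAt (fun y => f (y + d)) (f' (x + d)) s x := by
  intro x hx
  have h1 : HasDerivWithinAt (fun y : ℝ => y + d) 1 s x := (hasDerivWithinAt_id x s).add_const d
  have h2 := HasDerivWithinAt.comp x (hf _ (hst hx)) h1 hst
  rw [mul_one] at h2
  exact h2

/-- On a uniform mesh the trapezoidal errors of neighbouring cells agree to one order more, since
their difference is the trapezoidal error of the difference `f (x + h) - f x`. -/
theorem abs_fwd_trapErr_le (hN : 0 < N) {f f' f'' f''' : ℝ → ℝ} {K : ℝ}
    (hf : ∀ x ∈ Set.Icc (0 : ℝ) 1, HasDerivWithinAt f (f' x) (Set.Icc 0 1) x)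
    (hf' : ∀ x ∈ Set.Icc (0 : ℝ) 1, HasDerivWithinAt f' (f'' x) (Set.Icc 0 1) x)
    (hf'' : ∀ x ∈ Set.Icc (0 : ℝ) 1, HasDerivWithinAt f'' (f''' x) (Set.Icc 0 1) x)
    (hK : ∀ x ∈ Set.Icc (0 : ℝ) 1, |f''' x| ≤ K) {j : ℕ} (hj : j + 1 < N) :
    |fwd (trapErr N f) j| ≤ 2 * K * (1 / N) ^ 3 := by
  have hN' : (0 : ℝ) < N := by exact_mod_cast hN
  have c0 : cell N j ⊆ Set.Icc 0 1 := cell_subset (by omega)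
  have c1 : Set.MapsTo (fun x : ℝ => x + 1 / N) (cell N j) (Set.Icc 0 1) :=
    fun x hx => cell_subset hj (add_mem_cell_succ hx)
  set D : (ℝ → ℝ) → ℝ → ℝ := fun g y => g (y + 1 / N) - g y
  have hD : ∀ {g g' : ℝ → ℝ}, (∀ x ∈ Set.Icc (0 : ℝ) 1, HasDerivWithinAt g (g' x) (Set.Icc 0 1) x) →
      ∀ x ∈ cell N j, HasDerivWithinAt (D g) (D g' x) (cell N j) x := fun {g g'} hg x hx =>
    (hasDerivWithinAt_shift hg c1 x hx).sub ((hg x (c0 hx)).mono c0)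
  have hDK : ∀ x ∈ cell N j, |D f'' x| ≤ K * (1 / N) := fun x hx => by
    have := abs_sub_le_of_deriv_bound (convex_Icc (0 : ℝ) 1) hf'' hK (c0 hx) (c1 hx)
    rwa [add_sub_cancel_left, abs_of_nonneg (by positivity : (0 : ℝ) ≤ 1 / N)] at this
  have h1 := abs_trapErr_le hN (hD hf) (hD hf') hDK
  have h2 : fwd (trapErr N f) j = trapErr N (D f) j := by
    have hint : ∀ g : ℝ → ℝ, ContinuousOn g (cell N j) → IntervalIntegrable g
        MeasureTheory.volume ((j : ℝ) / N) (((j : ℝ) + 1) / N) := fun g hg =>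
      ContinuousOn.intervalIntegrable_of_Icc (cell_le j) hg
    have hshift : ContinuousOn (fun x => f (x + 1 / N)) (cell N j) :=
      continuousOn_of_hasDerivWithinAt (hasDerivWithinAt_shift hf c1)
    have e1 : ∫ x in ((j : ℝ) / N)..(((j : ℝ) + 1) / N), D f x
        = (∫ x in (((j + 1 : ℕ) : ℝ) / N)..((((j + 1 : ℕ) : ℝ) + 1) / N), f x)
          - ∫ x in ((j : ℝ) / N)..(((j : ℝ) + 1) / N), f x := by
      rw [intervalIntegral.integral_sub (hint _ hshift)
        (hint _ ((continuousOn_of_hasDerivWithinAt hf).mono c0)),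
        intervalIntegral.integral_comp_add_right]
      push_cast
      simp only [← add_div]
    have e2 : ∀ i : ℕ, (i : ℝ) / N + 1 / N = ((i + 1 : ℕ) : ℝ) / N := fun i => by
      push_cast; ring
    rw [fwd, trapErr, trapErr, trapErr, e1]
    simp only [avg, nodal, D, e2]
    ring
  rw [h2]
  refine h1.trans (le_of_eq ?_)
  ring

theorem abs_fwd_fwd_nodal_le {f f' f'' : ℝ → ℝ} {K : ℝ}
    (hf : ∀ x ∈ Set.Icc (0 : ℝ) 1, HasDerivWithinAt f (f' x) (Set.Icc 0 1) x)
    (hf' : ∀ x ∈ Set.Icc (0 : ℝ) 1, HasDerivWithinAt f' (f'' x) (Set.Icc 0 1) x)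
    (hK : ∀ x ∈ Set.Icc (0 : ℝ) 1, |f'' x| ≤ K) {j : ℕ} (hj : j + 1 < N) :
    |fwd (fwd (nodal N f)) j| ≤ 2 * K * (1 / N) ^ 2 := by
  have t1 := abs_taylor_one_le (convex_Icc (0 : ℝ) 1) hf hf' hK
    (node_mem_Icc (N := N) (j := j + 1) (by omega)) (node_mem_Icc (N := N) (j := j) (by omega))
  have t2 := abs_taylor_one_le (convex_Icc (0 : ℝ) 1) hf hf' hK
    (node_mem_Icc (N := N) (j := j + 1) (by omega)) (node_mem_Icc (N := N) (j := j + 1 + 1) hj)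
  have e1 : (j : ℝ) / N - ((j + 1 : ℕ) : ℝ) / N = -(1 / N) := by push_cast; ring
  have e2 : ((j + 1 + 1 : ℕ) : ℝ) / N - ((j + 1 : ℕ) : ℝ) / N = 1 / N := by push_cast; ring
  rw [e1] at t1
  rw [e2] at t2
  have e3 : fwd (fwd (nodal N f)) j
      = (f ((j + 1 + 1 : ℕ) / N) - f ((j + 1 : ℕ) / N) - f' ((j + 1 : ℕ) / N) * (1 / N))
        + (f (j / N) - f ((j + 1 : ℕ) / N) - f' ((j + 1 : ℕ) / N) * (-(1 / N))) := by
    simp only [fwd, nodal]; ring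
  rw [e3]
  refine (abs_add_le _ _).trans ?_
  linarith [neg_sq (1 / (N : ℝ))]

/-- The cell contribution of a balance law `p = -Φ'` tested with the piecewise affine function with
nodal values `z`: up to the interpolation error of `p`, integration by parts leaves nodal values
of `Φ`, which telescope over the cells, and the mean of `Φ` times the slope. -/
theorem abs_mass_add_flux_le (hN : 0 < N) {p p' p'' Φ : ℝ → ℝ} {K : ℝ} {j : ℕ}
    (hp : ∀ x ∈ cell N j, HasDerivWithinAt p (p' x) (cell N j) x)
    (hp' : ∀ x ∈ cell N j, HasDerivWithinAt p' (p'' x) (cell N j) x)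
    (hK : ∀ x ∈ cell N j, |p'' x| ≤ K)
    (hΦ : ∀ x ∈ cell N j, HasDerivWithinAt Φ (-p x) (cell N j) x) (z : ℕ → ℝ) :
    |1 / N * mass (nodal N p) z j + fwd (fun i => nodal N Φ i * z i) j
        - N * fwd z j * ∫ x in ((j : ℝ) / N)..(((j : ℝ) + 1) / N), Φ x|
      ≤ 2 * K * (1 / N) ^ 3 * (|z j| + |z (j + 1)|) := by
  have hN' : (0 : ℝ) < N := by exact_mod_cast hN
  set P := nodal N p
  set φ : ℝ → ℝ := fun x => z j + fwd z j * (N * x - j)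
  have hφc : Continuous φ := by fun_prop
  have hpc : ContinuousOn p (cell N j) := continuousOn_of_hasDerivWithinAt hp
  have hΦc : ContinuousOn Φ (cell N j) := continuousOn_of_hasDerivWithinAt hΦ
  have hint : ∀ g : ℝ → ℝ, ContinuousOn g (cell N j) → IntervalIntegrable g
      MeasureTheory.volume ((j : ℝ) / N) (((j : ℝ) + 1) / N) := fun g hg =>
    ContinuousOn.intervalIntegrable_of_Icc (cell_le j) hg
  have hpφ : ContinuousOn (fun x => p x * φ x) (cell N j) := hpc.mul hφc.continuousOn
  have hφd : ∀ x, HasDerivAt φ (N * fwd z j) x := fun x => by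
    have := ((((hasDerivAt_id x).const_mul (N : ℝ)).sub_const (j : ℝ)).const_mul
      (fwd z j)).const_add (z j)
    exact this.congr_deriv (by ring)
  have hφ0 : φ (j / N) = z j := by
    simp only [φ]; rw [mul_div_cancel₀ _ hN'.ne']; ring
  have hφ1 : φ ((j + 1) / N) = z (j + 1) := by
    simp only [φ, fwd]; rw [mul_div_cancel₀ _ hN'.ne']; ring
  -- integration by parts on the cell
  have hparts : ∫ x in ((j : ℝ) / N)..(((j : ℝ) + 1) / N), p x * φ x
      = -fwd (fun i => nodal N Φ i * z i) j
        + N * fwd z j * ∫ x in ((j : ℝ) / N)..(((j : ℝ) + 1) / N), Φ x := by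
    have h1 := intervalIntegral.integral_eq_sub_of_hasDerivAt_of_le (f := fun x => Φ x * φ x)
      (f' := fun x => N * fwd z j * Φ x - p x * φ x) (cell_le (N := N) j)
      (hΦc.mul hφc.continuousOn) (fun x hx => by
        have := ((hΦ x (Set.Ioo_subset_Icc_self hx)).hasDerivAt (Icc_mem_nhds hx.1 hx.2)).fun_mul
          (hφd x)
        exact this.congr_deriv (by ring))
      (hint _ ((hΦc.const_mul _).sub hpφ))
    rw [intervalIntegral.integral_sub (hint _ (hΦc.const_mul _)) (hint _ hpφ),
      intervalIntegral.integral_const_mul, hφ0, hφ1] at h1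
    simp only [fwd, nodal]
    push_cast
    simp only [fwd] at h1
    linarith
  have hmass : ∫ x in ((j : ℝ) / N)..(((j : ℝ) + 1) / N), (P j + fwd P j * (N * x - j)) * φ x
      = 1 / N * mass P z j := by
    have h1 := integral_cell_quadratic hN j (P j * z j) (P j * fwd z j + fwd P j * z j)
      (fwd P j * fwd z j)
    have h2 : (1 : ℝ) / N * mass P z j = 1 / N * (P j * z j + (P j * fwd z j + fwd P j * z j) / 2
        + fwd P j * fwd z j / 3) := by simp only [mass, fwd]; ring
    rw [h2, ← h1]
    refine intervalIntegral.integral_congr fun x _ => ?_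
    simp only [φ]; ring
  have hφb : ∀ x ∈ cell N j, |φ x| ≤ |z j| + |z (j + 1)| := fun x hx => by
    obtain ⟨h0, h1⟩ := (mem_cell_iff hN).1 hx
    have e : φ x = (1 - (N * x - j)) * z j + (N * x - j) * z (j + 1) := by
      simp only [φ, fwd]; ring
    rw [e]
    refine (abs_add_le _ _).trans (add_le_add ?_ ?_) <;> rw [abs_mul] <;>
      refine mul_le_of_le_one_left (abs_nonneg _) (abs_le.2 ⟨by linarith, by linarith⟩)
  have hb := abs_integral_cell_le (j := j)
    (F := fun x => (P j + fwd P j * (N * x - j) - p x) * φ x)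
    (C := 2 * K * (1 / N) ^ 2 * (|z j| + |z (j + 1)|)) (fun x hx => by
      have h1 := abs_interp_sub_le hN hp hp' hK hx
      rw [abs_mul]
      exact mul_le_mul h1 (hφb x hx) (abs_nonneg _) ((abs_nonneg _).trans h1))
  simp only [sub_mul] at hb
  rw [intervalIntegral.integral_sub (Continuous.intervalIntegrable (by fun_prop) _ _)
    (hint _ hpφ), hmass, hparts] at hb
  calc _ = |1 / N * mass P z j - (-fwd (fun i => nodal N Φ i * z i) j
        + N * fwd z j * ∫ x in ((j : ℝ) / N)..(((j : ℝ) + 1) / N), Φ x)| := by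
        congr 1; ring
    _ ≤ _ := hb
    _ = _ := by ring

end Cells

end

section

open Finset

/-! ### The residual of the interpolated solution -/

theorem sum_fwd_mul (z ω : ℕ → ℝ) (n : ℕ) :
    ∑ j ∈ range (n + 1), fwd z j * ω j
      = z (n + 1) * ω n - z 0 * ω 0 - ∑ j ∈ range n, z (j + 1) * fwd ω j := by
  induction n with
  | zero => simp [fwd]; ring
  | succ n ih =>
    rw [sum_range_succ, ih, sum_range_succ (fun j => z (j + 1) * fwd ω j)]
    simp only [fwd]
    ring

namespace State

variable {N : ℕ}

theorem sum_cellSize_le [NeZero N] (z : State N) :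
    ∑ j ∈ range N, 1 / (N : ℝ) * cellSize z j ≤ 6 * ‖z‖ := by
  have hN : (0 : ℝ) < N := by exact_mod_cast Nat.pos_of_neZero N
  refine le_of_sq_le_sq ?_ (by positivity)
  rw [← mul_sum]
  have h1 := sum_cellSize_sq_le z
  rw [← mul_sum] at h1
  have h2 : (∑ j ∈ range N, cellSize z j) ^ 2 ≤ N * ∑ j ∈ range N, cellSize z j ^ 2 := by
    simpa using sq_sum_le_card_mul_sum_sq (s := range N) (f := cellSize z)
  calc (1 / (N : ℝ) * ∑ j ∈ range N, cellSize z j) ^ 2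
      = (1 / (N : ℝ)) ^ 2 * (∑ j ∈ range N, cellSize z j) ^ 2 := by ring
    _ ≤ (1 / (N : ℝ)) ^ 2 * (N * ∑ j ∈ range N, cellSize z j ^ 2) := by gcongr
    _ = 1 / (N : ℝ) * ∑ j ∈ range N, cellSize z j ^ 2 := by field_simp
    _ ≤ 30 * ‖z‖ ^ 2 := h1
    _ ≤ _ := by nlinarith [sq_nonneg ‖z‖]

/-- The inverse inequality for nodal values. -/
theorem sqrt_mul_abs_H_le [NeZero N] (z : State N) {j : ℕ} (hj : j ≤ N) :
    √(1 / N) * |z.H j| ≤ 6 * ‖z‖ := by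
  have hN : 0 < N := Nat.pos_of_neZero N
  have hN' : (0 : ℝ) < N := by exact_mod_cast hN
  obtain ⟨i, hi, hle⟩ : ∃ i < N, |z.H j| ≤ cellSize z i := by
    rcases Nat.lt_or_ge j N with h | h
    · exact ⟨j, h, le_trans (by linarith [abs_nonneg (z.H (j + 1))]) (abs_H_add_le_cellSize z j)⟩
    · refine ⟨N - 1, by omega, ?_⟩
      have := abs_H_add_le_cellSize z (N - 1)
      rw [show N - 1 + 1 = j by omega] at this
      linarith [abs_nonneg (z.H (N - 1))]
  refine le_of_sq_le_sq ?_ (by positivity)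
  rw [mul_pow, Real.sq_sqrt (by positivity)]
  have h1 : 1 / (N : ℝ) * cellSize z i ^ 2 ≤ 30 * ‖z‖ ^ 2 :=
    (single_le_sum (f := fun j => 1 / (N : ℝ) * cellSize z j ^ 2) (fun _ _ => by positivity)
      (mem_range.2 hi)).trans (sum_cellSize_sq_le z)
  calc 1 / (N : ℝ) * |z.H j| ^ 2 ≤ 1 / N * cellSize z i ^ 2 := by gcongr
    _ ≤ 30 * ‖z‖ ^ 2 := h1
    _ ≤ _ := by nlinarith [sq_nonneg ‖z‖]

/-- Summation by parts against a slowly varying grid function. The boundary terms are the reason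
for the loss of half a power of the mesh length. -/
theorem abs_sum_fwd_H_mul_le [NeZero N] (z : State N) {ω : ℕ → ℝ} {C : ℝ} (hC : 0 ≤ C)
    (h0 : ∀ j < N, |ω j| ≤ C * (1 / N) ^ 2)
    (h1 : ∀ j, j + 1 < N → |fwd ω j| ≤ C * (1 / N) ^ 3) :
    |∑ j ∈ range N, fwd z.H j * ω j| ≤ 18 * C * √(1 / N) ^ 3 * ‖z‖ := by
  have hN : 0 < N := Nat.pos_of_neZero N
  have hN' : (1 : ℝ) ≤ N := by exact_mod_cast hN
  obtain ⟨n, rfl⟩ : ∃ n, N = n + 1 := ⟨N - 1, by omega⟩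
  rw [sum_fwd_mul]
  obtain ⟨s, hs⟩ : ∃ s, s = √(1 / ((n + 1 : ℕ) : ℝ)) := ⟨_, rfl⟩
  have hs0 : 0 ≤ s := hs ▸ Real.sqrt_nonneg _
  have hs2 : 1 / ((n + 1 : ℕ) : ℝ) = s ^ 2 := by rw [hs, Real.sq_sqrt (by positivity)]
  have hs1 : s ≤ 1 := by
    rw [hs]; exact Real.sqrt_le_one.2 (div_le_one_of_le₀ hN' (by positivity))
  have b : ∀ j i, j ≤ n + 1 → i < n + 1 → |z.H j * ω i| ≤ 6 * C * s ^ 3 * ‖z‖ := by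
    intro j i hj hi
    have e1 := sqrt_mul_abs_H_le z hj
    have e2 := h0 i hi
    rw [← hs] at e1
    rw [hs2] at e2
    rw [abs_mul]
    calc |z.H j| * |ω i| ≤ |z.H j| * (C * (s ^ 2) ^ 2) := by gcongr
      _ = C * s ^ 3 * (s * |z.H j|) := by ring
      _ ≤ C * s ^ 3 * (6 * ‖z‖) := by gcongr
      _ = _ := by ring
  have hsum : |∑ j ∈ range n, z.H (j + 1) * fwd ω j| ≤ 6 * C * s ^ 3 * ‖z‖ := by
    calc |∑ j ∈ range n, z.H (j + 1) * fwd ω j|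
        ≤ ∑ j ∈ range n, |z.H (j + 1) * fwd ω j| := abs_sum_le_sum_abs _ _
      _ ≤ ∑ j ∈ range n, C * s ^ 4 * (1 / ((n + 1 : ℕ) : ℝ) * cellSize z j) := by
        refine sum_le_sum fun j hj => ?_
        have hj' := mem_range.1 hj
        have e1 := h1 j (by omega)
        have e2 := abs_H_add_le_cellSize z j
        rw [hs2] at e1 ⊢
        rw [abs_mul]
        calc |z.H (j + 1)| * |fwd ω j| ≤ cellSize z j * (C * (s ^ 2) ^ 3) := by
              refine mul_le_mul ?_ e1 (abs_nonneg _) (cellSize_nonneg z j)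
              linarith [abs_nonneg (z.H j)]
          _ = _ := by ring
      _ ≤ ∑ j ∈ range (n + 1), C * s ^ 4 * (1 / ((n + 1 : ℕ) : ℝ) * cellSize z j) := by
        refine sum_le_sum_of_subset_of_nonneg (range_mono (by omega)) fun j _ _ => ?_
        have := cellSize_nonneg z j
        positivity
      _ = C * s ^ 4 * ∑ j ∈ range (n + 1), (1 / ((n + 1 : ℕ) : ℝ) * cellSize z j) := by
        rw [mul_sum]
      _ ≤ C * s ^ 4 * (6 * ‖z‖) := by
        gcongr
        exact sum_cellSize_le z
      _ ≤ C * s ^ 3 * (6 * ‖z‖) := by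
        gcongr C * ?_ * (6 * ‖z‖)
        exact pow_le_pow_of_le_one hs0 hs1 (by norm_num)
      _ = _ := by ring
  have b1 := b (n + 1) n le_rfl (by omega)
  have b2 := b 0 0 (by omega) (by omega)
  rw [← hs]
  refine (abs_sub _ _).trans ((add_le_add ((abs_sub _ _).trans (add_le_add b1 b2)) hsum).trans
    (le_of_eq ?_))
  ring

end State

/-- A function on `s` with a first and a second derivative there, both bounded by `K`, as is the
function itself. -/
structure C2Bound (s : Set ℝ) (K : ℝ) (f f' f'' : ℝ → ℝ) : Prop where
  deriv1 : ∀ x ∈ s, HasDerivWithinAt f (f' x) s x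
  deriv2 : ∀ x ∈ s, HasDerivWithinAt f' (f'' x) s x
  le0 : ∀ x ∈ s, |f x| ≤ K
  le1 : ∀ x ∈ s, |f' x| ≤ K
  le2 : ∀ x ∈ s, |f'' x| ≤ K

theorem C2Bound.mono {s t : Set ℝ} {K : ℝ} {f f' f'' : ℝ → ℝ} (h : C2Bound s K f f' f'')
    (hts : t ⊆ s) : C2Bound t K f f' f'' :=
  ⟨fun x hx => (h.deriv1 x (hts hx)).mono hts, fun x hx => (h.deriv2 x (hts hx)).mono hts,
    fun x hx => h.le0 x (hts hx), fun x hx => h.le1 x (hts hx), fun x hx => h.le2 x (hts hx)⟩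

variable {N : ℕ}

/-- Consistency: if `p = -(b + α a b)'` and `q - q'' / 3 = -(a + β b² / 2 + γ a² / 2)'`, then the
nodal values of `(p, q)` agree with the discrete right-hand side at the nodal values of `(a, b)` up
to `O(h^{3/2})`. -/
theorem norm_residual_le [NeZero N] {α β γ K : ℝ} (hα : |α| ≤ 2) (hβ : |β| ≤ 2) (hγ : |γ| ≤ 2)
    {a a' a'' b b' b'' p p' p'' q q' q'' f' f'' : ℝ → ℝ}
    (ha : C2Bound (Set.Icc 0 1) K a a' a'') (hb : C2Bound (Set.Icc 0 1) K b b' b'')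
    (hp : C2Bound (Set.Icc 0 1) K p p' p'') (hq : C2Bound (Set.Icc 0 1) K q q' q'')
    (hf : C2Bound (Set.Icc 0 1) K (fun x => a x + β / 2 * b x ^ 2 + γ / 2 * a x ^ 2) f' f'')
    (hmass : ∀ x ∈ Set.Icc (0 : ℝ) 1,
      HasDerivWithinAt (fun x => b x + α * (a x * b x)) (-p x) (Set.Icc 0 1) x)
    (hmom : ∀ x ∈ Set.Icc (0 : ℝ) 1,
      HasDerivWithinAt (fun x => a x + β / 2 * b x ^ 2 + γ / 2 * a x ^ 2 - 1 / 3 * q' x) (-q x)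
        (Set.Icc 0 1) x)
    (hb0 : b 0 = 0) (hb1 : b 1 = 0) (hq0 : q 0 = 0) (hq1 : q 1 = 0) :
    ‖State.mk N (nodal N p) (nodal N q) - quadField (State.linOp N) (State.quadOp N α β γ)
        (State.mk N (nodal N a) (nodal N b))‖ ≤ 100 * (K + K ^ 2) * √(1 / N) ^ 3 := by
  have hN : 0 < N := Nat.pos_of_neZero N
  have hN' : (0 : ℝ) < N := by exact_mod_cast hN
  have hN1 : (1 : ℝ) ≤ N := by exact_mod_cast hN
  have hK : 0 ≤ K := (abs_nonneg _).trans (ha.le0 0 (by simp))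
  obtain ⟨s, hs⟩ : ∃ s, s = √(1 / (N : ℝ)) := ⟨_, rfl⟩
  have hs0 : 0 ≤ s := hs ▸ Real.sqrt_nonneg _
  have hs2 : 1 / (N : ℝ) = s ^ 2 := by rw [hs, Real.sq_sqrt (by positivity)]
  have hs1 : s ≤ 1 := by
    rw [hs]; exact Real.sqrt_le_one.2 (div_le_one_of_le₀ hN1 (by positivity))
  set g : ℝ → ℝ := fun x => b x + α * (a x * b x) with hg
  set f : ℝ → ℝ := fun x => a x + β / 2 * b x ^ 2 + γ / 2 * a x ^ 2 with hfdef
  set Φ : ℝ → ℝ := fun x => f x - 1 / 3 * q' x with hΦ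
  set A := nodal N a
  set B := nodal N b
  set P := nodal N p
  set Q := nodal N q
  refine State.norm_le_of_inner_le (by positivity) fun z => ?_
  -- cell contributions of the two equations
  set T₁ : ℕ → ℝ := fun j => 1 / N * mass P z.H j + fwd B j * avg z.H j
    + α * (fwd A j * mass B z.H j + fwd B j * mass A z.H j) with hT₁
  set T₂ : ℕ → ℝ := fun j => 1 / N * mass Q z.U j + 1 / 3 * (N * (fwd Q j * fwd z.U j))
    - fwd z.U j * avg A j - β / 2 * (fwd z.U j * mass B B j)
    - γ / 2 * (fwd z.U j * mass A A j) with hT₂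
  have hinner : inner ℝ (State.mk N P Q - quadField (State.linOp N) (State.quadOp N α β γ)
      (State.mk N A B)) z = ∑ j ∈ range N, T₁ j + ∑ j ∈ range N, T₂ j := by
    rw [inner_sub_left, quadField, inner_add_left, State.inner_linOp, State.inner_quadOp,
      State.inner_eq, State.form, State.linForm, State.quadForm]
    simp only [← sum_add_distrib, ← sum_sub_distrib]
    refine sum_congr rfl fun j hj => ?_
    have hH : ∀ (c d : ℕ → ℝ) i, i ≤ N → (State.mk N c d).H i = c i := fun c d i hi => by
      simp [hi]
    have hU : ∀ (c d : ℕ → ℝ), d 0 = 0 → d N = 0 → ∀ i, i ≤ N → (State.mk N c d).U i = d i := by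
      intro c d h0 h1 i hi
      rcases Nat.eq_zero_or_pos i with rfl | hi0
      · simp [h0]
      · rcases Nat.lt_or_ge i N with h | h
        · simp [hi0, h]
        · obtain rfl : i = N := le_antisymm hi h
          simp [h1]
    have hB0 : B 0 = 0 := by simp [B, nodal, hb0]
    have hBN : B N = 0 := by simp [B, nodal, hN'.ne', hb1]
    have hQ0 : Q 0 = 0 := by simp [Q, nodal, hq0]
    have hQN : Q N = 0 := by simp [Q, nodal, hN'.ne', hq1]
    have hj0 : j ≤ N := (mem_range.1 hj).le
    have hj1 : j + 1 ≤ N := mem_range.1 hj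
    simp only [hT₁, hT₂, mass, fwd, avg, hH _ _ j hj0, hH _ _ _ hj1, hU A B hB0 hBN j hj0,
      hU A B hB0 hBN _ hj1, hU P Q hQ0 hQN j hj0, hU P Q hQ0 hQN _ hj1]
    ring
  have hdA : ∀ j < N, |fwd A j| ≤ K * (1 / N) := fun j hj =>
    abs_fwd_nodal_le (ha.mono (cell_subset hj)).deriv1 (ha.mono (cell_subset hj)).le1
  have hdB : ∀ j < N, |fwd B j| ≤ K * (1 / N) := fun j hj =>
    abs_fwd_nodal_le (hb.mono (cell_subset hj)).deriv1 (hb.mono (cell_subset hj)).le1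
  -- first equation: `E₁` is the interpolation error of `p`, and the errors `ω` of the flux have
  -- to be summed by parts, since the slope of `z.H` is not controlled by the norm
  set ω : ℕ → ℝ := fun j => trapErr N g j - α / 6 * (fwd A j * fwd B j) with hω
  set E₁ : ℕ → ℝ := fun j => 1 / N * mass P z.H j + fwd (fun i => nodal N g i * z.H i) j
        - N * fwd z.H j * ∫ x in ((j : ℝ) / N)..(((j : ℝ) + 1) / N), g x with hE₁
  have hT₁eq : ∀ j, T₁ j = E₁ j - fwd z.H j * ω j := by
    intro j
    have : ∀ i, nodal N g i = B i + α * (A i * B i) := fun _ => rfl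
    simp only [hT₁, hE₁, hω, trapErr, this, avg, mass, fwd]
    ring
  have sumE : ∀ (E c : ℕ → ℝ), (∀ j < N, |E j| ≤ 2 * K * (1 / N) ^ 3 * (|c j| + |c (j + 1)|)) →
      (∀ j, |c j| + |c (j + 1)| ≤ z.cellSize j) →
      |∑ j ∈ range N, E j| ≤ 12 * K * s ^ 3 * ‖z‖ := by
    intro E c hE hc
    calc |∑ j ∈ range N, E j| ≤ ∑ j ∈ range N, |E j| := abs_sum_le_sum_abs _ _
      _ ≤ ∑ j ∈ range N, 2 * K * s ^ 4 * (1 / (N : ℝ) * z.cellSize j) := by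
        refine sum_le_sum fun j hj => (hE j (mem_range.1 hj)).trans ?_
        have := hc j
        rw [hs2]
        calc 2 * K * (s ^ 2) ^ 3 * (|c j| + |c (j + 1)|)
            ≤ 2 * K * (s ^ 2) ^ 3 * z.cellSize j := by gcongr
          _ = _ := by ring
      _ = 2 * K * s ^ 4 * ∑ j ∈ range N, (1 / (N : ℝ) * z.cellSize j) := by rw [mul_sum]
      _ ≤ 2 * K * s ^ 4 * (6 * ‖z‖) := by
        gcongr
        exact State.sum_cellSize_le z
      _ ≤ 2 * K * s ^ 3 * (6 * ‖z‖) := by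
        gcongr 2 * K * ?_ * (6 * ‖z‖)
        exact pow_le_pow_of_le_one hs0 hs1 (by norm_num)
      _ = _ := by ring
  have hsumE₁ : |∑ j ∈ range N, E₁ j| ≤ 12 * K * s ^ 3 * ‖z‖ := by
    refine sumE E₁ z.H (fun j hj => ?_) (State.abs_H_add_le_cellSize z)
    have hp' := hp.mono (cell_subset hj)
    exact abs_mass_add_flux_le hN hp'.deriv1 hp'.deriv2 hp'.le2
      (fun x hx => (hmass x (cell_subset hj hx)).mono (cell_subset hj)) z.H
  have hα6 : |α / 6| ≤ 1 / 3 := by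
    rw [abs_div, abs_of_pos (by norm_num : (0 : ℝ) < 6)]; linarith
  have hω0 : ∀ j < N, |ω j| ≤ (2 * K + 2 * K ^ 2) * (1 / N) ^ 2 := by
    intro j hj
    have hp' := hp.mono (cell_subset hj)
    have e1 := abs_trapErr_le hN
      (fun x hx => (hmass x (cell_subset hj hx)).mono (cell_subset hj))
      (f'' := fun x => -p' x) (K := K) (fun x hx => (hp'.deriv1 x hx).neg)
      (fun x hx => by rw [abs_neg]; exact hp'.le1 x hx)
    have e2 : |α / 6 * (fwd A j * fwd B j)| ≤ 1 / 3 * ((K * (1 / N)) * (K * (1 / N))) := by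
      rw [abs_mul, abs_mul]
      have := hdA j hj
      have := hdB j hj
      gcongr
    refine (abs_sub _ _).trans ((add_le_add e1 e2).trans ?_)
    have : 0 ≤ K ^ 2 * (1 / (N : ℝ)) ^ 2 := by positivity
    linarith
  have hω1 : ∀ j, j + 1 < N → |fwd ω j| ≤ (2 * K + 2 * K ^ 2) * (1 / N) ^ 3 := by
    intro j hj
    have e1 := abs_fwd_trapErr_le hN hmass (f'' := fun x => -p' x) (f''' := fun x => -p'' x)
      (K := K) (fun x hx => (hp.deriv1 x hx).neg) (fun x hx => (hp.deriv2 x hx).neg)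
      (fun x hx => by rw [abs_neg]; exact hp.le2 x hx) hj
    have e2 : |α / 6 * (fwd (fwd A) j * fwd B (j + 1) + fwd A j * fwd (fwd B) j)|
        ≤ 1 / 3 * (2 * K * (1 / N) ^ 2 * (K * (1 / N)) + K * (1 / N) * (2 * K * (1 / N) ^ 2)) := by
      have a1 := hdA j (by omega)
      have a2 := hdB (j + 1) hj
      have a3 := abs_fwd_fwd_nodal_le ha.deriv1 ha.deriv2 ha.le2 hj
      have a4 := abs_fwd_fwd_nodal_le hb.deriv1 hb.deriv2 hb.le2 hj
      rw [abs_mul]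
      refine mul_le_mul hα6 ((abs_add_le _ _).trans (add_le_add ?_ ?_)) (abs_nonneg _)
        (by norm_num)
      · rw [abs_mul]
        exact mul_le_mul a3 a2 (abs_nonneg _) (by positivity)
      · rw [abs_mul]
        exact mul_le_mul a1 a4 (abs_nonneg _) (by positivity)
    have e3 : fwd ω j = fwd (trapErr N g) j
        - α / 6 * (fwd (fwd A) j * fwd B (j + 1) + fwd A j * fwd (fwd B) j) := by
      simp only [hω, fwd]; ring
    rw [e3]
    refine (abs_sub _ _).trans ((add_le_add e1 e2).trans ?_)
    have : 0 ≤ K ^ 2 * (1 / (N : ℝ)) ^ 3 := by positivity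
    linarith
  have hsumω := State.abs_sum_fwd_H_mul_le z (by positivity) hω0 hω1
  rw [← hs] at hsumω
  -- second equation: the slope of `z.U` is controlled by the norm, so that the flux errors `ψ`
  -- can be estimated directly
  set ψ : ℕ → ℝ := fun j => trapErr N f j
    - (β / 12 * (fwd B j * fwd B j) + γ / 12 * (fwd A j * fwd A j)) with hψ
  set E₂ : ℕ → ℝ := fun j => 1 / N * mass Q z.U j + fwd (fun i => nodal N Φ i * z.U i) j
        - N * fwd z.U j * ∫ x in ((j : ℝ) / N)..(((j : ℝ) + 1) / N), Φ x with hE₂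
  have hT₂eq : ∀ j < N, T₂ j = E₂ j - fwd (fun i => nodal N Φ i * z.U i) j - fwd z.U j * ψ j := by
    intro j hj
    have hf1 := hf.mono (cell_subset hj)
    have hq1 := hq.mono (cell_subset hj)
    have i1 : ∫ x in ((j : ℝ) / N)..(((j : ℝ) + 1) / N), q' x = fwd Q j := by
      rw [intervalIntegral.integral_eq_sub_of_hasDerivAt_of_le (f := q) (cell_le j)
        (continuousOn_of_hasDerivWithinAt hq1.deriv1)
        (fun x hx => (hq1.deriv1 x (Set.Ioo_subset_Icc_self hx)).hasDerivAt
          (Icc_mem_nhds hx.1 hx.2))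
        (ContinuousOn.intervalIntegrable_of_Icc (cell_le j)
          (continuousOn_of_hasDerivWithinAt hq1.deriv2))]
      simp only [fwd, Q, nodal]
      push_cast
      rfl
    have i2 : ∫ x in ((j : ℝ) / N)..(((j : ℝ) + 1) / N), Φ x
        = (∫ x in ((j : ℝ) / N)..(((j : ℝ) + 1) / N), f x) - 1 / 3 * fwd Q j := by
      rw [← i1, ← intervalIntegral.integral_const_mul, ← intervalIntegral.integral_sub]
      · exact ContinuousOn.intervalIntegrable_of_Icc (cell_le j)
          (continuousOn_of_hasDerivWithinAt hf1.deriv1)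
      · exact ContinuousOn.intervalIntegrable_of_Icc (cell_le j)
          ((continuousOn_of_hasDerivWithinAt hq1.deriv2).const_mul _)
    have : ∀ i, nodal N f i = A i + β / 2 * B i ^ 2 + γ / 2 * A i ^ 2 := fun _ => rfl
    simp only [hT₂, hE₂, hψ, i2, trapErr, this, avg, mass]
    simp only [fwd]
    ring
  have hsumE₂ : |∑ j ∈ range N, E₂ j| ≤ 12 * K * s ^ 3 * ‖z‖ := by
    refine sumE E₂ z.U (fun j hj => ?_) (State.abs_U_add_le_cellSize z)
    have hq' := hq.mono (cell_subset hj)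
    exact abs_mass_add_flux_le hN hq'.deriv1 hq'.deriv2 hq'.le2
      (fun x hx => (hmom x (cell_subset hj hx)).mono (cell_subset hj)) z.U
  have htel : ∑ j ∈ range N, fwd (fun i => nodal N Φ i * z.U i) j = 0 := by
    rw [sum_fwd, z.U_zero_eq, z.U_eq_zero le_rfl]; simp
  have hψ0 : ∀ j < N, |ψ j| ≤ (2 * K + K ^ 2) * (1 / N) ^ 2 := by
    intro j hj
    have hf' := hf.mono (cell_subset hj)
    have e1 := abs_trapErr_le hN hf'.deriv1 hf'.deriv2 hf'.le2
    have hβ' : |β / 12| ≤ 1 / 6 := by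
      rw [abs_div, abs_of_pos (by norm_num : (0 : ℝ) < 12)]; linarith
    have hγ' : |γ / 12| ≤ 1 / 6 := by
      rw [abs_div, abs_of_pos (by norm_num : (0 : ℝ) < 12)]; linarith
    have e2 : |β / 12 * (fwd B j * fwd B j)| ≤ 1 / 6 * ((K * (1 / N)) * (K * (1 / N))) := by
      rw [abs_mul, abs_mul]
      have := hdB j hj
      gcongr
    have e3 : |γ / 12 * (fwd A j * fwd A j)| ≤ 1 / 6 * ((K * (1 / N)) * (K * (1 / N))) := by
      rw [abs_mul, abs_mul]
      have := hdA j hj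
      gcongr
    refine (abs_sub _ _).trans ((add_le_add e1 ((abs_add_le _ _).trans
      (add_le_add e2 e3))).trans ?_)
    have : 0 ≤ K ^ 2 * (1 / (N : ℝ)) ^ 2 := by positivity
    linarith
  have hsumψ : |∑ j ∈ range N, fwd z.U j * ψ j| ≤ 6 * (2 * K + K ^ 2) * s ^ 3 * ‖z‖ := by
    calc |∑ j ∈ range N, fwd z.U j * ψ j| ≤ ∑ j ∈ range N, |fwd z.U j * ψ j| :=
          abs_sum_le_sum_abs _ _
      _ ≤ ∑ j ∈ range N, (2 * K + K ^ 2) * s ^ 4 * (1 / (N : ℝ) * z.cellSize j) := by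
        refine sum_le_sum fun j hj => ?_
        have e1 := hψ0 j (mem_range.1 hj)
        have e2 := State.abs_fwd_U_le_cellSize z j
        have e3 := State.cellSize_nonneg z j
        rw [abs_mul]
        calc |fwd z.U j| * |ψ j|
            ≤ (1 / N * z.cellSize j) * ((2 * K + K ^ 2) * (1 / N) ^ 2) := by gcongr
          _ = _ := by rw [hs2]; ring
      _ = (2 * K + K ^ 2) * s ^ 4 * ∑ j ∈ range N, (1 / (N : ℝ) * z.cellSize j) := by rw [mul_sum]
      _ ≤ (2 * K + K ^ 2) * s ^ 4 * (6 * ‖z‖) := by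
        gcongr
        exact State.sum_cellSize_le z
      _ ≤ (2 * K + K ^ 2) * s ^ 3 * (6 * ‖z‖) := by
        gcongr (2 * K + K ^ 2) * ?_ * (6 * ‖z‖)
        exact pow_le_pow_of_le_one hs0 hs1 (by norm_num)
      _ = _ := by ring
  have r1 : ∑ j ∈ range N, T₁ j = ∑ j ∈ range N, E₁ j - ∑ j ∈ range N, fwd z.H j * ω j := by
    rw [← sum_sub_distrib]; exact sum_congr rfl fun j _ => hT₁eq j
  have r2 : ∑ j ∈ range N, T₂ j = ∑ j ∈ range N, E₂ j - ∑ j ∈ range N, fwd z.U j * ψ j := by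
    have : ∑ j ∈ range N, T₂ j = ∑ j ∈ range N, E₂ j
        - ∑ j ∈ range N, fwd (fun i => nodal N Φ i * z.U i) j
        - ∑ j ∈ range N, fwd z.U j * ψ j := by
      rw [← sum_sub_distrib, ← sum_sub_distrib]
      exact sum_congr rfl fun j hj => hT₂eq j (mem_range.1 hj)
    rw [this, htel, sub_zero]
  rw [hinner, r1, r2, ← hs]
  refine (abs_add_le _ _).trans ((add_le_add ((abs_sub _ _).trans (add_le_add hsumE₁ hsumω))
    ((abs_sub _ _).trans (add_le_add hsumE₂ hsumψ))).trans ?_)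
  have e1 : 0 ≤ K * (s ^ 3 * ‖z‖) := by positivity
  have e2 : 0 ≤ K ^ 2 * (s ^ 3 * ‖z‖) := by positivity
  linarith

end

section

open Set

/-! ### Smooth functions on the space-time rectangle -/

/-- The closed space-time rectangle. -/
def rect (T : ℝ) : Set (ℝ × ℝ) := Icc 0 1 ×ˢ Icc 0 T

/-- `w = w(x, t)` is of class `C^n` on the closed space-time rectangle. -/
def SmoothRect (T : ℝ) (n : ℕ) (w : ℝ → ℝ → ℝ) : Prop :=
  ContDiffOn ℝ n (fun p : ℝ × ℝ => w p.1 p.2) (rect T)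

section

variable {T : ℝ} {n : ℕ} {w : ℝ → ℝ → ℝ} {x t : ℝ}

theorem uniqueDiffOn_rect (hT : 0 < T) : UniqueDiffOn ℝ (rect T) :=
  (uniqueDiffOn_Icc one_pos).prod (uniqueDiffOn_Icc hT)

theorem SmoothRect.of_le {m : ℕ} (hw : SmoothRect T n w) (hmn : m ≤ n) : SmoothRect T m w :=
  ContDiffOn.of_le hw (by exact_mod_cast hmn)

theorem SmoothRect.hasFDerivWithinAt (hw : SmoothRect T (n + 1) w) {p : ℝ × ℝ} (hp : p ∈ rect T) :
    HasFDerivWithinAt (fun p : ℝ × ℝ => w p.1 p.2)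
      (fderivWithin ℝ (fun p : ℝ × ℝ => w p.1 p.2) (rect T) p) (rect T) p :=
  ((ContDiffOn.differentiableOn hw (by simp)) p hp).hasFDerivWithinAt

theorem hasDerivWithinAt_fst_of_rect {f : ℝ × ℝ → ℝ} {f' : ℝ × ℝ →L[ℝ] ℝ} (ht : t ∈ Icc 0 T)
    (hf : HasFDerivWithinAt f f' (rect T) (x, t)) :
    HasDerivWithinAt (fun y => f (y, t)) (f' (1, 0)) (Icc 0 1) x := by
  have h1 : HasDerivWithinAt (fun y : ℝ => (y, t)) ((1 : ℝ), (0 : ℝ)) (Icc 0 1) x :=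
    (hasDerivWithinAt_id x _).prodMk (hasDerivWithinAt_const x _ t)
  exact HasFDerivWithinAt.comp_hasDerivWithinAt x hf h1 fun y hy => ⟨hy, ht⟩

theorem hasDerivWithinAt_snd_of_rect {f : ℝ × ℝ → ℝ} {f' : ℝ × ℝ →L[ℝ] ℝ}
    (hx : x ∈ Icc (0 : ℝ) 1) (hf : HasFDerivWithinAt f f' (rect T) (x, t)) :
    HasDerivWithinAt (fun s => f (x, s)) (f' (0, 1)) (Icc 0 T) t := by
  have h1 : HasDerivWithinAt (fun s : ℝ => (x, s)) ((0 : ℝ), (1 : ℝ)) (Icc 0 T) t :=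
    (hasDerivWithinAt_const t _ x).prodMk (hasDerivWithinAt_id t _)
  exact HasFDerivWithinAt.comp_hasDerivWithinAt t hf h1 fun y hy => ⟨hx, hy⟩

theorem SmoothRect.dx_eq (hw : SmoothRect T (n + 1) w) (hx : x ∈ Icc (0 : ℝ) 1)
    (ht : t ∈ Icc 0 T) :
    dx w x t = fderivWithin ℝ (fun p : ℝ × ℝ => w p.1 p.2) (rect T) (x, t) (1, 0) :=
  (hasDerivWithinAt_fst_of_rect ht (hw.hasFDerivWithinAt ⟨hx, ht⟩)).derivWithin
    (uniqueDiffOn_Icc one_pos x hx)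

theorem SmoothRect.dt_eq (hT : 0 < T) (hw : SmoothRect T (n + 1) w) (hx : x ∈ Icc (0 : ℝ) 1)
    (ht : t ∈ Icc 0 T) :
    dt T w x t = fderivWithin ℝ (fun p : ℝ × ℝ => w p.1 p.2) (rect T) (x, t) (0, 1) :=
  (hasDerivWithinAt_snd_of_rect hx (hw.hasFDerivWithinAt ⟨hx, ht⟩)).derivWithin
    (uniqueDiffOn_Icc hT t ht)

theorem SmoothRect.hasDerivWithinAt_x (hw : SmoothRect T (n + 1) w) (hx : x ∈ Icc (0 : ℝ) 1)
    (ht : t ∈ Icc 0 T) : HasDerivWithinAt (fun y => w y t) (dx w x t) (Icc 0 1) x := by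
  rw [hw.dx_eq hx ht]
  exact hasDerivWithinAt_fst_of_rect ht (hw.hasFDerivWithinAt ⟨hx, ht⟩)

theorem SmoothRect.hasDerivWithinAt_t (hT : 0 < T) (hw : SmoothRect T (n + 1) w)
    (hx : x ∈ Icc (0 : ℝ) 1) (ht : t ∈ Icc 0 T) :
    HasDerivWithinAt (fun s => w x s) (dt T w x t) (Icc 0 T) t := by
  rw [hw.dt_eq hT hx ht]
  exact hasDerivWithinAt_snd_of_rect hx (hw.hasFDerivWithinAt ⟨hx, ht⟩)

theorem SmoothRect.contDiffOn_fderivWithin (hT : 0 < T) (hw : SmoothRect T (n + 1) w) :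
    ContDiffOn ℝ n (fderivWithin ℝ (fun p : ℝ × ℝ => w p.1 p.2) (rect T)) (rect T) :=
  ContDiffOn.fderivWithin hw (uniqueDiffOn_rect hT) (by simp)

theorem SmoothRect.smooth_dx (hT : 0 < T) (hw : SmoothRect T (n + 1) w) : SmoothRect T n (dx w) :=
  ((hw.contDiffOn_fderivWithin hT).clm_apply contDiffOn_const).congr fun _ hp =>
    hw.dx_eq hp.1 hp.2

theorem SmoothRect.smooth_dt (hT : 0 < T) (hw : SmoothRect T (n + 1) w) : SmoothRect T n (dt T w) :=
  ((hw.contDiffOn_fderivWithin hT).clm_apply contDiffOn_const).congr fun _ hp =>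
    hw.dt_eq hT hp.1 hp.2

theorem SmoothRect.exists_bound (hw : SmoothRect T n w) :
    ∃ K, ∀ x ∈ Icc (0 : ℝ) 1, ∀ t ∈ Icc 0 T, |w x t| ≤ K := by
  obtain ⟨K, hK⟩ := (isCompact_Icc.prod isCompact_Icc).exists_bound_of_continuousOn
    (ContDiffOn.continuousOn hw)
  exact ⟨K, fun x hx t ht => hK (x, t) ⟨hx, ht⟩⟩

/-- Mixed partial derivatives commute up to the boundary of the rectangle. -/
theorem SmoothRect.dt_dx_comm (hT : 0 < T) (hw : SmoothRect T (n + 2) w)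
    (hx : x ∈ Icc (0 : ℝ) 1) (ht : t ∈ Icc 0 T) :
    dt T (dx w) x t = dx (dt T w) x t := by
  set W : ℝ × ℝ → ℝ := fun p => w p.1 p.2
  have hp : (x, t) ∈ rect T := ⟨hx, ht⟩
  have h1 : DifferentiableOn ℝ (fderivWithin ℝ W (rect T)) (rect T) :=
    (hw.contDiffOn_fderivWithin (n := n + 1) hT).differentiableOn (by simp)
  have h2 := (h1 (x, t) hp).hasFDerivWithinAt
  have e1 : dt T (dx w) x t
      = fderivWithin ℝ (fderivWithin ℝ W (rect T)) (rect T) (x, t) (0, 1) (1, 0) := by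
    have h3 := hasDerivWithinAt_snd_of_rect hx
      (h2.clm_apply (hasFDerivWithinAt_const ((1 : ℝ), (0 : ℝ)) (x, t) (rect T)))
    have h4 := h3.congr_of_mem (f₁ := fun s => dx w x s)
      (fun s hs => hw.dx_eq (n := n + 1) hx hs) ht
    have h5 := h4.derivWithin (uniqueDiffOn_Icc hT t ht)
    refine Eq.trans h5 ?_
    simp
  have e2 : dx (dt T w) x t
      = fderivWithin ℝ (fderivWithin ℝ W (rect T)) (rect T) (x, t) (1, 0) (0, 1) := by
    have h3 := hasDerivWithinAt_fst_of_rect ht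
      (h2.clm_apply (hasFDerivWithinAt_const ((0 : ℝ), (1 : ℝ)) (x, t) (rect T)))
    have h4 := h3.congr_of_mem (f₁ := fun s => dt T w s t)
      (fun s hs => hw.dt_eq (n := n + 1) hT hs ht) hx
    have h5 := h4.derivWithin (uniqueDiffOn_Icc one_pos x hx)
    refine Eq.trans h5 ?_
    simp
  rw [e1, e2]
  have hint : (x, t) ∈ closure (interior (rect T)) := by
    rw [rect, interior_prod_eq, interior_Icc, interior_Icc, closure_prod_eq,
      closure_Ioo one_ne_zero.symm, closure_Ioo hT.ne]
    exact hp
  have hsm : ContDiffWithinAt ℝ (n + 2 : ℕ) W (rect T) (x, t) := hw (x, t) hp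
  refine hsm.isSymmSndFDerivWithinAt ?_ (uniqueDiffOn_rect hT) hint hp (0, 1) (1, 0)
  simp [minSmoothness_of_isRCLikeNormedField]

end

end

section

open Finset

/-! ### Taylor expansion in time of the interpolated solution -/

theorem abs_taylor_two_le {s : Set ℝ} (hs : Convex ℝ s) {f f' f'' f''' : ℝ → ℝ} {K : ℝ}
    (hf : ∀ x ∈ s, HasDerivWithinAt f (f' x) s x)
    (hf' : ∀ x ∈ s, HasDerivWithinAt f' (f'' x) s x)
    (hf'' : ∀ x ∈ s, HasDerivWithinAt f'' (f''' x) s x) (hK : ∀ x ∈ s, |f''' x| ≤ K) {x y : ℝ}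
    (hx : x ∈ s) (hy : y ∈ s) :
    |f y - f x - f' x * (y - x) - f'' x / 2 * (y - x) ^ 2| ≤ K * |y - x| ^ 3 := by
  have hK0 : 0 ≤ K := (abs_nonneg _).trans (hK x hx)
  have hsub : Set.uIcc x y ⊆ s := hs.ordConnected.uIcc_subset hx hy
  have h := abs_sub_le_of_deriv_bound (s := Set.uIcc x y) (convex_uIcc x y)
    (f := fun z => f z - f' x * z - f'' x / 2 * (z - x) ^ 2)
    (f' := fun z => f' z - f' x - f'' x * (z - x)) (K := K * (y - x) ^ 2)
    (fun z hz => by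
      have e1 := (hf z (hsub hz)).mono hsub
      have e2 := (hasDerivWithinAt_id z (Set.uIcc x y)).const_mul (f' x)
      have e3 := (((hasDerivWithinAt_id z (Set.uIcc x y)).sub_const x).pow 2).const_mul (f'' x / 2)
      refine ((e1.sub e2).sub e3).congr_deriv ?_
      simp
      ring)
    (fun z hz => (abs_taylor_one_le hs hf' hf'' hK hx (hsub hz)).trans
      (mul_le_mul_of_nonneg_left (sq_le_sq.2 (Set.abs_sub_left_of_mem_uIcc hz)) hK0))
    Set.left_mem_uIcc Set.right_mem_uIcc
  calc |f y - f x - f' x * (y - x) - f'' x / 2 * (y - x) ^ 2|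
      = |f y - f' x * y - f'' x / 2 * (y - x) ^ 2
          - (f x - f' x * x - f'' x / 2 * (x - x) ^ 2)| := by ring_nf
    _ ≤ K * (y - x) ^ 2 * |y - x| := h
    _ = K * |y - x| ^ 3 := by rw [← sq_abs (y - x)]; ring

theorem abs_midpoint_le {s : Set ℝ} (hs : Convex ℝ s) {f f' f'' f''' : ℝ → ℝ} {K : ℝ}
    (hf : ∀ x ∈ s, HasDerivWithinAt f (f' x) s x)
    (hf' : ∀ x ∈ s, HasDerivWithinAt f' (f'' x) s x)
    (hf'' : ∀ x ∈ s, HasDerivWithinAt f'' (f''' x) s x) (hK : ∀ x ∈ s, |f''' x| ≤ K) {t τ : ℝ}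
    (hτ : 0 ≤ τ) (h0 : t ∈ s) (h1 : t + τ ∈ s) (h2 : t + 2 * τ ∈ s) :
    |f (t + 2 * τ) - f t - 2 * τ * f' (t + τ)| ≤ 2 * K * τ ^ 3 := by
  have t1 := abs_taylor_two_le hs hf hf' hf'' hK h1 h2
  have t2 := abs_taylor_two_le hs hf hf' hf'' hK h1 h0
  rw [show t + 2 * τ - (t + τ) = τ by ring, abs_of_nonneg hτ] at t1
  rw [show t - (t + τ) = -τ by ring, abs_neg, abs_of_nonneg hτ] at t2
  have e : f (t + 2 * τ) - f t - 2 * τ * f' (t + τ)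
      = (f (t + 2 * τ) - f (t + τ) - f' (t + τ) * τ - f'' (t + τ) / 2 * τ ^ 2)
        - (f t - f (t + τ) - f' (t + τ) * (-τ) - f'' (t + τ) / 2 * (-τ) ^ 2) := by ring
  rw [e]
  refine (abs_sub _ _).trans ?_
  linarith

theorem C2Bound.mono_const {s : Set ℝ} {K K' : ℝ} {f f' f'' : ℝ → ℝ} (h : C2Bound s K f f' f'')
    (hK : K ≤ K') : C2Bound s K' f f' f'' :=
  ⟨h.deriv1, h.deriv2, fun x hx => (h.le0 x hx).trans hK, fun x hx => (h.le1 x hx).trans hK,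
    fun x hx => (h.le2 x hx).trans hK⟩

theorem SmoothRect.exists_c2Bound {T : ℝ} (hT : 0 < T) {w : ℝ → ℝ → ℝ} (hw : SmoothRect T 2 w) :
    ∃ K, ∀ t ∈ Set.Icc 0 T, C2Bound (Set.Icc 0 1) K (fun x => w x t) (fun x => dx w x t)
      (fun x => dx (dx w) x t) := by
  have h1 : SmoothRect T 1 (dx w) := SmoothRect.smooth_dx (n := 1) hT hw
  have h2 : SmoothRect T 0 (dx (dx w)) := SmoothRect.smooth_dx (n := 0) hT h1
  obtain ⟨K0, hK0⟩ := hw.exists_bound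
  obtain ⟨K1, hK1⟩ := h1.exists_bound
  obtain ⟨K2, hK2⟩ := h2.exists_bound
  refine ⟨max K0 (max K1 K2), fun t ht =>
    ⟨fun x hx => SmoothRect.hasDerivWithinAt_x (n := 1) hw hx ht,
    fun x hx => SmoothRect.hasDerivWithinAt_x (n := 0) h1 hx ht, fun x hx => ?_, fun x hx => ?_,
    fun x hx => ?_⟩⟩
  · exact (hK0 x hx t ht).trans (le_max_left _ _)
  · exact (hK1 x hx t ht).trans ((le_max_left _ _).trans (le_max_right _ _))
  · exact (hK2 x hx t ht).trans ((le_max_right _ _).trans (le_max_right _ _))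

/-- The first three time derivatives of `w` exist, they may be interchanged with one space
derivative, and all of them are bounded by `K` together with two space derivatives. -/
structure TimeRegular (T K : ℝ) (w : ℝ → ℝ → ℝ) : Prop where
  bound : ∀ i ≤ 3, ∀ t ∈ Set.Icc 0 T, C2Bound (Set.Icc 0 1) K (fun x => (dt T)^[i] w x t)
    (fun x => dx ((dt T)^[i] w) x t) (fun x => dx (dx ((dt T)^[i] w)) x t)
  deriv_t : ∀ i < 3, ∀ x ∈ Set.Icc (0 : ℝ) 1, ∀ t ∈ Set.Icc 0 T,
    HasDerivWithinAt (fun s => (dt T)^[i] w x s) ((dt T)^[i + 1] w x t) (Set.Icc 0 T) t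
  deriv_xt : ∀ i < 3, ∀ x ∈ Set.Icc (0 : ℝ) 1, ∀ t ∈ Set.Icc 0 T,
    HasDerivWithinAt (fun s => dx ((dt T)^[i] w) x s) (dx ((dt T)^[i + 1] w) x t) (Set.Icc 0 T) t

theorem SmoothRect.iterate_dt {T : ℝ} (hT : 0 < T) {w : ℝ → ℝ → ℝ} {n : ℕ} (i : ℕ)
    (hw : SmoothRect T (n + i) w) : SmoothRect T n ((dt T)^[i] w) := by
  induction i generalizing n with
  | zero => exact hw
  | succ i ih =>
    rw [Function.iterate_succ_apply']
    refine SmoothRect.smooth_dt hT (ih ?_)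
    rwa [show n + 1 + i = n + (i + 1) by ring]

theorem SmoothRect.exists_timeRegular {T : ℝ} (hT : 0 < T) {w : ℝ → ℝ → ℝ}
    (hw : SmoothRect T 5 w) : ∃ K, TimeRegular T K w := by
  have h : ∀ i ≤ 3, SmoothRect T 2 ((dt T)^[i] w) := fun i hi =>
    SmoothRect.iterate_dt hT i (hw.of_le (by omega))
  have hb : ∀ i, ∃ K, i ≤ 3 → ∀ t ∈ Set.Icc 0 T, C2Bound (Set.Icc 0 1) K
      (fun x => (dt T)^[i] w x t) (fun x => dx ((dt T)^[i] w) x t)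
      (fun x => dx (dx ((dt T)^[i] w)) x t) := fun i => by
    by_cases hi : i ≤ 3
    · obtain ⟨K, hK⟩ := (h i hi).exists_c2Bound hT
      exact ⟨K, fun _ => hK⟩
    · exact ⟨0, fun h => absurd h hi⟩
  choose K hK using hb
  refine ⟨∑ i ∈ range 4, |K i|, fun i hi t ht => (hK i hi t ht).mono_const ?_,
    fun i hi x hx t ht => ?_, fun i hi x hx t ht => ?_⟩
  · exact (le_abs_self _).trans (single_le_sum (f := fun i => |K i|) (fun _ _ => abs_nonneg _)
      (mem_range.2 (by omega)))
  · rw [Function.iterate_succ_apply']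
    exact SmoothRect.hasDerivWithinAt_t (n := 1) hT (h i hi.le) hx ht
  · rw [Function.iterate_succ_apply', ← SmoothRect.dt_dx_comm (n := 0) hT (h i hi.le) hx ht]
    exact SmoothRect.hasDerivWithinAt_t (n := 0) hT
      (SmoothRect.smooth_dx (n := 1) hT (h i hi.le)) hx ht

theorem TimeRegular.mono {T K K' : ℝ} {w : ℝ → ℝ → ℝ} (h : TimeRegular T K w) (hK : K ≤ K') :
    TimeRegular T K' w :=
  ⟨fun i hi t ht => (h.bound i hi t ht).mono_const hK, h.deriv_t, h.deriv_xt⟩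

/-- `d` and its derivative are bounded by `C` on `[0, 1]`. -/
def C1Bound (C : ℝ) (d : ℝ → ℝ) : Prop :=
  ∃ d' : ℝ → ℝ, (∀ x ∈ Set.Icc (0 : ℝ) 1, HasDerivWithinAt d (d' x) (Set.Icc 0 1) x) ∧
    ∀ x ∈ Set.Icc (0 : ℝ) 1, |d x| ≤ C ∧ |d' x| ≤ C

section TimeRegular

variable {T K : ℝ} {w : ℝ → ℝ → ℝ} {t τ : ℝ}

theorem TimeRegular.c1Bound (h : TimeRegular T K w) (ht : t ∈ Set.Icc 0 T) :
    C1Bound K (fun x => w x t) := by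
  have b0 := h.bound 0 (by norm_num)
  simp only [Function.iterate_zero, id] at b0
  exact ⟨_, (b0 t ht).deriv1, fun x hx => ⟨(b0 t ht).le0 x hx, (b0 t ht).le1 x hx⟩⟩

theorem TimeRegular.c1Bound_sub (h : TimeRegular T K w) (hτ : 0 ≤ τ) (ht : t ∈ Set.Icc 0 T)
    (ht' : t + τ ∈ Set.Icc 0 T) : C1Bound (K * τ) (fun x => w x t - w x (t + τ)) := by
  have b0 := h.bound 0 (by norm_num)
  have b1 := h.bound 1 (by norm_num)
  have d0 := h.deriv_t 0 (by norm_num)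
  have dx0 := h.deriv_xt 0 (by norm_num)
  simp only [zero_add, Function.iterate_zero, id, Function.iterate_one] at b0 b1 d0 dx0
  refine ⟨fun x => dx w x t - dx w x (t + τ), fun x hx => ((b0 t ht).deriv1 x hx).sub
    ((b0 _ ht').deriv1 x hx), fun x hx => ⟨?_, ?_⟩⟩
  · have := abs_sub_le_of_deriv_bound (convex_Icc 0 T) (d0 x hx) (fun s hs => (b1 s hs).le0 x hx)
      ht' ht
    rwa [show t - (t + τ) = -τ by ring, abs_neg, abs_of_nonneg hτ] at this
  · have := abs_sub_le_of_deriv_bound (convex_Icc 0 T) (dx0 x hx) (fun s hs => (b1 s hs).le1 x hx)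
      ht' ht
    rwa [show t - (t + τ) = -τ by ring, abs_neg, abs_of_nonneg hτ] at this

theorem TimeRegular.c1Bound_taylor (h : TimeRegular T K w) (ht : t ∈ Set.Icc 0 T)
    (ht' : t + τ ∈ Set.Icc 0 T) :
    C1Bound (K * τ ^ 2) (fun x => w x (t + τ) - w x t - τ * dt T w x t) := by
  have b0 := h.bound 0 (by norm_num)
  have b1 := h.bound 1 (by norm_num)
  have b2 := h.bound 2 (by norm_num)
  have d0 := h.deriv_t 0 (by norm_num)
  have dx0 := h.deriv_xt 0 (by norm_num)
  have d1 := h.deriv_t 1 (by norm_num)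
  have dx1 := h.deriv_xt 1 (by norm_num)
  simp only [zero_add, Function.iterate_zero, id, Function.iterate_one] at b0 b1 d0 dx0 d1 dx1
  refine ⟨fun x => dx w x (t + τ) - dx w x t - τ * dx (dt T w) x t,
    fun x hx => (((b0 _ ht').deriv1 x hx).sub ((b0 t ht).deriv1 x hx)).sub
      (((b1 t ht).deriv1 x hx).const_mul τ), fun x hx => ⟨?_, ?_⟩⟩
  · have := abs_taylor_one_le (convex_Icc 0 T) (d0 x hx) (d1 x hx)
      (fun s hs => (b2 s hs).le0 x hx) ht ht'
    rwa [show t + τ - t = τ by ring, mul_comm (dt T w x t)] at this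
  · have := abs_taylor_one_le (convex_Icc 0 T) (dx0 x hx) (dx1 x hx)
      (fun s hs => (b2 s hs).le1 x hx) ht ht'
    rwa [show t + τ - t = τ by ring, mul_comm (dx (dt T w) x t)] at this

theorem TimeRegular.c1Bound_midpoint (h : TimeRegular T K w) (hτ : 0 ≤ τ) (ht : t ∈ Set.Icc 0 T)
    (ht' : t + τ ∈ Set.Icc 0 T) (ht'' : t + 2 * τ ∈ Set.Icc 0 T) :
    C1Bound (2 * K * τ ^ 3) (fun x => w x (t + 2 * τ) - w x t - 2 * τ * dt T w x (t + τ)) := by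
  have b0 := h.bound 0 (by norm_num)
  have b1 := h.bound 1 (by norm_num)
  have b3 := h.bound 3 (by norm_num)
  have d0 := h.deriv_t 0 (by norm_num)
  have dx0 := h.deriv_xt 0 (by norm_num)
  have d1 := h.deriv_t 1 (by norm_num)
  have dx1 := h.deriv_xt 1 (by norm_num)
  have d2 := h.deriv_t 2 (by norm_num)
  have dx2 := h.deriv_xt 2 (by norm_num)
  simp only [zero_add, Function.iterate_zero, id, Function.iterate_one] at b0 b1 d0 dx0 d1 dx1
  refine ⟨fun x => dx w x (t + 2 * τ) - dx w x t - 2 * τ * dx (dt T w) x (t + τ),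
    fun x hx => (((b0 _ ht'').deriv1 x hx).sub ((b0 t ht).deriv1 x hx)).sub
      (((b1 _ ht').deriv1 x hx).const_mul (2 * τ)), fun x hx => ⟨?_, ?_⟩⟩
  · exact abs_midpoint_le (convex_Icc 0 T) (d0 x hx) (d1 x hx) (d2 x hx)
      (fun s hs => (b3 s hs).le0 x hx) hτ ht ht' ht''
  · exact abs_midpoint_le (convex_Icc 0 T) (dx0 x hx) (dx1 x hx) (dx2 x hx)
      (fun s hs => (b3 s hs).le1 x hx) hτ ht ht' ht''

end TimeRegular

/-! ### Nodal states of pairs of functions -/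

/-- The state of the nodal values of a pair of functions. -/
def stateOf (N : ℕ) (d e : ℝ → ℝ) : State N := State.mk N (nodal N d) (nodal N e)

section StateOf

variable {N : ℕ}

theorem stateOf_sub (d e d₁ e₁ : ℝ → ℝ) :
    stateOf N d e - stateOf N d₁ e₁ = stateOf N (fun x => d x - d₁ x) (fun x => e x - e₁ x) :=
  State.ext_nodal (fun j hj => by simp [stateOf, hj, nodal])
    (fun j h0 h1 => by simp [stateOf, h0, h1, nodal])

theorem smul_stateOf (c : ℝ) (d e : ℝ → ℝ) :
    c • stateOf N d e = stateOf N (fun x => c * d x) (fun x => c * e x) :=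
  State.ext_nodal (fun j hj => by simp [stateOf, hj, nodal])
    (fun j h0 h1 => by simp [stateOf, h0, h1, nodal])

theorem H_stateOf (d e : ℝ → ℝ) {j : ℕ} (hj : j ≤ N) : (stateOf N d e).H j = nodal N d j := by
  simp [stateOf, hj]

theorem U_stateOf (hN : 0 < N) (d : ℝ → ℝ) {e : ℝ → ℝ} (h0 : e 0 = 0) (h1 : e 1 = 0) {j : ℕ}
    (hj : j ≤ N) : (stateOf N d e).U j = nodal N e j := by
  have hN' : (N : ℝ) ≠ 0 := by exact_mod_cast hN.ne'
  rcases Nat.eq_zero_or_pos j with rfl | hj0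
  · simp [stateOf, nodal, h0]
  · rcases Nat.lt_or_ge j N with h | h
    · simp [stateOf, hj0, h]
    · obtain rfl : j = N := le_antisymm hj h
      simp [stateOf, nodal, h1, hN']

theorem lipBound_stateOf (hN : 0 < N) {C : ℝ} {d e : ℝ → ℝ} (hC : 0 ≤ C) (hd : C1Bound C d)
    (he : C1Bound C e) (h0 : e 0 = 0) (h1 : e 1 = 0) : (stateOf N d e).LipBound C := by
  obtain ⟨d', hd', hd⟩ := hd
  obtain ⟨e', he', he⟩ := he
  refine ⟨fun j => ?_, fun j => ?_, fun j hj => ?_, fun j hj => ?_⟩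
  · rcases Nat.lt_or_ge N j with h | h
    · rw [State.H_eq_zero _ h, abs_zero]; exact hC
    · rw [H_stateOf d e h]; exact (hd _ (node_mem_Icc h)).1
  · rcases Nat.lt_or_ge N j with h | h
    · rw [State.U_eq_zero _ h.le, abs_zero]; exact hC
    · rw [U_stateOf hN d h0 h1 h]; exact (he _ (node_mem_Icc h)).1
  · have := abs_fwd_nodal_le (N := N) (j := j) (K := C)
      (fun x hx => (hd' x (cell_subset hj hx)).mono (cell_subset hj))
      (fun x hx => (hd x (cell_subset hj hx)).2)
    rwa [fwd, H_stateOf d e hj.le, H_stateOf d e hj]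
  · have := abs_fwd_nodal_le (N := N) (j := j) (K := C)
      (fun x hx => (he' x (cell_subset hj hx)).mono (cell_subset hj))
      (fun x hx => (he x (cell_subset hj hx)).2)
    rwa [fwd, U_stateOf hN d h0 h1 hj.le, U_stateOf hN d h0 h1 hj]

theorem State.LipBound.norm_le [NeZero N] {x : State N} {C : ℝ} (h : x.LipBound C) :
    ‖x‖ ≤ 2 * C := by
  have hN : (0 : ℝ) < N := by exact_mod_cast Nat.pos_of_neZero N
  have hC : 0 ≤ C := (abs_nonneg _).trans (h.H_le 0)
  refine le_of_sq_le_sq ?_ (by positivity)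
  rw [State.norm_sq_eq, State.form]
  have hm : ∀ a : ℕ → ℝ, (∀ j, |a j| ≤ C) → ∀ j, mass a a j ≤ C ^ 2 := by
    intro a ha j
    have h1 : a j ^ 2 ≤ C ^ 2 := sq_le_sq' (abs_le.1 (ha j)).1 (abs_le.1 (ha j)).2
    have h2 : a (j + 1) ^ 2 ≤ C ^ 2 :=
      sq_le_sq' (abs_le.1 (ha (j + 1))).1 (abs_le.1 (ha (j + 1))).2
    unfold mass
    nlinarith [sq_nonneg (a j - a (j + 1))]
  calc _ ≤ ∑ j ∈ range N, (1 / (N : ℝ) * C ^ 2 + 1 / N * C ^ 2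
          + 1 / 3 * (N * ((C * (1 / N)) * (C * (1 / N))))) := by
        refine sum_le_sum fun j hj => ?_
        have h1 := hm _ h.H_le j
        have h2 := hm _ h.U_le j
        have h3 : fwd x.U j * fwd x.U j ≤ (C * (1 / N)) * (C * (1 / N)) := by
          rw [← abs_mul_abs_self]
          have := h.fwd_U_le j (mem_range.1 hj)
          gcongr
        gcongr
    _ = 7 / 3 * C ^ 2 := by
      rw [sum_const, card_range, nsmul_eq_mul]; field_simp; ring
    _ ≤ _ := by nlinarith [sq_nonneg C]

theorem norm_stateOf_le [NeZero N] {C : ℝ} {d e : ℝ → ℝ} (hC : 0 ≤ C) (hd : C1Bound C d)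
    (he : C1Bound C e) (h0 : e 0 = 0) (h1 : e 1 = 0) : ‖stateOf N d e‖ ≤ 2 * C :=
  (lipBound_stateOf (Nat.pos_of_neZero N) hC hd he h0 h1).norm_le

end StateOf

end

section

open Finset

/-! ### Consistency of the nodal interpolant of a solution -/

/-- The right-hand side of the semidiscrete problem. -/
def semiField (N : ℕ) [NeZero N] (sys : System) : State N → State N :=
  quadField (State.linOp N) (State.quadOp N sys.coeffEU sys.coeffUU sys.coeffEE)

theorem System.abs_coeffEU_le (sys : System) : |sys.coeffEU| ≤ 2 := by
  cases sys <;> norm_num [System.coeffEU, abs_le]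

theorem System.abs_coeffUU_le (sys : System) : |sys.coeffUU| ≤ 2 := by
  cases sys <;> norm_num [System.coeffUU, abs_le]

theorem System.abs_coeffEE_le (sys : System) : |sys.coeffEE| ≤ 2 := by
  cases sys <;> norm_num [System.coeffEE, abs_le]

/-- The curve `w`, with velocity `wt`, in the discrete state space is bounded and smooth in time
uniformly in the mesh, and solves the semidiscrete problem up to `O(h^{3/2})`. -/
structure ConsistentCurve (N : ℕ) [NeZero N] (sys : System) (T K : ℝ) (w wt : ℝ → State N) :
    Prop where
  residual : ∀ t ∈ Set.Icc 0 T, ‖wt t - semiField N sys (w t)‖ ≤ 100 * (K + K ^ 2) * √(1 / N) ^ 3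
  lipBound : ∀ t ∈ Set.Icc 0 T, (w t).LipBound K
  sub_le : ∀ t ∈ Set.Icc 0 T, ∀ τ, 0 ≤ τ → t + τ ∈ Set.Icc 0 T → ‖w t - w (t + τ)‖ ≤ 2 * (K * τ)
  taylor_le : ∀ t ∈ Set.Icc 0 T, ∀ τ, 0 ≤ τ → t + τ ∈ Set.Icc 0 T →
    ‖w (t + τ) - w t - τ • wt t‖ ≤ 2 * (K * τ ^ 2)
  midpoint_le : ∀ t ∈ Set.Icc 0 T, ∀ τ, 0 ≤ τ → t + 2 * τ ∈ Set.Icc 0 T →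
    ‖w (t + 2 * τ) - w t - (2 * τ) • wt (t + τ)‖ ≤ 2 * (2 * K * τ ^ 3)

theorem IsSolution.dt_u_boundary {sys : System} {r : ℕ} {T : ℝ} {η u : ℝ → ℝ → ℝ}
    (h : IsSolution sys r T η u) {t : ℝ} (ht : t ∈ Set.Icc 0 T) :
    dt T u 0 t = 0 ∧ dt T u 1 t = 0 := by
  constructor
  · rw [dt, derivWithin_congr (f := fun _ => 0) (fun s hs => h.bc_left s hs) (h.bc_left t ht)]
    simp
  · rw [dt, derivWithin_congr (f := fun _ => 0) (fun s hs => h.bc_right s hs) (h.bc_right t ht)]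
    simp

theorem IsSolution.dt_dx_dx_comm {sys : System} {T : ℝ} (hT : 0 < T) {η u : ℝ → ℝ → ℝ}
    (h : IsSolution sys 5 T η u) {x t : ℝ} (hx : x ∈ Set.Icc (0 : ℝ) 1) (ht : t ∈ Set.Icc 0 T) :
    dt T (dx (dx u)) x t = dx (dx (dt T u)) x t := by
  have hu : SmoothRect T 5 u := h.smooth_u
  have hu1 : SmoothRect T 4 (dx u) := SmoothRect.smooth_dx (n := 4) hT hu
  rw [SmoothRect.dt_dx_comm (n := 2) hT hu1 hx ht]
  exact derivWithin_congr (fun y hy => SmoothRect.dt_dx_comm (n := 3) hT hu hy ht)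
    (SmoothRect.dt_dx_comm (n := 3) hT hu hx ht)

/-- The nodal values of a solution form a consistent curve, with a constant that does not depend on
the mesh. Order of smoothness five is what three time derivatives together with two space
derivatives require. -/
theorem IsSolution.exists_consistentCurve {sys : System} {T : ℝ} (hT : 0 < T) {η u : ℝ → ℝ → ℝ}
    (h : IsSolution sys 5 T η u) :
    ∃ K, 0 ≤ K ∧ TimeRegular T K η ∧ TimeRegular T K u ∧ ∀ (N : ℕ) [NeZero N],
      ConsistentCurve N sys T K (fun t => stateOf N (fun x => η x t) (fun x => u x t))
        (fun t => stateOf N (fun x => dt T η x t) (fun x => dt T u x t)) := by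
  have hη : SmoothRect T 5 η := h.smooth_eta
  have hu : SmoothRect T 5 u := h.smooth_u
  obtain ⟨K₁, hK₁⟩ := hη.exists_timeRegular hT
  obtain ⟨K₂, hK₂⟩ := hu.exists_timeRegular hT
  have hηu : SmoothRect T 5 (fun x t => η x t * u x t) := ContDiffOn.mul hη hu
  have hf : SmoothRect T 5 (fun x t => η x t + sys.coeffUU / 2 * u x t ^ 2
      + sys.coeffEE / 2 * η x t ^ 2) :=
    (ContDiffOn.add hη (contDiffOn_const.mul (ContDiffOn.pow hu 2))).add
      (contDiffOn_const.mul (ContDiffOn.pow hη 2))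
  obtain ⟨K₃, hK₃⟩ := (hf.of_le (m := 2) (by norm_num)).exists_c2Bound hT
  obtain ⟨K, hK⟩ : ∃ K, K = max (max K₁ K₂) K₃ := ⟨_, rfl⟩
  have k1 : K₁ ≤ K := hK ▸ (le_max_left _ _).trans (le_max_left _ _)
  have k2 : K₂ ≤ K := hK ▸ (le_max_right _ _).trans (le_max_left _ _)
  have k3 : K₃ ≤ K := hK ▸ le_max_right _ _
  have rη := hK₁.mono k1
  have ru := hK₂.mono k2
  have h0T : (0 : ℝ) ∈ Set.Icc 0 T := ⟨le_rfl, hT.le⟩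
  have hK0 : 0 ≤ K := (abs_nonneg _).trans ((rη.bound 0 (by norm_num) 0 h0T).le0 0 (by simp))
  have bη0 := rη.bound 0 (by norm_num)
  have bη1 := rη.bound 1 (by norm_num)
  have bu0 := ru.bound 0 (by norm_num)
  have bu1 := ru.bound 1 (by norm_num)
  simp only [Function.iterate_zero, id, Function.iterate_one] at bη0 bη1 bu0 bu1
  refine ⟨K, hK0, rη, ru, fun N _ => ⟨fun t ht => ?_, fun t ht => ?_, fun t ht τ hτ ht' => ?_,
    fun t ht τ hτ ht' => ?_, fun t ht τ hτ ht' => ?_⟩⟩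
  · refine norm_residual_le sys.abs_coeffEU_le sys.abs_coeffUU_le sys.abs_coeffEE_le (bη0 t ht)
      (bu0 t ht) (bη1 t ht) (bu1 t ht) ((hK₃ t ht).mono_const k3) (fun x hx => ?_) (fun x hx => ?_)
      (h.bc_left t ht) (h.bc_right t ht) (h.dt_u_boundary ht).1 (h.dt_u_boundary ht).2
    · refine (((bu0 t ht).deriv1 x hx).add ((SmoothRect.hasDerivWithinAt_x (n := 4) hηu hx
        ht).const_mul sys.coeffEU)).congr_deriv ?_
      linarith [h.eq_eta x hx t ht]
    · have e1 := (bη0 t ht).deriv1 x hx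
      have e2 := (bu0 t ht).deriv1 x hx
      have e3 := (bu1 t ht).deriv2 x hx
      refine (((e1.add ((e2.pow 2).const_mul (sys.coeffUU / 2))).add
        ((e1.pow 2).const_mul (sys.coeffEE / 2))).sub (e3.const_mul (1 / 3))).congr_deriv ?_
      have e4 := h.eq_u x hx t ht
      rw [h.dt_dx_dx_comm hT hx ht] at e4
      simp only [Nat.cast_ofNat, Nat.add_one_sub_one, pow_one]
      linarith
  · exact lipBound_stateOf (Nat.pos_of_neZero N) hK0 (rη.c1Bound ht) (ru.c1Bound ht)
      (h.bc_left t ht) (h.bc_right t ht)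
  · simp only [stateOf_sub]
    exact norm_stateOf_le (by positivity) (rη.c1Bound_sub hτ ht ht') (ru.c1Bound_sub hτ ht ht')
      (by rw [h.bc_left t ht, h.bc_left _ ht', sub_zero])
      (by rw [h.bc_right t ht, h.bc_right _ ht', sub_zero])
  · simp only [stateOf_sub, smul_stateOf]
    exact norm_stateOf_le (by positivity) (rη.c1Bound_taylor ht ht') (ru.c1Bound_taylor ht ht')
      (by rw [h.bc_left t ht, h.bc_left _ ht', (h.dt_u_boundary ht).1]; ring)
      (by rw [h.bc_right t ht, h.bc_right _ ht', (h.dt_u_boundary ht).2]; ring)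
  · have hm : t + τ ∈ Set.Icc 0 T := ⟨by linarith [ht.1], by linarith [ht'.2]⟩
    simp only [stateOf_sub, smul_stateOf]
    exact norm_stateOf_le (by positivity) (rη.c1Bound_midpoint hτ ht hm ht')
      (ru.c1Bound_midpoint hτ ht hm ht')
      (by rw [h.bc_left t ht, h.bc_left _ ht', (h.dt_u_boundary hm).1]; ring)
      (by rw [h.bc_right t ht, h.bc_right _ ht', (h.dt_u_boundary hm).2]; ring)

/-! ### Convergence in the discrete state space -/

/-- The fully discrete solution in nodal coordinates. -/
def eulerSeq {N : ℕ} [NeZero N] (sys : System) (k : ℝ) (x₀ : State N) : ℕ → State N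
  | 0 => x₀
  | n + 1 => eulerSeq sys k x₀ n + k • semiField N sys
      (eulerSeq sys k x₀ n + (k / 2) • semiField N sys (eulerSeq sys k x₀ n))

set_option maxHeartbeats 1000000 in
/-- Convergence of order `h^{3/2}` on sufficiently fine meshes, when `k³ ≤ m³ h⁴`. Under this
condition `k² ≤ m² h^{8/3}`, so the time discretization error is absorbed. On a mesh with
`D h^{3/2} ≤ h` the error bound keeps the error below the threshold `h` of the error recursion. -/
theorem exists_norm_eulerSeq_sub_le {T K m : ℝ} (hT : 0 < T) (hK : 0 ≤ K) (hm : 0 ≤ m) :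
    ∃ D h₁ : ℝ, 0 ≤ D ∧ 0 < h₁ ∧ ∀ (N M : ℕ) [NeZero N], 0 < M → 1 / (N : ℝ) ≤ h₁ →
      (T / M) ^ 3 ≤ m ^ 3 * (1 / (N : ℝ)) ^ 4 →
      ∀ (sys : System) (w wt : ℝ → State N), ConsistentCurve N sys T K w wt →
        ∀ n ≤ M, ‖eulerSeq sys (T / M) (w 0) n - w (n * (T / M))‖ ≤ D * √(1 / N) ^ 3 := by
  obtain ⟨c, hc⟩ : ∃ c, c = 2000 + 2000 * K := ⟨_, rfl⟩
  have hc0 : 0 ≤ c := by rw [hc]; positivity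
  obtain ⟨G, hG, hstep⟩ := exists_midpoint_error_step c m hc0 hm
  obtain ⟨E, hE⟩ : ∃ E, E = 100 * (K + K ^ 2) + 2 * K * m ^ 2 := ⟨_, rfl⟩
  have hE0 : 0 ≤ E := by rw [hE]; positivity
  obtain ⟨D, hD⟩ : ∃ D, D = Real.exp (G * T) * E := ⟨_, rfl⟩
  have hED : E ≤ D := by
    rw [hD]
    exact le_mul_of_one_le_left hE0 (Real.one_le_exp (by positivity))
  have hD0 : 0 ≤ D := hE0.trans hED
  refine ⟨D, (1 / (D + 1)) ^ 2, hD0, by positivity, ?_⟩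
  intro N M _ hM hh₁ hk3 sys w wt hw
  have hN : 0 < N := Nat.pos_of_neZero N
  have hN' : (1 : ℝ) ≤ N := by exact_mod_cast hN
  have hM' : (0 : ℝ) < M := by exact_mod_cast hM
  obtain ⟨k, hk⟩ : ∃ k, k = T / M := ⟨_, rfl⟩
  have hk0 : 0 < k := by rw [hk]; positivity
  have hMk : M * k = T := by rw [hk]; field_simp
  -- `h = s ^ 2`, which turns all powers of `h` into integral ones
  obtain ⟨s, hs⟩ : ∃ s, s = √(1 / (N : ℝ)) := ⟨_, rfl⟩
  have hs0 : 0 < s := hs ▸ Real.sqrt_pos.2 (by positivity)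
  have hs2 : 1 / (N : ℝ) = s ^ 2 := by rw [hs, Real.sq_sqrt (by positivity)]
  have hNs : (N : ℝ) = 1 / s ^ 2 := by rw [← hs2]; field_simp
  have hs1 : s ≤ 1 := by
    rw [hs]; exact Real.sqrt_le_one.2 (div_le_one_of_le₀ hN' (by positivity))
  rw [← hk, hs2] at hk3
  rw [hs2] at hh₁
  rw [← hk, ← hs]
  have hDs : D * s ≤ 1 := by
    have h1 : s ≤ 1 / (D + 1) := le_of_sq_le_sq hh₁ (by positivity)
    calc D * s ≤ (D + 1) * (1 / (D + 1)) := by gcongr; linarith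
      _ = 1 := by field_simp
  -- consequences of the mesh condition
  have hks : k ≤ m * s ^ 2 := by
    refine le_of_pow_le_pow_left₀ (n := 3) (by norm_num) (by positivity) (hk3.trans ?_)
    calc m ^ 3 * (s ^ 2) ^ 4 = m ^ 3 * (s ^ 6 * s ^ 2) := by ring
      _ ≤ m ^ 3 * (s ^ 6 * 1) := by gcongr; exact pow_le_one₀ hs0.le hs1
      _ = _ := by ring
  have hk2 : k ^ 2 ≤ m ^ 2 * s ^ 5 := by
    refine le_of_pow_le_pow_left₀ (n := 3) (by norm_num) (by positivity) ?_
    calc (k ^ 2) ^ 3 = (k ^ 3) ^ 2 := by ring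
      _ ≤ (m ^ 3 * (s ^ 2) ^ 4) ^ 2 := by gcongr
      _ = m ^ 6 * (s ^ 15 * s) := by ring
      _ ≤ m ^ 6 * (s ^ 15 * 1) := by gcongr
      _ = _ := by ring
  obtain ⟨ε, hε⟩ : ∃ ε, ε = E * s ^ 3 := ⟨_, rfl⟩
  have hε0 : 0 ≤ ε := by rw [hε]; positivity
  have hs32 : s ^ 3 ≤ s := by
    calc s ^ 3 = s * s ^ 2 := by ring
      _ ≤ s * 1 := by gcongr; exact pow_le_one₀ hs0.le hs1
      _ = s := mul_one s
  have hε1 : ε ≤ 1 := by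
    calc ε ≤ D * s := by rw [hε]; gcongr
      _ ≤ 1 := hDs
  have hfin : Real.exp (G * (M * k)) * ε = D * s ^ 3 := by rw [hMk, hε, hD]; ring
  have hDh : Real.exp (G * (M * k)) * ε ≤ s ^ 2 := by
    rw [hfin]
    calc D * s ^ 3 = (D * s) * s ^ 2 := by ring
      _ ≤ 1 * s ^ 2 := by gcongr
      _ = s ^ 2 := one_mul _
  intro n hn
  rw [← hfin]
  refine le_exp_mul_of_conditional_recursion (a := fun n => ‖eulerSeq sys k (w 0) n - w (n * k)‖)
    (b := s ^ 2) hG hk0.le hε0 (by simp [eulerSeq]) (fun n hn hb => ?_) hDh n hn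
  have hn1 : (n : ℝ) + 1 ≤ M := by exact_mod_cast hn
  have t0 : (n : ℝ) * k ∈ Set.Icc 0 T := ⟨by positivity, by nlinarith⟩
  have t1 : (n : ℝ) * k + k / 2 ∈ Set.Icc 0 T := ⟨by positivity, by nlinarith⟩
  have t2 : (n : ℝ) * k + 2 * (k / 2) ∈ Set.Icc 0 T := ⟨by positivity, by nlinarith⟩
  have e2 : (n : ℝ) * k + 2 * (k / 2) = ((n + 1 : ℕ) : ℝ) * k := by push_cast; ring
  have hα := sys.abs_coeffEU_le
  have hβ := sys.abs_coeffUU_le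
  have hγ := sys.abs_coeffEE_le
  have hlip := hw.lipBound _ t1
  -- defect of the midpoint rule along the exact curve
  set δ : State N := semiField N sys (w (n * k + k / 2))
    - (1 / k) • (w (n * k + 2 * (k / 2)) - w (n * k)) with hδ
  refine hstep (State N) (State.linOp N) (State.quadOp N sys.coeffEU sys.coeffUU sys.coeffEE)
    (s ^ 2) k ε (eulerSeq sys k (w 0) n) _ _ (w (n * k)) (w (n * k + k / 2))
    (w ((n + 1 : ℕ) * k)) (wt (n * k)) (wt (n * k) - semiField N sys (w (n * k))) δ
    (w (n * k + k / 2) - w (n * k) - (k / 2) • wt (n * k))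
    (by positivity) (pow_le_one₀ hs0.le hs1) hk0.le hks hk3 hε0 hε1 (fun x y => ?_) (fun x => ?_)
    (fun x y => ?_) rfl rfl ?_ ?_ ?_ ?_ ?_ ?_ ?_ hb
  · refine (State.norm_quadOp_le hα hβ hγ x y).trans ?_
    rw [hNs]
    calc 1000 * (1 / s ^ 2) * ‖x‖ * ‖y‖ = 1000 / s ^ 2 * ‖x‖ * ‖y‖ := by ring
      _ ≤ c / s ^ 2 * ‖x‖ * ‖y‖ := by gcongr; rw [hc]; linarith
  · refine (State.norm_linearizedField_le hα hβ hγ hlip x).trans ?_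
    rw [hNs]
    calc (60 + 600 * K) * (1 / s ^ 2) * ‖x‖ = (60 + 600 * K) / s ^ 2 * ‖x‖ := by ring
      _ ≤ c / s ^ 2 * ‖x‖ := by gcongr; rw [hc]; linarith
  · refine (State.abs_linearizedField_symm_le hα hβ hγ hlip x y).trans ?_
    gcongr
    rw [hc]; linarith
  · rw [semiField]; abel
  · refine (hw.residual _ t0).trans ?_
    rw [← hs, hε, hE]
    gcongr
    have : 0 ≤ 2 * K * m ^ 2 := by positivity
    linarith
  · module
  · refine (hw.taylor_le _ t0 (k / 2) (by positivity) t1).trans ?_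
    calc 2 * (K * (k / 2) ^ 2) = 1 / 2 * K * k ^ 2 := by ring
      _ ≤ 1 / 2 * K * (m ^ 2 * s ^ 5) := by gcongr
      _ = s ^ 2 * (1 / 2 * K * m ^ 2 * s ^ 3) := by ring
      _ ≤ s ^ 2 * (E * s ^ 3) := by
        gcongr
        rw [hE]
        have : 0 ≤ K * m ^ 2 := by positivity
        have : 0 ≤ 100 * (K + K ^ 2) := by positivity
        linarith
      _ = _ := by rw [hε]
  · refine (hw.sub_le _ t0 (k / 2) (by positivity) t1).trans ?_
    calc 2 * (K * (k / 2)) = K * k := by ring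
      _ ≤ c * k := by gcongr; rw [hc]; linarith
  · rw [hδ, ← e2, smul_sub, smul_smul, mul_one_div_cancel hk0.ne', one_smul, semiField]
    abel
  · have h1 := hw.residual _ t1
    have h2 := hw.midpoint_le _ t0 (k / 2) (by positivity) t2
    have h3 : δ = -(wt (n * k + k / 2) - semiField N sys (w (n * k + k / 2)))
        - (1 / k) • (w (n * k + 2 * (k / 2)) - w (n * k) - (2 * (k / 2)) • wt (n * k + k / 2)) := by
      rw [hδ, show 2 * (k / 2) = k by ring, smul_sub (1 / k) _ (k • _), smul_smul,
        one_div_mul_cancel hk0.ne', one_smul]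
      abel
    rw [h3]
    refine (norm_sub_le _ _).trans ?_
    rw [norm_neg, norm_smul, Real.norm_of_nonneg (by positivity)]
    calc _ ≤ 100 * (K + K ^ 2) * √(1 / N) ^ 3 + 1 / k * (2 * (2 * K * (k / 2) ^ 3)) := by gcongr
      _ = 100 * (K + K ^ 2) * s ^ 3 + 1 / 2 * K * k ^ 2 := by rw [← hs]; field_simp
      _ ≤ 100 * (K + K ^ 2) * s ^ 3 + 1 / 2 * K * (m ^ 2 * s ^ 5) := by gcongr
      _ = (100 * (K + K ^ 2) + 1 / 2 * K * m ^ 2 * s ^ 2) * s ^ 3 := by ring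
      _ ≤ (100 * (K + K ^ 2) + 1 / 2 * K * m ^ 2 * 1) * s ^ 3 := by
        gcongr; exact pow_le_one₀ hs0.le hs1
      _ ≤ E * s ^ 3 := by
        gcongr
        rw [hE]
        have : 0 ≤ K * m ^ 2 := by positivity
        linarith
      _ = ε := hε.symm

end

section

open Finset

/-! ### From nodal errors to the error norms -/

theorem integral_le_sum_cells {N : ℕ} (hN : 0 < N) {F : ℝ → ℝ} (P : ℕ → ℝ → ℝ) (b : ℕ → ℝ)
    (hP : ∀ j < N, ContinuousOn (P j) (cell N j))
    (h : ∀ j < N, ∀ x ∈ Set.Ioo ((j : ℝ) / N) (((j : ℝ) + 1) / N), F x = P j x)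
    (hb : ∀ j < N, ∀ x ∈ cell N j, P j x ≤ b j) :
    ∫ x in (0 : ℝ)..1, F x ≤ ∑ j ∈ range N, 1 / N * b j := by
  rw [integral_eq_sum_cells hN P hP h]
  refine sum_le_sum fun j hj => ?_
  have hj' := mem_range.1 hj
  calc ∫ x in ((j : ℝ) / N)..(((j : ℝ) + 1) / N), P j x
      ≤ ∫ _ in ((j : ℝ) / N)..(((j : ℝ) + 1) / N), b j :=
        intervalIntegral.integral_mono_on (cell_le j)
          (ContinuousOn.intervalIntegrable_of_Icc (cell_le j) (hP j hj'))
          (Continuous.intervalIntegrable continuous_const _ _) (hb j hj')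
    _ = 1 / N * b j := by
      rw [intervalIntegral.integral_const, smul_eq_mul]; ring

/-- The error of a piecewise affine function is that of its nodal values, bounded by `b j` in the
`j`-th cell, and the interpolation error. -/
theorem ip_sub_self_le {N : ℕ} (hN : 0 < N) {K : ℝ} {f d d' d'' : ℝ → ℝ} (hf : f ∈ Sh N)
    (hd : C2Bound (Set.Icc 0 1) K d d' d'') {b : ℕ → ℝ}
    (hb : ∀ j < N, |nodal N f j - nodal N d j| + |nodal N f (j + 1) - nodal N d (j + 1)| ≤ b j) :
    ip (fun x => f x - d x) (fun x => f x - d x)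
      ≤ 2 * ∑ j ∈ range N, 1 / (N : ℝ) * b j ^ 2 + 8 * K ^ 2 * (1 / N) ^ 4 := by
  have hN' : (0 : ℝ) < N := by exact_mod_cast hN
  have hK : 0 ≤ K := (abs_nonneg _).trans (hd.le0 0 (by simp))
  have hcont : ContinuousOn (fun x => (f x - d x) * (f x - d x)) (Set.Icc 0 1) := by
    have := hf.1.sub (continuousOn_of_hasDerivWithinAt hd.deriv1)
    exact this.mul this
  refine (integral_le_sum_cells hN (fun _ x => (f x - d x) * (f x - d x))
    (fun j => 2 * b j ^ 2 + 8 * K ^ 2 * (1 / N) ^ 4) (fun j hj => hcont.mono (cell_subset hj))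
    (fun j hj x hx => rfl) (fun j hj x hx => ?_)).trans (le_of_eq ?_)
  · have hdc := hd.mono (cell_subset hj)
    obtain ⟨h0, h1⟩ := (mem_cell_iff hN).1 hx
    have e1 := abs_interp_sub_le hN hdc.deriv1 hdc.deriv2 hdc.le2 hx
    obtain ⟨σ, hσ⟩ : ∃ σ, σ = N * x - j := ⟨_, rfl⟩
    have e2 : f x - d x = ((1 - σ) * (nodal N f j - nodal N d j)
          + σ * (nodal N f (j + 1) - nodal N d (j + 1)))
        + (nodal N d j + fwd (nodal N d) j * (N * x - j) - d x) := by
      rw [Sh.eq_affine hf hj hx, ← hσ, fwd, fwd]; ring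
    have e3 : |(1 - σ) * (nodal N f j - nodal N d j)
          + σ * (nodal N f (j + 1) - nodal N d (j + 1))| ≤ b j := by
      refine ((abs_add_le _ _).trans (add_le_add ?_ ?_)).trans (hb j hj) <;> rw [abs_mul] <;>
        refine mul_le_of_le_one_left (abs_nonneg _) (abs_le.2 ⟨by linarith, by linarith⟩)
    have e4 : |f x - d x| ≤ b j + 2 * K * (1 / N) ^ 2 := by
      rw [e2]; exact (abs_add_le _ _).trans (add_le_add e3 e1)
    rw [← abs_mul_abs_self]
    calc |f x - d x| * |f x - d x|
        ≤ (b j + 2 * K * (1 / N) ^ 2) * (b j + 2 * K * (1 / N) ^ 2) :=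
          mul_le_mul e4 e4 (abs_nonneg _) ((abs_nonneg _).trans e4)
      _ ≤ 2 * b j ^ 2 + 8 * K ^ 2 * (1 / N) ^ 4 := by
        linarith [sq_nonneg (b j - 2 * K * (1 / N) ^ 2)]
  · simp only [mul_add, sum_add_distrib, sum_const, card_range, nsmul_eq_mul, mul_sum]
    congr 1
    · exact sum_congr rfl fun j _ => by ring
    · field_simp

theorem ip_deriv_sub_self_le {N : ℕ} (hN : 0 < N) {K : ℝ} {f d d' d'' : ℝ → ℝ} (hf : f ∈ Sh N)
    (hd : C2Bound (Set.Icc 0 1) K d d' d'') {b : ℕ → ℝ}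
    (hb : ∀ j < N, N * |fwd (nodal N f) j - fwd (nodal N d) j| ≤ b j) :
    ip (deriv fun x => f x - d x) (deriv fun x => f x - d x)
      ≤ 2 * ∑ j ∈ range N, 1 / (N : ℝ) * b j ^ 2 + 8 * K ^ 2 * (1 / N) ^ 2 := by
  have hN' : (0 : ℝ) < N := by exact_mod_cast hN
  have hK : 0 ≤ K := (abs_nonneg _).trans (hd.le0 0 (by simp))
  refine (integral_le_sum_cells hN
    (fun j x => (N * fwd (nodal N f) j - d' x) * (N * fwd (nodal N f) j - d' x))
    (fun j => 2 * b j ^ 2 + 8 * K ^ 2 * (1 / N) ^ 2) (fun j hj => ?_)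
    (fun j hj x hx => ?_) (fun j hj x hx => ?_)).trans (le_of_eq ?_)
  · have := (continuousOn_const (c := N * fwd (nodal N f) j)).sub
      ((continuousOn_of_hasDerivWithinAt hd.deriv2).mono (cell_subset hj))
    exact this.mul this
  · have hx' := Set.Ioo_subset_Icc_self hx
    have hdc := (hd.mono (cell_subset hj)).deriv1 x hx'
    simp only [((Sh.hasDerivAt hf hj hx).fun_sub
      (hdc.hasDerivAt (Icc_mem_nhds hx.1 hx.2))).deriv]
  · have hdc := hd.mono (cell_subset hj)
    obtain ⟨h0, h1⟩ := (mem_cell_iff hN).1 hx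
    have t1 := abs_taylor_one_le (convex_cell j) hdc.deriv1 hdc.deriv2 hdc.le2 hx
      (node_mem_cell j)
    have t2 := abs_taylor_one_le (convex_cell j) hdc.deriv1 hdc.deriv2 hdc.le2 hx
      (node_succ_mem_cell j)
    have s1 : ((j : ℝ) / N - x) ^ 2 ≤ (1 / N) ^ 2 := by
      refine sq_le_sq' ?_ ?_
      · have : x ≤ ((j : ℝ) + 1) / N := hx.2
        rw [add_div] at this
        linarith
      · have : (0 : ℝ) ≤ 1 / N := by positivity
        linarith [hx.1]
    have s2 : (((j + 1 : ℕ) : ℝ) / N - x) ^ 2 ≤ (1 / N) ^ 2 := by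
      push_cast
      rw [add_div]
      refine sq_le_sq' ?_ ?_
      · have : x ≤ ((j : ℝ) + 1) / N := hx.2
        rw [add_div] at this
        have : (0 : ℝ) ≤ 1 / N := by positivity
        linarith
      · linarith [hx.1]
    have e1 : N * fwd (nodal N f) j - d' x
        = N * (fwd (nodal N f) j - fwd (nodal N d) j)
          + N * ((d ((j + 1 : ℕ) / N) - d x - d' x * (((j + 1 : ℕ) : ℝ) / N - x))
            - (d (j / N) - d x - d' x * ((j : ℝ) / N - x))) := by
      simp only [fwd, nodal]
      push_cast
      field_simp
      ring
    have e2 : |N * fwd (nodal N f) j - d' x| ≤ b j + 2 * K * (1 / N) := by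
      rw [e1]
      refine (abs_add_le _ _).trans (add_le_add ?_ ?_)
      · rw [abs_mul, abs_of_pos hN']; exact hb j hj
      · rw [abs_mul, abs_of_pos hN']
        calc _ ≤ N * (K * (1 / N) ^ 2 + K * (1 / N) ^ 2) := by
              gcongr
              refine (abs_sub _ _).trans (add_le_add (t2.trans ?_) (t1.trans ?_)) <;> gcongr
          _ = _ := by field_simp; ring
    rw [← abs_mul_abs_self]
    calc |N * fwd (nodal N f) j - d' x| * |N * fwd (nodal N f) j - d' x|
        ≤ (b j + 2 * K * (1 / N)) * (b j + 2 * K * (1 / N)) :=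
          mul_le_mul e2 e2 (abs_nonneg _) ((abs_nonneg _).trans e2)
      _ ≤ 2 * b j ^ 2 + 8 * K ^ 2 * (1 / N) ^ 2 := by
        linarith [sq_nonneg (b j - 2 * K * (1 / N))]
  · simp only [mul_add, sum_add_distrib, sum_const, card_range, nsmul_eq_mul, mul_sum]
    congr 1
    · exact sum_congr rfl fun j _ => by ring
    · field_simp

section

variable {N : ℕ} [NeZero N] {K : ℝ} {f g d d' d'' e e' e'' : ℝ → ℝ} {x : State N}

theorem l2Norm_sub_le (hx : Represents N f g x) (hd : C2Bound (Set.Icc 0 1) K d d' d'') :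
    l2Norm (fun y => f y - d y) ≤ 8 * ‖x - stateOf N d e‖ + 3 * K * (1 / N) ^ 2 := by
  have hK : 0 ≤ K := (abs_nonneg _).trans (hd.le0 0 (by simp))
  have hN : 0 < N := Nat.pos_of_neZero N
  have h1 := ip_sub_self_le hN hx.mem_H hd (b := (x - stateOf N d e).cellSize) (fun j hj => by
    have := State.abs_H_add_le_cellSize (x - stateOf N d e) j
    rwa [State.H_sub, State.H_sub, ← hx.nodal_H j hj.le, ← hx.nodal_H _ hj, H_stateOf _ _ hj.le,
      H_stateOf _ _ hj] at this)
  have h2 := State.sum_cellSize_sq_le (x - stateOf N d e)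
  refine Real.sqrt_le_iff.2 ⟨by positivity, ?_⟩
  have h3 : 0 ≤ ‖x - stateOf N d e‖ * (K * (1 / N) ^ 2) := by positivity
  have h4 : 0 ≤ (K * (1 / N) ^ 2) ^ 2 := by positivity
  have h5 := sq_nonneg ‖x - stateOf N d e‖
  linarith

theorem h1Norm_sub_le (hx : Represents N f g x) (he : C2Bound (Set.Icc 0 1) K e e' e'')
    (h0 : e 0 = 0) (h1 : e 1 = 0) :
    h1Norm (fun y => g y - e y) ≤ 10 * ‖x - stateOf N d e‖ + 4 * K * (1 / N) := by
  have hK : 0 ≤ K := (abs_nonneg _).trans (he.le0 0 (by simp))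
  have hN : 0 < N := Nat.pos_of_neZero N
  have hN1 : (1 : ℝ) ≤ N := by exact_mod_cast hN
  have hU : ∀ j ≤ N, (x - stateOf N d e).U j = nodal N g j - nodal N e j := fun j hj => by
    rw [State.U_sub, ← hx.nodal_U j hj, U_stateOf hN d h0 h1 hj]
  have e1 := ip_sub_self_le hN hx.mem_U.1 he (b := (x - stateOf N d e).cellSize) (fun j hj => by
    have := State.abs_U_add_le_cellSize (x - stateOf N d e) j
    rwa [hU j hj.le, hU _ hj] at this)
  have e2 := ip_deriv_sub_self_le hN hx.mem_U.1 he (b := (x - stateOf N d e).cellSize)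
    (fun j hj => by
      have := State.abs_fwd_U_le_cellSize (x - stateOf N d e) j
      rw [fwd, hU j hj.le, hU _ hj] at this
      rw [fwd, fwd, sub_sub_sub_comm]
      calc _ ≤ N * (1 / N * (x - stateOf N d e).cellSize j) := by gcongr
        _ = _ := by field_simp)
  have e3 := State.sum_cellSize_sq_le (x - stateOf N d e)
  refine Real.sqrt_le_iff.2 ⟨by positivity, ?_⟩
  rw [aForm]
  have h3 : 0 ≤ ‖x - stateOf N d e‖ * (K * (1 / N)) := by positivity
  have h4 : 0 ≤ (K * (1 / N)) ^ 2 := by positivity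
  have h5 := sq_nonneg ‖x - stateOf N d e‖
  have h6 : 8 * K ^ 2 * (1 / (N : ℝ)) ^ 4 ≤ 8 * K ^ 2 * (1 / N) ^ 2 := by
    gcongr 8 * K ^ 2 * ?_
    exact pow_le_pow_of_le_one (by positivity) (div_le_one_of_le₀ hN1 (by positivity)) (by norm_num)
  linarith

end

/-! ### Existence and uniqueness of the fully discrete solution -/

section Scheme

variable {N : ℕ} [NeZero N] {sys : System} {M : ℕ} {k : ℝ} {η₀ u₀ : ℝ → ℝ}

/-- Every solution of the scheme has the nodal values computed by `eulerSeq`. -/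
theorem IsImprovedEuler.represents {H U Hs Us : ℕ → ℝ → ℝ}
    (h : IsImprovedEuler sys N M k η₀ u₀ H U Hs Us) :
    ∀ n ≤ M, Represents N (H n) (U n) (eulerSeq sys k (stateOf N η₀ u₀) n) := by
  have hN : 0 < N := Nat.pos_of_neZero N
  intro n
  induction n with
  | zero =>
    intro hn
    refine ⟨h.mem_H 0 hn, h.mem_U 0 hn, fun j hj => ?_, fun j hj => ?_⟩
    · rw [nodal, h.init_H (node_mem_Icc hj), interp_eq_plFun]
      exact (nodal_plFun hN _ hj).trans (H_stateOf _ _ hj).symm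
    · rw [nodal, h.init_U (node_mem_Icc hj), interp0_eq_plFun]
      exact nodal_plFun hN _ hj
  | succ n ih =>
    intro hn
    have hx := ih (by omega)
    have hst := h.stage n hn
    have hsp := h.step n hn
    have hy := represents_mk hN hst.mem_H hst.mem_U
    have hx' := represents_mk hN hsp.mem_H hsp.mem_U
    have e1 := (isSubstep_iff sys (k / 2) hx hx hy).1 hst
    have e2 := (isSubstep_iff sys k hx hy hx').1 hsp
    rw [e1] at e2
    have e3 : eulerSeq sys k (stateOf N η₀ u₀) (n + 1) = _ := e2.symm
    rw [e3]
    exact hx'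

theorem exists_isImprovedEuler (sys : System) (M : ℕ) (k : ℝ) (η₀ u₀ : ℝ → ℝ) :
    ∃ H U Hs Us : ℕ → ℝ → ℝ, IsImprovedEuler sys N M k η₀ u₀ H U Hs Us := by
  have hN : 0 < N := Nat.pos_of_neZero N
  set X := eulerSeq sys k (stateOf N η₀ u₀)
  set Y : ℕ → State N := fun n => X n + (k / 2) • semiField N sys (X n)
  refine ⟨fun n => plFun N (X n).H, fun n => plFun N (X n).U, fun n => plFun N (Y n).H,
    fun n => plFun N (Y n).U, fun n _ => (represents_plFun hN _).mem_H,
    fun n _ => (represents_plFun hN _).mem_U, fun x _ => ?_, fun x _ => ?_, fun n _ => ?_,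
    fun n _ => ?_⟩
  · rw [interp_eq_plFun, plFun, plFun]
    refine sum_congr rfl fun j hj => ?_
    have : (X 0).H j = nodal N η₀ j := H_stateOf _ _ (by rw [mem_range] at hj; omega)
    rw [this]
  · rw [interp0_eq_plFun]
    rfl
  · exact (isSubstep_iff sys (k / 2) (represents_plFun hN _) (represents_plFun hN _)
      (represents_plFun hN _)).2 rfl
  · exact (isSubstep_iff sys k (represents_plFun hN _) (represents_plFun hN _)
      (represents_plFun hN _)).2 rfl

end Scheme

/-! ### A continuous increasing majorant -/

/-- Bounds `b n` that hold on the ranges `μ ≤ n` are dominated by a continuous strictly increasing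
function. -/
theorem exists_continuous_strictMono_majorant (b : ℕ → ℝ) :
    ∃ C : ℝ → ℝ, ContinuousOn C (Set.Ici 0) ∧ StrictMonoOn C (Set.Ici 0) ∧
      ∀ μ, 0 ≤ μ → b ⌈μ⌉₊ ≤ C μ := by
  set β : ℕ → ℝ := fun n => 1 + ∑ i ∈ range (n + 1), |b i|
  have hβ : Monotone β := fun m n hmn => by
    have : ∑ i ∈ range (m + 1), |b i| ≤ ∑ i ∈ range (n + 1), |b i| :=
      sum_le_sum_of_subset_of_nonneg (range_mono (by omega)) fun _ _ _ => abs_nonneg _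
    simp only [β]; linarith
  have hβ1 : ∀ n, 1 ≤ β n := fun n => by
    have : 0 ≤ ∑ i ∈ range (n + 1), |b i| := sum_nonneg fun _ _ => abs_nonneg _
    simp only [β]; linarith
  have hbβ : ∀ n, b n ≤ β n := fun n => by
    have := single_le_sum (f := fun i => |b i|) (fun _ _ => abs_nonneg _) (self_mem_range_succ n)
    simp only [β]
    linarith [le_abs_self (b n)]
  set g : ℝ → ℝ := fun s => β ⌈s⌉₊
  have hg : Monotone g := hβ.comp Nat.ceil_mono
  have hint : ∀ x y, IntervalIntegrable g MeasureTheory.volume x y := fun x y =>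
    hg.intervalIntegrable
  -- the primitive is continuous, and it dominates `g μ` by monotonicity of `g` on `[μ, μ + 1]`
  refine ⟨fun μ => ∫ s in (0 : ℝ)..(μ + 1), g s, ?_, ?_, ?_⟩
  · have : Continuous fun y => ∫ s in (0 : ℝ)..y, g s :=
      intervalIntegral.continuous_primitive hint 0
    exact (this.comp (continuous_id.add continuous_const)).continuousOn
  · intro x _ y _ hxy
    have h1 := intervalIntegral.integral_add_adjacent_intervals (hint 0 (x + 1))
      (hint (x + 1) (y + 1))
    have h2 : ∫ _ in (x + 1)..(y + 1), (1 : ℝ) ≤ ∫ s in (x + 1)..(y + 1), g s :=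
      intervalIntegral.integral_mono_on (by linarith) (by simp) (hint _ _)
        fun s _ => hβ1 _
    rw [intervalIntegral.integral_const, smul_eq_mul, mul_one] at h2
    simp only
    linarith
  · intro μ hμ
    have h1 := intervalIntegral.integral_add_adjacent_intervals (hint 0 μ) (hint μ (μ + 1))
    have h2 : 0 ≤ ∫ s in (0 : ℝ)..μ, g s :=
      intervalIntegral.integral_nonneg hμ fun s _ => zero_le_one.trans (hβ1 _)
    have h3 : ∫ _ in μ..(μ + 1), g μ ≤ ∫ s in μ..(μ + 1), g s :=
      intervalIntegral.integral_mono_on (by linarith) (by simp) (hint _ _)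
        fun s hs => hg hs.1
    rw [intervalIntegral.integral_const, smul_eq_mul, add_sub_cancel_left, one_mul] at h3
    have h4 : b ⌈μ⌉₊ ≤ g μ := hbβ _
    simp only
    linarith

/-! ### The error bound -/

/-- Every solution of the scheme has errors at most `B h^{3/2}` and `B h`, where `h = 1 / N`. -/
def ErrorBound (sys : System) (T : ℝ) (η u : ℝ → ℝ → ℝ) (N M : ℕ) (B : ℝ) : Prop :=
  ∀ H U Hs Us : ℕ → ℝ → ℝ,
    IsImprovedEuler sys N M (T / M) (fun x => η x 0) (fun x => u x 0) H U Hs Us → ∀ n ≤ M,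
      l2Norm (fun x => H n x - η x (n * (T / M))) ≤ B * √(1 / N) ^ 3 ∧
      h1Norm (fun x => U n x - u x (n * (T / M))) ≤ B * √(1 / N) ^ 2

theorem ErrorBound.mono {sys : System} {T : ℝ} {η u : ℝ → ℝ → ℝ} {N M : ℕ} {B B' : ℝ}
    (h : ErrorBound sys T η u N M B) (hB : B ≤ B') : ErrorBound sys T η u N M B' := by
  intro H U Hs Us hs n hn
  obtain ⟨h1, h2⟩ := h H U Hs Us hs n hn
  exact ⟨h1.trans (by gcongr), h2.trans (by gcongr)⟩

theorem errorBound_of_norm_le {sys : System} {T K D : ℝ} (hT : 0 < T) {η u : ℝ → ℝ → ℝ}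
    (hsol : IsSolution sys 5 T η u) (hη : TimeRegular T K η) (hu : TimeRegular T K u) {N M : ℕ}
    [NeZero N] (hM : 0 < M)
    (hD : ∀ n ≤ M, ‖eulerSeq sys (T / M) (stateOf N (fun x => η x 0) (fun x => u x 0)) n
      - stateOf N (fun x => η x (n * (T / M))) (fun x => u x (n * (T / M)))‖
        ≤ D * √(1 / N) ^ 3) :
    ErrorBound sys T η u N M (10 * D + 4 * K) := by
  intro H U Hs Us hs n hn
  have hN1 : (1 : ℝ) ≤ N := by exact_mod_cast Nat.pos_of_neZero N
  have hM' : (0 : ℝ) < M := by exact_mod_cast hM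
  have hn' : (n : ℝ) ≤ M := by exact_mod_cast hn
  have ht : (n : ℝ) * (T / M) ∈ Set.Icc 0 T := by
    refine ⟨by positivity, ?_⟩
    rw [mul_div_left_comm]
    exact mul_le_of_le_one_right hT.le (div_le_one_of_le₀ hn' hM'.le)
  have bη := hη.bound 0 (by norm_num) _ ht
  have bu := hu.bound 0 (by norm_num) _ ht
  simp only [Function.iterate_zero, id] at bη bu
  have hK : 0 ≤ K := (abs_nonneg _).trans (bη.le0 0 (by simp))
  have hrep := hs.represents n hn
  have h1 := l2Norm_sub_le (e := fun x => u x (n * (T / M))) hrep bη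
  have h2 := h1Norm_sub_le (d := fun x => η x (n * (T / M))) hrep bu (hsol.bc_left _ ht)
    (hsol.bc_right _ ht)
  have h3 := hD n hn
  obtain ⟨s, hs⟩ : ∃ s, s = √(1 / (N : ℝ)) := ⟨_, rfl⟩
  have hs0 : 0 < s := hs ▸ Real.sqrt_pos.2 (by positivity)
  have hs2 : 1 / (N : ℝ) = s ^ 2 := by rw [hs, Real.sq_sqrt (by positivity)]
  have hs1 : s ≤ 1 := by
    rw [hs]; exact Real.sqrt_le_one.2 (div_le_one_of_le₀ hN1 (by positivity))
  have hD0 : 0 ≤ D := by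
    have := (norm_nonneg _).trans h3
    rw [← hs] at this
    exact nonneg_of_mul_nonneg_left this (by positivity)
  rw [← hs] at h3 ⊢
  rw [hs2] at h1 h2
  constructor
  · have e1 : K * (s ^ 2) ^ 2 ≤ K * s ^ 3 := by
      rw [← pow_mul]
      gcongr K * ?_
      exact pow_le_pow_of_le_one hs0.le hs1 (by norm_num)
    have e2 : 0 ≤ D * s ^ 3 := by positivity
    have e3 : 0 ≤ K * s ^ 3 := by positivity
    linarith
  · have e1 : D * s ^ 3 ≤ D * s ^ 2 := by
      gcongr D * ?_
      exact pow_le_pow_of_le_one hs0.le hs1 (by norm_num)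
    linarith

/-- Without uniformity in the mesh, an error bound holds because the discrete solution is unique. -/
theorem exists_errorBound {sys : System} {T : ℝ} (hT : 0 < T) {η u : ℝ → ℝ → ℝ}
    (hsol : IsSolution sys 5 T η u) {N M : ℕ} (hN : 0 < N) (hM : 0 < M) :
    ∃ B, ErrorBound sys T η u N M B := by
  have : NeZero N := ⟨hN.ne'⟩
  have hN' : (0 : ℝ) < N := by exact_mod_cast hN
  obtain ⟨K, -, hη, hu, -⟩ := hsol.exists_consistentCurve hT
  set err : ℕ → ℝ := fun n =>
    ‖eulerSeq sys (T / M) (stateOf N (fun x => η x 0) (fun x => u x 0)) n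
      - stateOf N (fun x => η x (n * (T / M))) (fun x => u x (n * (T / M)))‖
  have hs : 0 < √(1 / (N : ℝ)) ^ 3 := by positivity
  refine ⟨_, errorBound_of_norm_le (D := (∑ n ∈ range (M + 1), err n) / √(1 / (N : ℝ)) ^ 3) hT
    hsol hη hu hM fun n hn => ?_⟩
  rw [div_mul_cancel₀ _ hs.ne']
  exact single_le_sum (f := err) (fun _ _ => norm_nonneg _) (mem_range.2 (by omega))

theorem exists_uniform_errorBound {sys : System} {T m : ℝ} (hT : 0 < T) (hm : 0 ≤ m)
    {η u : ℝ → ℝ → ℝ} (hsol : IsSolution sys 5 T η u) :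
    ∃ B h₁ : ℝ, 0 < h₁ ∧ ∀ N M : ℕ, 0 < N → 0 < M → 1 / (N : ℝ) ≤ h₁ →
      (T / M) ^ 3 ≤ m ^ 3 * (1 / (N : ℝ)) ^ 4 → ErrorBound sys T η u N M B := by
  obtain ⟨K, hK, hη, hu, hcons⟩ := hsol.exists_consistentCurve hT
  obtain ⟨D, h₁, -, hh₁, hD⟩ := exists_norm_eulerSeq_sub_le hT hK hm
  refine ⟨10 * D + 4 * K, h₁, hh₁, fun N M hN hM hle hk => ?_⟩
  have : NeZero N := ⟨hN.ne'⟩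
  have hE := hD N M hM hle hk sys _ _ (hcons N)
  refine errorBound_of_norm_le hT hsol hη hu hM fun n hn => ?_
  exact hE n hn

/-- The threshold for the mesh length can be taken independent of `m`: for `m > 1` only finitely
many pairs `(N, M)` violate both `h ≤ h₁(m)` and `k³ ≤ h⁴`. -/
theorem exists_errorBound_threshold {sys : System} {T : ℝ} (hT : 0 < T) {η u : ℝ → ℝ → ℝ}
    (hsol : IsSolution sys 5 T η u) :
    ∃ (h₀ : ℝ) (b : ℕ → ℝ), 0 < h₀ ∧ (∀ m, 0 ≤ b m) ∧ ∀ (m N M : ℕ), 0 < N → 0 < M →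
      1 / (N : ℝ) ≤ h₀ → (T / M) ^ 3 ≤ (m : ℝ) ^ 3 * (1 / (N : ℝ)) ^ 4 →
      ErrorBound sys T η u N M (b m) := by
  obtain ⟨B₀, h₀, hh₀, hB₀⟩ := exists_uniform_errorBound (m := 1) hT zero_le_one hsol
  have huni := fun m : ℕ => exists_uniform_errorBound (m := m) hT (Nat.cast_nonneg m) hsol
  choose B h₁ hh₁ hB using huni
  have hind : ∀ N M : ℕ, ∃ b, 0 < N → 0 < M → ErrorBound sys T η u N M b := fun N M => by
    by_cases h : 0 < N ∧ 0 < M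
    · obtain ⟨b, hb⟩ := exists_errorBound hT hsol h.1 h.2
      exact ⟨b, fun _ _ => hb⟩
    · exact ⟨0, fun h1 h2 => absurd ⟨h1, h2⟩ h⟩
  choose c hc using hind
  -- coarse meshes with large time steps
  set S : ℕ → ℝ := fun m => ∑ N ∈ range (⌈1 / h₁ m⌉₊ + 1),
    ∑ M ∈ range (⌈T ^ 3 / h₁ m ^ 4⌉₊ + 1), |c N M|
  have hS : ∀ m, 0 ≤ S m := fun m => sum_nonneg fun _ _ => sum_nonneg fun _ _ => abs_nonneg _
  refine ⟨h₀, fun m => |B₀| + |B m| + S m, hh₀, fun m => by have := hS m; positivity,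
    fun m N M hN hM hle hk => ?_⟩
  have hN' : (0 : ℝ) < N := by exact_mod_cast hN
  have hM' : (0 : ℝ) < M := by exact_mod_cast hM
  have hM1 : (1 : ℝ) ≤ M := by exact_mod_cast hM
  have hSm := hS m
  by_cases h1 : 1 / (N : ℝ) ≤ h₁ m
  · refine (hB m N M hN hM h1 hk).mono ?_
    linarith [abs_nonneg B₀, le_abs_self (B m)]
  by_cases h2 : (T / M) ^ 3 ≤ 1 ^ 3 * (1 / (N : ℝ)) ^ 4
  · refine (hB₀ N M hN hM hle h2).mono ?_
    linarith [le_abs_self B₀, abs_nonneg (B m)]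
  push Not at h1 h2
  have hpos := hh₁ m
  have hNle : (N : ℝ) ≤ 1 / h₁ m := by
    rw [le_div_iff₀ hpos]
    rw [lt_div_iff₀ hN'] at h1
    linarith
  have hMle : (M : ℝ) ≤ T ^ 3 / h₁ m ^ 4 := by
    rw [le_div_iff₀ (by positivity)]
    have h3 : h₁ m ^ 4 ≤ (T / M) ^ 3 := by
      calc h₁ m ^ 4 ≤ (1 / (N : ℝ)) ^ 4 := by gcongr
        _ ≤ _ := by linarith
    rw [div_pow, le_div_iff₀ (by positivity)] at h3
    calc M * h₁ m ^ 4 ≤ M ^ 3 * h₁ m ^ 4 := by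
          gcongr
          exact le_self_pow₀ hM1 (by norm_num)
      _ ≤ _ := by linarith
  refine (hc N M hN hM).mono ?_
  have h4 : N ∈ range (⌈1 / h₁ m⌉₊ + 1) := by
    rw [mem_range, Nat.lt_succ_iff]
    exact_mod_cast hNle.trans (Nat.le_ceil _)
  have h5 : M ∈ range (⌈T ^ 3 / h₁ m ^ 4⌉₊ + 1) := by
    rw [mem_range, Nat.lt_succ_iff]
    exact_mod_cast hMle.trans (Nat.le_ceil _)
  have h6 : |c N M| ≤ S m :=
    (single_le_sum (f := fun M => |c N M|) (fun _ _ => abs_nonneg _) h5).trans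
      (single_le_sum (f := fun N => ∑ M ∈ range (⌈T ^ 3 / h₁ m ^ 4⌉₊ + 1), |c N M|)
        (fun _ _ => sum_nonneg fun _ _ => abs_nonneg _) h4)
  linarith [le_abs_self (c N M), abs_nonneg B₀, abs_nonneg (B m)]

end

end

end Boussinesq

theorem proposition4p2 :
    -- `r` is the order of smoothness that suffices
    ∃ r : ℕ, ∀ (sys : Boussinesq.System) (T : ℝ), 0 < T →
      ∀ η u : ℝ → ℝ → ℝ, Boussinesq.IsSolution sys r T η u →
        ∃ (C : ℝ → ℝ) (h₀ : ℝ),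
          ContinuousOn C (Set.Ici 0) ∧ StrictMonoOn C (Set.Ici 0) ∧ 0 < h₀ ∧
          ∀ N M : ℕ, 0 < N → 0 < M →
            ∀ h k μ : ℝ, h = 1 / (N : ℝ) → k = T / (M : ℝ) → μ = k / h ^ (4 / 3 : ℝ) → h ≤ h₀ →
              (∃ H U Hs Us : ℕ → ℝ → ℝ, Boussinesq.IsImprovedEuler sys N M k
                (fun x => η x 0) (fun x => u x 0) H U Hs Us) ∧
              ∀ H U Hs Us : ℕ → ℝ → ℝ, Boussinesq.IsImprovedEuler sys N M k
                (fun x => η x 0) (fun x => u x 0) H U Hs Us →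
                ∀ n ≤ M,
                  Boussinesq.l2Norm (fun x => H n x - η x ((n : ℝ) * k))
                      ≤ C μ * (k ^ 2 + h ^ (3 / 2 : ℝ)) ∧
                  Boussinesq.h1Norm (fun x => U n x - u x ((n : ℝ) * k))
                      ≤ C μ * (k ^ 2 + h) := by
  refine ⟨5, fun sys T hT η u hsol => ?_⟩
  obtain ⟨h₀, b, hh₀, hb, hbound⟩ := Boussinesq.exists_errorBound_threshold hT hsol
  obtain ⟨C, hCc, hCm, hC⟩ := Boussinesq.exists_continuous_strictMono_majorant b
  refine ⟨C, h₀, hCc, hCm, hh₀, fun N M hN hM h k μ hh hk hμ hle => ⟨?_, ?_⟩⟩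
  · have : NeZero N := ⟨hN.ne'⟩
    exact Boussinesq.exists_isImprovedEuler sys M k _ _
  intro H U Hs Us hs n hn
  have hN' : (0 : ℝ) < N := by exact_mod_cast hN
  have hM' : (0 : ℝ) < M := by exact_mod_cast hM
  have hh0 : 0 < h := by rw [hh]; positivity
  have hk0 : 0 < k := by rw [hk]; positivity
  have hμ0 : 0 ≤ μ := by rw [hμ]; positivity
  have hcond : (T / M) ^ 3 ≤ (⌈μ⌉₊ : ℝ) ^ 3 * (1 / (N : ℝ)) ^ 4 := by
    rw [← hk, ← hh]
    have h1 : k = μ * h ^ (4 / 3 : ℝ) := by rw [hμ]; field_simp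
    have h2 : (h ^ (4 / 3 : ℝ)) ^ 3 = h ^ 4 := by
      rw [← Real.rpow_natCast, ← Real.rpow_mul hh0.le, ← Real.rpow_natCast]
      norm_num
    rw [h1, mul_pow, h2]
    gcongr
    exact Nat.le_ceil μ
  rw [hh] at hle
  rw [hk] at hs
  obtain ⟨e1, e2⟩ := hbound ⌈μ⌉₊ N M hN hM hle hcond H U Hs Us hs n hn
  have hCμ := hC μ hμ0
  have hCμ0 : 0 ≤ C μ := (hb _).trans hCμ
  rw [← hk, ← hh] at e1 e2
  have hs3 : √h ^ 3 = h ^ (3 / 2 : ℝ) := by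
    rw [Real.sqrt_eq_rpow, ← Real.rpow_natCast, ← Real.rpow_mul hh0.le]
    norm_num
  rw [hs3] at e1
  rw [Real.sq_sqrt hh0.le] at e2
  have hk2 : 0 ≤ C μ * k ^ 2 := by positivity
  constructor
  · calc _ ≤ b ⌈μ⌉₊ * h ^ (3 / 2 : ℝ) := e1
      _ ≤ C μ * h ^ (3 / 2 : ℝ) := by gcongr
      _ ≤ _ := by linarith
  · calc _ ≤ b ⌈μ⌉₊ * h := e2
      _ ≤ C μ * h := by gcongr
      _ ≤ _ := by linarith
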